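/- Let $\mathbb K$ be $\mathbb R$ (smooth category) or $\mathbb C$ (holomorphic category), $r\ge 2$, and let $M\subseteq\mathbb K^r$ be open with a Frobenius manifold structure of charge $d\neq 1$: metric $\Pi$, product $\circ$, identity $e$, Euler field $E$. Suppose that the standard coordinates $(t^1,\dots,t^r)$ are flat for $\Pi$ with $e=\partial_{t^r}$, that the potential has the standard form $$F(t)=\tfrac12 (t^r)^2t^1+\tfrac12 t^r\sum_{i=2}^{r-1}t^it^{r-i+1}+G(t^1,\dots,t^{r-1})$$ (so $\Pi_{ij}=\delta_{i+j,r+1}$), and that $E=\sum_i d_it^i\partial_{t^i}$, $E F=(3-d)F$, $d_r=1$ and $d_i\ne d_1/2$ for all $i$. Let $\Omega_1$ be the inverse of $\Pi$, let $\Omega_2^{ij}=E(dt^i\circ dt^j)$ be the intersection form, and $\tau=t^1$, so that $e=\nabla_1\tau$ and $E=\nabla_2\tau$, where $(\nabla_a\tau)^i=\Omega_a^{ij}\partial_j\tau$. A conjugate of the given structure on an open set $U\subseteq M\setminus\{t^1=0\}$, for a branch $f(\tau)=\tau^{2/(1-d)}$, is a Frobenius manifold structure of charge $2-d$ on $U$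 with intersection form $\Omega_2$, contravariant metric $\widetilde\Omega_1=\mathrm{Lie}_{f(\tau)e}\Omega_2$, identity $\widetilde\nabla_1(-\tau)$ and Euler field $\nabla_2(-\tau)$. Branches of powers: let $\Lambda\subseteq\mathbb K\setminus\{0\}$ be open and $\ell:\Lambda\to\mathbb K$ smooth (holomorphic) with $e^{\ell(x)}=x^2$, for instance $\ell=2\log x$, or $\ell = 2\log|x|$ on $\mathbb R\setminus\{0\}$. Write $[x]^a:=e^{a\ell(x)/2}$, a branch of $(x^2)^{a/2}$. Every point of $M\setminus\{t^1=0\}$ lies in $U:=\{t\in M: t^1\in\Lambda\}$ for some such $(\Lambda,\ell)$, and for all such $(\Lambda,\ell)$ the following holds. 1. A conjugate Frobenius structure, with $f(\tau)=[\tau]^{2/(1-d)}$, exists on $U$. 2. For every such conjugate structure, the functions $$s^1=-t^1,\qquad s^i=t^i\,t^1[t^1]^{-2d_i/d_1}\ (1<i<r),\qquad s^r=\tfrac12\Big(\sum_{i=1}^r t^it^{r-i+1}\Big)(t^1)^{-1}[t^1]^{-2/d_1}$$ are flat coordinates on $U$, in which its metric is $\delta_{i+j,r+1}$ and its identity is $\partial_{s^r}$,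 and $$\widetilde F(s)=[t^1]^{-4/d_1}\Big(F(t)-\tfrac12t^r\sum_{i=1}^r t^it^{r-i+1}\Big)$$ is a potential for it in these coordinates; so the product is unique. 3. $\widetilde F(s)$ is the potential obtained from $F$ by Dubrovin's inversion, that is, by $$z^1=-\frac1{t^1},\quad z^k=\frac{t^k}{t^1}\ (1<k<r),\quad z^r=\frac1{2t^1}\sum_i t^it^{r-i+1},\qquad \widehat F(z)=(t^1)^{-2}\Big(F(t)-\tfrac12t^r\sum_i t^it^{r-i+1}\Big),$$ at $z=s$, where $F$ is continued by homogeneity along the Euler flow if necessary. Precisely: let $t\in U$, let $N$ be open and contain all points $(e^{d_iu\sigma}t^i)_i$ with $0\le u\le1$ and $\sigma=-\ell(t^1)/d_1$, and let $F'$ be smooth (holomorphic) on $N$ with $\sum_i d_iq^i\partial_{q^i} F'=(3-d)F'$ and $F'(t)=F(t)$ (for instance $N=M$, $F'=F$, if $M$ contains these points). Then $s(t)$ is the $z$-image of a point of $N\setminus\{q^1=0\}$, and the inversion $\widehat{F'}$ of $F'$ satisfies $\widehat{F'}(s(t))=\widetilde F(s(t))$. -/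

import Mathlib

open Set Filter Topology
open scoped ContDiff

noncomputable section

/-! Frobenius structures on open subsets of `𝕜ʳ`, where `r = m + 1` and `𝕜` is `ℝ` (smooth structures)
or `ℂ` (holomorphic structures). Tensor fields are given by their components in the standard
coordinates of `𝕜ʳ`; flat coordinates are arbitrary other coordinate systems. The index `i` of the
mathematical text, `1 ≤ i ≤ r`, is `i - 1 : Fin r` here; `Fin.rev` is `i ↦ r - i + 1`. -/

/-- Points of `𝕜ʳ`, and also tangent vectors. -/
abbrev Pt (𝕜 : Type*) (r : ℕ) := Fin r → 𝕜

section Coordinates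

variable {𝕜 : Type*} [RCLike 𝕜] {r : ℕ}

/-- The partial derivative `∂f/∂uⁱ` in the standard coordinates. -/
def pd (i : Fin r) (f : Pt 𝕜 r → 𝕜) (p : Pt 𝕜 r) : 𝕜 :=
  fderiv 𝕜 f p (Pi.single i 1)

/-- The functions `(x¹, …, xʳ)` are a coordinate system on the open set `W`. -/
def IsCoordinateSystem (W : Set (Pt 𝕜 r)) (x : Pt 𝕜 r → Pt 𝕜 r) : Prop :=
  ContDiffOn 𝕜 ∞ x W ∧ InjOn x W ∧ ∀ p ∈ W, (fderiv 𝕜 x p).IsInvertible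

/-- The coordinate vector field `∂/∂xⁱ` of a coordinate system `x`: it satisfies
`dxʲ(∂/∂xⁱ) = δᵢʲ`. -/
def coordField (x : Pt 𝕜 r → Pt 𝕜 r) (i : Fin r) (p : Pt 𝕜 r) : Pt 𝕜 r :=
  (fderiv 𝕜 x p).inverse (Pi.single i 1)

/-- The partial derivative `∂f/∂xⁱ` of a function with respect to a coordinate system `x`. -/
def coordDeriv (x : Pt 𝕜 r → Pt 𝕜 r) (i : Fin r) (f : Pt 𝕜 r → 𝕜) (p : Pt 𝕜 r) : 𝕜 :=
  fderiv 𝕜 f p (coordField x i p)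

/-- The Lie derivative of a contravariant 2-tensor `Ω` along the vector field `X`. -/
def lieContra (X : Pt 𝕜 r → Pt 𝕜 r) (Ω : Pt 𝕜 r → Matrix (Fin r) (Fin r) 𝕜) (p : Pt 𝕜 r) :
    Matrix (Fin r) (Fin r) 𝕜 :=
  Matrix.of fun i j =>
    fderiv 𝕜 (fun q => Ω q i j) p (X p)
      - ∑ l, Ω p l j * pd l (fun q => X q i) p
      - ∑ l, Ω p i l * pd l (fun q => X q j) p

/-- The gradient `∇τ` of a function with respect to a contravariant 2-tensor:
`(∇τ)ⁱ = Ωⁱʲ ∂ⱼτ`. -/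
def gradField (Ω : Pt 𝕜 r → Matrix (Fin r) (Fin r) 𝕜) (τ : Pt 𝕜 r → 𝕜) (p : Pt 𝕜 r) : Pt 𝕜 r :=
  fun i => ∑ j, Ω p i j * pd j τ p

end Coordinates

/-- The data of a Frobenius structure: the metric `Π`, the structure functions
`c p i j k = Cᵢⱼᵏ(p)` of the multiplication, the identity field `e`, the Euler field `E` and the
charge `d`. The laws are in `IsFrobenius`. -/
structure FrobeniusData (𝕜 : Type*) (r : ℕ) where
  metric : Pt 𝕜 r → Matrix (Fin r) (Fin r) 𝕜
  c : Pt 𝕜 r → Fin r → Fin r → Fin r → 𝕜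
  unit : Pt 𝕜 r → Pt 𝕜 r
  euler : Pt 𝕜 r → Pt 𝕜 r
  charge : 𝕜

namespace FrobeniusData

variable {𝕜 : Type*} [RCLike 𝕜] {r : ℕ} (S : FrobeniusData 𝕜 r)

/-- The multiplication of tangent vectors at `p`. -/
def mul (p v w : Pt 𝕜 r) : Pt 𝕜 r :=
  fun k => ∑ i, ∑ j, S.c p i j k * v i * w j

/-- The bilinear form `Π` at `p`. -/
def pair (p v w : Pt 𝕜 r) : 𝕜 :=
  ∑ i, ∑ j, S.metric p i j * v i * w j

/-- The contravariant metric `Ω₁`, the inverse of `Π`. -/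
def cometric (p : Pt 𝕜 r) : Matrix (Fin r) (Fin r) 𝕜 := (S.metric p)⁻¹

/-- The intersection form `Ω₂ⁱʲ = E(duⁱ ∘ duʲ)`, where covectors are multiplied after raising
indices by `Ω₁`. -/
def intersectionForm (p : Pt 𝕜 r) : Matrix (Fin r) (Fin r) 𝕜 :=
  Matrix.of fun i j => S.pair p (S.mul p (S.cometric p i) (S.cometric p j)) (S.euler p)

end FrobeniusData

section Frobenius

variable {𝕜 : Type*} [RCLike 𝕜] {m : ℕ}

/-- `x` are flat coordinates on `W` for the metric of `S`, normalised as usual by `e = ∂/∂xʳ`. -/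
def IsFlatCoordinates (W : Set (Pt 𝕜 (m + 1))) (S : FrobeniusData 𝕜 (m + 1))
    (x : Pt 𝕜 (m + 1) → Pt 𝕜 (m + 1)) : Prop :=
  IsCoordinateSystem W x ∧
  (∃ η : Matrix (Fin (m + 1)) (Fin (m + 1)) 𝕜, ∀ p ∈ W, ∀ i j,
    S.pair p (coordField x i p) (coordField x j p) = η i j) ∧
  ∀ p ∈ W, S.unit p = coordField x (Fin.last m) p

/-- `F` is a potential of `S` on `W` in the flat coordinates `x`:
`Π(∂ᵢ ∘ ∂ⱼ, ∂ₖ) = ∂ᵢ∂ⱼ∂ₖ F`, and `E F = (3 - d) F + ½ Aᵢⱼ xⁱ xʲ + Bᵢ xⁱ + c₀`.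
(For `k = r` the first equation reads `Π(∂ᵢ, ∂ⱼ) = ∂ᵣ∂ᵢ∂ⱼ F`.) -/
def IsPotential (W : Set (Pt 𝕜 (m + 1))) (S : FrobeniusData 𝕜 (m + 1))
    (x : Pt 𝕜 (m + 1) → Pt 𝕜 (m + 1)) (F : Pt 𝕜 (m + 1) → 𝕜) : Prop :=
  ContDiffOn 𝕜 ∞ F W ∧
  (∀ p ∈ W, ∀ i j k,
    S.pair p (S.mul p (coordField x i p) (coordField x j p)) (coordField x k p)
      = coordDeriv x i (coordDeriv x j (coordDeriv x k F)) p) ∧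
  ∃ (A : Matrix (Fin (m + 1)) (Fin (m + 1)) 𝕜) (B : Fin (m + 1) → 𝕜) (c₀ : 𝕜), ∀ p ∈ W,
    fderiv 𝕜 F p (S.euler p)
      = (3 - S.charge) * F p + (1 / 2) * ∑ i, ∑ j, A i j * x p i * x p j + ∑ i, B i * x p i + c₀

/-- `S` is a Frobenius manifold structure of charge `S.charge` on the open set `U`: a smooth
family of Frobenius algebras on the tangent spaces with a flat metric, a covariantly constant
identity, an Euler vector field and, near every point, a potential. -/
structure IsFrobenius (U : Set (Pt 𝕜 (m + 1))) (S : FrobeniusData 𝕜 (m + 1)) : Prop where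
  isOpen : IsOpen U
  smooth_metric : ∀ i j, ContDiffOn 𝕜 ∞ (fun p => S.metric p i j) U
  smooth_mul : ∀ i j k, ContDiffOn 𝕜 ∞ (fun p => S.c p i j k) U
  smooth_unit : ContDiffOn 𝕜 ∞ S.unit U
  smooth_euler : ContDiffOn 𝕜 ∞ S.euler U
  /-- the bilinear form is symmetric and nondegenerate -/
  metric_symm : ∀ p ∈ U, ∀ v w, S.pair p v w = S.pair p w v
  metric_nondeg : ∀ p ∈ U, IsUnit (S.metric p).det
  /-- commutative associative algebra with identity `e` -/
  mul_comm : ∀ p ∈ U, ∀ v w, S.mul p v w = S.mul p w v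
  mul_assoc : ∀ p ∈ U, ∀ v w z, S.mul p (S.mul p v w) z = S.mul p v (S.mul p w z)
  unit_mul : ∀ p ∈ U, ∀ v, S.mul p (S.unit p) v = v
  /-- `Π(a ∘ b, c) = Π(a, b ∘ c)` -/
  pair_mul : ∀ p ∈ U, ∀ v w z, S.pair p (S.mul p v w) z = S.pair p v (S.mul p w z)
  /-- the metric is flat, the identity is parallel, there is a potential, and the Euler field is
  affine in flat coordinates -/
  flat : ∀ p ∈ U, ∃ W : Set (Pt 𝕜 (m + 1)), IsOpen W ∧ p ∈ W ∧ W ⊆ U ∧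
    ∃ (x : Pt 𝕜 (m + 1) → Pt 𝕜 (m + 1)) (F : Pt 𝕜 (m + 1) → 𝕜),
      IsFlatCoordinates W S x ∧ IsPotential W S x F ∧
      ∃ (a : Matrix (Fin (m + 1)) (Fin (m + 1)) 𝕜) (b : Fin (m + 1) → 𝕜), ∀ q ∈ W, ∀ j,
        fderiv 𝕜 x q (S.euler q) j = ∑ i, a i j * x q i + b j
  /-- `[e, E] = e` -/
  lie_unit : ∀ p ∈ U, VectorField.lieBracket 𝕜 S.unit S.euler p = S.unit p
  /-- `Lie_E Π = (2 - d) Π` -/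
  lie_metric : ∀ p ∈ U, ∀ i j,
    fderiv 𝕜 (fun q => S.metric q i j) p (S.euler p)
      + ∑ l, S.metric p l j * pd i (fun q => S.euler q l) p
      + ∑ l, S.metric p i l * pd j (fun q => S.euler q l) p
      = (2 - S.charge) * S.metric p i j
  /-- `Lie_E (∘) = ∘` -/
  lie_mul : ∀ p ∈ U, ∀ i j k,
    fderiv 𝕜 (fun q => S.c q i j k) p (S.euler p)
      - ∑ l, S.c p i j l * pd l (fun q => S.euler q k) p
      + ∑ l, S.c p l j k * pd i (fun q => S.euler q l) p
      + ∑ l, S.c p i l k * pd j (fun q => S.euler q l) p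
      = S.c p i j k

/-- `(Ω₂, Ω₁)`, with the function `τ`, is the quasihomogeneous pencil of metrics associated to the
Frobenius structure `S` on `U`: `Ω₁` is its contravariant metric, `Ω₂` its intersection form, and
`e = ∇₁τ`, `E = ∇₂τ`. -/
def IsAssociatedPencil (U : Set (Pt 𝕜 (m + 1))) (S : FrobeniusData 𝕜 (m + 1))
    (Ω₂ Ω₁ : Pt 𝕜 (m + 1) → Matrix (Fin (m + 1)) (Fin (m + 1)) 𝕜) (τ : Pt 𝕜 (m + 1) → 𝕜) : Prop :=
  ContDiffOn 𝕜 ∞ τ U ∧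
  ∀ p ∈ U, Ω₁ p = S.cometric p ∧ Ω₂ p = S.intersectionForm p ∧
    S.unit p = gradField Ω₁ τ p ∧ S.euler p = gradField Ω₂ τ p

/-- `S'` is the conjugate of the Frobenius structure `S` on `U`, with respect to the function `τ` of
the associated pencil `(Ω₂, Ω₁)` of `S`, where `e(τ) = 0` and `E(τ) = (1 - d) τ`, and to a choice
`f` of the power function `f(τ) = τ ^ (2 / (1 - d))`: it is a Frobenius structure of charge `2 - d`
on `U` whose associated pencil is the conjugate pencil `(Ω₂, Lie_{f(τ) e} Ω₂)`, with the
function `-τ`. -/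
def IsConjugate (U : Set (Pt 𝕜 (m + 1))) (S : FrobeniusData 𝕜 (m + 1)) (τ : Pt 𝕜 (m + 1) → 𝕜)
    (f : 𝕜 → 𝕜) (S' : FrobeniusData 𝕜 (m + 1)) : Prop :=
  IsAssociatedPencil U S S.intersectionForm S.cometric τ ∧
  (∀ p ∈ U, fderiv 𝕜 τ p (S.unit p) = 0 ∧
    fderiv 𝕜 τ p (S.euler p) = (1 - S.charge) * τ p) ∧
  IsFrobenius U S' ∧
  S'.charge = 2 - S.charge ∧
  IsAssociatedPencil U S' S.intersectionForm
    (lieContra (fun p => f (τ p) • S.unit p) S.intersectionForm) (fun p => -τ p)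

end Frobenius

section Powers

variable {𝕜 : Type*} [RCLike 𝕜]

/-- `ℓ` is a smooth branch of `log (x²)` on the open set `Λ`, which does not contain `0`. Over `ℂ`
one can take `ℓ = 2 log` for a branch of the logarithm, over `ℝ` the function `2 log |x|` on all of
`ℝ \ {0}`. -/
structure IsLogSqBranch (Λ : Set 𝕜) (ℓ : 𝕜 → 𝕜) : Prop where
  isOpen : IsOpen Λ
  zero_notMem : (0 : 𝕜) ∉ Λ
  smooth : ContDiffOn 𝕜 ∞ ℓ Λ
  exp_eq : ∀ x ∈ Λ, NormedSpace.exp (ℓ x) = x ^ 2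

/-- The branch `(x²) ^ (a / 2) = exp (a ℓ(x) / 2)` of the power `x ^ a` given by a branch `ℓ` of
`log (x²)`. -/
def powBranch (ℓ : 𝕜 → 𝕜) (a x : 𝕜) : 𝕜 := NormedSpace.exp (a / 2 * ℓ x)

end Powers

section Inversion

variable {𝕜 : Type*} [RCLike 𝕜] {m : ℕ}

/-- The quadratic form `∑ᵢ tⁱ tʳ⁻ⁱ⁺¹` of the antidiagonal metric. -/
def antiQuad (t : Pt 𝕜 (m + 1)) : 𝕜 := ∑ i, t i * t (Fin.rev i)

/-- The coordinates of the conjugate structure, where `d` are the degrees: `s¹ = -t¹`,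
`sⁱ = tⁱ (t¹) ^ ((d₁ - 2dᵢ)/d₁)` for `1 < i < r`,
and `sʳ = ½ ∑ᵢ tⁱ tʳ⁻ⁱ⁺¹ (t¹) ^ (-2/d₁ - 1)`; an exponent `a ± 1` is read as the branch of
the exponent `a` times `(t¹) ^ (± 1)`. -/
def conjCoord (d : Fin (m + 1) → 𝕜) (ℓ : 𝕜 → 𝕜) (t : Pt 𝕜 (m + 1)) : Pt 𝕜 (m + 1) :=
  fun i =>
    if i = 0 then -t 0
    else if i = Fin.last m then
      (1 / 2) * antiQuad t * (powBranch ℓ (-2 / d 0) (t 0) * (t 0)⁻¹)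
    else t i * (t 0 * powBranch ℓ (-2 * d i / d 0) (t 0))

/-- The function `(t¹) ^ (-4/d₁) (F(t) - ½ tʳ ∑ᵢ tⁱ tʳ⁻ⁱ⁺¹)`. -/
def conjPotential (d : Fin (m + 1) → 𝕜) (ℓ : 𝕜 → 𝕜) (F : Pt 𝕜 (m + 1) → 𝕜)
    (t : Pt 𝕜 (m + 1)) : 𝕜 :=
  powBranch ℓ (-4 / d 0) (t 0) * (F t - (1 / 2) * t (Fin.last m) * antiQuad t)

/-- The coordinates of Dubrovin's inversion, for the antidiagonal metric: `z¹ = -1/t¹`,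
`zᵏ = tᵏ/t¹` for `1 < k < r`, and `zʳ = ∑ᵢ tⁱ tʳ⁻ⁱ⁺¹ / (2 t¹)`. -/
def invCoord (t : Pt 𝕜 (m + 1)) : Pt 𝕜 (m + 1) :=
  fun k =>
    if k = 0 then -1 / t 0
    else if k = Fin.last m then antiQuad t / (2 * t 0)
    else t k / t 0

/-- The potential obtained by applying Dubrovin's inversion to a function `F` on `N`, as a function
of the inversion coordinates `z`: its value at `z = invCoord t`, for `t ∈ N` with `t¹ ≠ 0`, is
`(t¹)⁻² (F(t) - ½ tʳ ∑ᵢ tⁱ tʳ⁻ⁱ⁺¹)`. (On `t¹ ≠ 0` the map `invCoord` is injective.) -/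
def inversionPotential (N : Set (Pt 𝕜 (m + 1))) (F : Pt 𝕜 (m + 1) → 𝕜) (z : Pt 𝕜 (m + 1)) : 𝕜 :=
  let t := Function.invFunOn invCoord {t | t ∈ N ∧ t 0 ≠ 0} z
  ((t 0) ^ 2)⁻¹ * (F t - (1 / 2) * t (Fin.last m) * antiQuad t)

/-- The flow at time `σ` of the Euler vector field `∑ᵢ dᵢ tⁱ ∂ᵢ`. -/
def eulerFlow (d : Fin (m + 1) → 𝕜) (σ : 𝕜) (t : Pt 𝕜 (m + 1)) : Pt 𝕜 (m + 1) :=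
  fun i => NormedSpace.exp (d i * σ) * t i

end Inversion

end

/-!
The conjugate structure is written down in closed form. Let `E = ∑ dᵢ tⁱ ∂ᵢ`, and let `A` be the
reflection `v ↦ v - 2 (dt¹(v) / dt¹(E)) E` of the tangent spaces, so that `A² = 1` and `A E = -E`.
With `ρ = (t¹) ^ (-2/d₁)`, the data
`Π'(v, w) = ρ Π(Av, Aw)`, `v ∘' w = ρ A(Av ∘ Aw)`, `e' = ρ⁻¹ e`, `E' = -E`
(`conjData`) are those of the conjugate. The algebraic laws are immediate, the homogeneity laws
follow from the `E`-degrees of the components, and the pencil is compared directly, using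
`Ω₂ⁱʲ = (dᵢ + dⱼ - d₁) ∂ⁱ∂ʲF` (`lieContra_intersectionForm`, `intersectionForm_conjData`).

The origin of these formulas is the inversion: the flow of `E` at the time `σ = -ℓ(t¹)/d₁`, which
depends on the point, sends `t¹` to `1/t¹`, and the inversion coordinates of the image of `t` are
the conjugate coordinates `s(t)` (`invCoord_eulerFlow`). Since a quasihomogeneous function
is multiplied by an exponential factor along the flow (`eval_eulerFlow_of_homogeneous`), the
potential of the inversion becomes `conjPotential`.

For flatness and the potential, the field `X = ∑ vⁱ ∂/∂sⁱ` with constant `v` is computed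
explicitly (`conjField`): `X = A Y`, where `Y = frameVec` satisfies `ρ Π(Y, Y) = η(v, v)` with the
antidiagonal `η`, so that the metric is constant in the coordinates `s`. The derivatives along `X`
of `Y` and of the contractions of the derivatives of `F` with `Y` form a closed system, and
differentiating the potential three times along `X` gives `ρ² (∂³F)(Y, Y, Y)`. Polarization of this
cubic form identifies the third derivatives of `conjPotential` with the structure constants
(`isPotential_conjData`).

Uniqueness: two conjugates share their metric, unit, Euler field and intersection form. The
difference `T` of their structure constants in the coordinates `s` is totally symmetric, and so are
its first derivatives, because flat coordinates of the same metric are affine in `s`.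
Moreover `T(·, ·, e') = 0`, and `T(·, ·, E') = 0` because the intersection forms agree.
Differentiating the latter identity and using the homogeneity of `T` leads to
`(δᵢ + δⱼ + 2 - d₁) T = 0` for all pairs of indices, and the condition `dᵢ ≠ d₁/2` forces `T = 0`
(`IsConjugate.coordMul_eq`).

If `M` is empty, the degrees `dᵢ` are not related to the charge and every claim is vacuous, except
for the existence of the data; otherwise the hypotheses amount to `StandardForm`.
-/

noncomputable section

/-! ### Derivatives along a vector -/

section Calculus

variable {𝕜 : Type*} [RCLike 𝕜] {r : ℕ}

/-- `f` is differentiable at `p`, with derivative `c` along the vector `V`. -/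
def HasDirDeriv (f : Pt 𝕜 r → 𝕜) (c : 𝕜) (p V : Pt 𝕜 r) : Prop :=
  DifferentiableAt 𝕜 f p ∧ fderiv 𝕜 f p V = c

namespace HasDirDeriv

variable {f g : Pt 𝕜 r → 𝕜} {c c' : 𝕜} {p V : Pt 𝕜 r}

theorem congr_deriv (h : HasDirDeriv f c p V) (hc : c = c') : HasDirDeriv f c' p V := hc ▸ h

theorem congr_of_eventuallyEq (h : HasDirDeriv f c p V) (hg : g =ᶠ[𝓝 p] f) :
    HasDirDeriv g c p V :=
  ⟨h.1.congr_of_eventuallyEq hg, by rw [hg.fderiv_eq]; exact h.2⟩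

theorem const (a : 𝕜) (p V : Pt 𝕜 r) : HasDirDeriv (fun _ => a) 0 p V :=
  ⟨differentiableAt_const a, by simp⟩

theorem coord (i : Fin r) (p V : Pt 𝕜 r) : HasDirDeriv (fun q => q i) (V i) p V :=
  ⟨differentiableAt_apply i p, by
    rw [(hasFDerivAt_apply (𝕜 := 𝕜) i p).fderiv]; rfl⟩

theorem add (hf : HasDirDeriv f c p V) (hg : HasDirDeriv g c' p V) :
    HasDirDeriv (fun q => f q + g q) (c + c') p V :=
  ⟨hf.1.add hg.1, by
    have := (hf.1.hasFDerivAt.add hg.1.hasFDerivAt).fderiv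
    rw [show (fun q => f q + g q) = f + g from rfl, this]; simp [hf.2, hg.2]⟩

theorem mul (hf : HasDirDeriv f c p V) (hg : HasDirDeriv g c' p V) :
    HasDirDeriv (fun q => f q * g q) (c * g p + f p * c') p V :=
  ⟨hf.1.mul hg.1, by
    have := (hf.1.hasFDerivAt.mul hg.1.hasFDerivAt).fderiv
    rw [show (fun q => f q * g q) = f * g from rfl, this]; simp [hf.2, hg.2]; ring⟩

theorem const_mul (a : 𝕜) (hf : HasDirDeriv f c p V) :
    HasDirDeriv (fun q => a * f q) (a * c) p V :=
  ((const a p V).mul hf).congr_deriv (by ring)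

theorem neg (hf : HasDirDeriv f c p V) : HasDirDeriv (fun q => -f q) (-c) p V :=
  ((hf.const_mul (-1)).congr_deriv (by ring)).congr_of_eventuallyEq
    (Eventually.of_forall fun q => by simp)

theorem sub (hf : HasDirDeriv f c p V) (hg : HasDirDeriv g c' p V) :
    HasDirDeriv (fun q => f q - g q) (c - c') p V := by
  simpa [sub_eq_add_neg] using hf.add hg.neg

theorem sum {ι : Type*} {s : Finset ι} {f : ι → Pt 𝕜 r → 𝕜} {c : ι → 𝕜}
    (h : ∀ i ∈ s, HasDirDeriv (f i) (c i) p V) :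
    HasDirDeriv (fun q => ∑ i ∈ s, f i q) (∑ i ∈ s, c i) p V :=
  ⟨DifferentiableAt.fun_sum fun i hi => (h i hi).1, by
    rw [fderiv_fun_sum fun i hi => (h i hi).1, _root_.sum_apply]
    exact Finset.sum_congr rfl fun i hi => (h i hi).2⟩

theorem scomp {φ : 𝕜 → 𝕜} {φ' : 𝕜} (hφ : HasDerivAt φ φ' (f p)) (hf : HasDirDeriv f c p V) :
    HasDirDeriv (fun q => φ (f q)) (φ' * c) p V := by
  have h := hφ.comp_hasFDerivAt p hf.1.hasFDerivAt
  exact ⟨h.differentiableAt, by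
    rw [show (fun q => φ (f q)) = φ ∘ f from rfl, h.fderiv]; simp [hf.2]⟩

theorem inv (hf : HasDirDeriv f c p V) (h0 : f p ≠ 0) :
    HasDirDeriv (fun q => (f q)⁻¹) (-c * (f p)⁻¹ ^ 2) p V :=
  (scomp (hasDerivAt_inv h0) hf).congr_deriv (by field_simp)

end HasDirDeriv

theorem ContDiffOn.differentiableAt_of_isOpen {W : Set (Pt 𝕜 r)} {f : Pt 𝕜 r → 𝕜} (hW : IsOpen W)
    (hf : ContDiffOn 𝕜 ∞ f W) {p : Pt 𝕜 r} (hp : p ∈ W) : DifferentiableAt 𝕜 f p :=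
  (hf.contDiffAt (hW.mem_nhds hp)).differentiableAt (by simp)

/-! ### Coordinate vector fields -/

section CoordinateSystem

variable {W : Set (Pt 𝕜 r)} {x : Pt 𝕜 r → Pt 𝕜 r}

theorem IsCoordinateSystem.differentiableAt (hx : IsCoordinateSystem W x) (hW : IsOpen W)
    {p : Pt 𝕜 r} (hp : p ∈ W) : DifferentiableAt 𝕜 x p :=
  (hx.1.contDiffAt (hW.mem_nhds hp)).differentiableAt (by simp)

theorem IsCoordinateSystem.mono {W' : Set (Pt 𝕜 r)} (hx : IsCoordinateSystem W x)
    (h : W' ⊆ W) : IsCoordinateSystem W' x :=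
  ⟨hx.1.mono h, hx.2.1.mono h, fun p hp => hx.2.2 p (h hp)⟩

theorem fderiv_coord_apply {p : Pt 𝕜 r} (hx : DifferentiableAt 𝕜 x p) (k : Fin r) (v : Pt 𝕜 r) :
    fderiv 𝕜 (fun q => x q k) p v = fderiv 𝕜 x p v k := by
  have := (hasFDerivAt_pi'.1 hx.hasFDerivAt k).fderiv
  rw [this]; rfl

theorem IsCoordinateSystem.contDiffOn_coord (hx : IsCoordinateSystem W x) (k : Fin r) :
    ContDiffOn 𝕜 ∞ (fun q => x q k) W := contDiffOn_pi.1 hx.1 k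

theorem fderiv_coordField (hx : IsCoordinateSystem W x) {p : Pt 𝕜 r} (hp : p ∈ W) (i : Fin r) :
    fderiv 𝕜 x p (coordField x i p) = Pi.single i 1 :=
  (hx.2.2 p hp).self_apply_inverse _

theorem eq_sum_coordField (hx : IsCoordinateSystem W x) {p : Pt 𝕜 r} (hp : p ∈ W)
    (v : Pt 𝕜 r) : v = ∑ k, fderiv 𝕜 x p v k • coordField x k p := by
  apply (hx.2.2 p hp).injective
  rw [map_sum]
  simp only [map_smul, fderiv_coordField hx hp]
  exact (pi_eq_sum_univ' _)

theorem fderiv_eq_sum_coordDeriv (hx : IsCoordinateSystem W x) {p : Pt 𝕜 r} (hp : p ∈ W)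
    (f : Pt 𝕜 r → 𝕜) (v : Pt 𝕜 r) :
    fderiv 𝕜 f p v = ∑ k, fderiv 𝕜 x p v k * coordDeriv x k f p := by
  conv_lhs => rw [eq_sum_coordField hx hp v, map_sum]
  simp [coordDeriv]

theorem contDiffOn_coordField (hx : IsCoordinateSystem W x) (hW : IsOpen W) (i : Fin r) :
    ContDiffOn 𝕜 ∞ (coordField x i) W := by
  intro p hp
  have h1 : ContDiffAt 𝕜 ∞ (fderiv 𝕜 x) p :=
    (hx.1.contDiffAt (hW.mem_nhds hp)).fderiv_right (m := ∞) (by simp)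
  obtain ⟨e, he⟩ := hx.2.2 p hp
  have h2 : ContDiffAt 𝕜 ∞ ContinuousLinearMap.inverse (fderiv 𝕜 x p) := by
    rw [← he]; exact contDiffAt_map_inverse e
  exact ((h2.comp p h1).clm_apply contDiffAt_const).contDiffWithinAt

theorem contDiffOn_fderiv_apply {f : Pt 𝕜 r → 𝕜} {V : Pt 𝕜 r → Pt 𝕜 r} (hW : IsOpen W)
    (hf : ContDiffOn 𝕜 ∞ f W) (hV : ContDiffOn 𝕜 ∞ V W) :
    ContDiffOn 𝕜 ∞ (fun p => fderiv 𝕜 f p (V p)) W :=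
  (hf.fderiv_of_isOpen hW (by simp)).clm_apply hV

theorem contDiffOn_coordDeriv (hx : IsCoordinateSystem W x) (hW : IsOpen W) (i : Fin r)
    {f : Pt 𝕜 r → 𝕜} (hf : ContDiffOn 𝕜 ∞ f W) : ContDiffOn 𝕜 ∞ (coordDeriv x i f) W :=
  contDiffOn_fderiv_apply hW hf (contDiffOn_coordField hx hW i)

theorem coordDeriv_congr {f g : Pt 𝕜 r → 𝕜} (hW : IsOpen W) (h : EqOn f g W) (i : Fin r) :
    EqOn (coordDeriv x i f) (coordDeriv x i g) W := fun p hp => by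
  have : f =ᶠ[𝓝 p] g := h.eventuallyEq_of_mem (hW.mem_nhds hp)
  simp [coordDeriv, this.fderiv_eq]

/-- The derivative of a derivative `V f` splits into the second derivative of `f` and a term
with the derivative of `V`. -/
theorem fderiv_fderiv_apply {f : Pt 𝕜 r → 𝕜} {V : Pt 𝕜 r → Pt 𝕜 r} (hW : IsOpen W)
    (hf : ContDiffOn 𝕜 ∞ f W) (hV : ContDiffOn 𝕜 ∞ V W) {p : Pt 𝕜 r} (hp : p ∈ W)
    (v : Pt 𝕜 r) :
    fderiv 𝕜 (fun q => fderiv 𝕜 f q (V q)) p v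
      = fderiv 𝕜 (fderiv 𝕜 f) p v (V p) + fderiv 𝕜 f p (fderiv 𝕜 V p v) := by
  have h1 : DifferentiableAt 𝕜 (fderiv 𝕜 f) p :=
    ((hf.contDiffAt (hW.mem_nhds hp)).fderiv_right (m := ∞) (by simp)).differentiableAt (by simp)
  have h2 : DifferentiableAt 𝕜 V p := (hV.contDiffAt (hW.mem_nhds hp)).differentiableAt (by simp)
  rw [fderiv_clm_apply h1 h2]
  simp [add_comm]

theorem fderiv_fderiv_symm {f : Pt 𝕜 r → 𝕜} (hW : IsOpen W)
    (hf : ContDiffOn 𝕜 ∞ f W) {p : Pt 𝕜 r} (hp : p ∈ W) (v w : Pt 𝕜 r) :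
    fderiv 𝕜 (fderiv 𝕜 f) p v w = fderiv 𝕜 (fderiv 𝕜 f) p w v :=
  (hf.contDiffAt (hW.mem_nhds hp)).isSymmSndFDerivAt
    (by rw [minSmoothness_of_isRCLikeNormedField]; exact WithTop.coe_le_coe.2 le_top) v w

/-- Coordinate vector fields commute. -/
theorem fderiv_coordField_symm (hx : IsCoordinateSystem W x) (hW : IsOpen W) {p : Pt 𝕜 r}
    (hp : p ∈ W) (i j : Fin r) :
    fderiv 𝕜 (coordField x j) p (coordField x i p)
      = fderiv 𝕜 (coordField x i) p (coordField x j p) := by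
  apply (hx.2.2 p hp).injective
  ext k
  have key : ∀ i j, fderiv 𝕜 (fderiv 𝕜 fun q => x q k) p (coordField x i p) (coordField x j p)
      + fderiv 𝕜 (fun q => x q k) p (fderiv 𝕜 (coordField x j) p (coordField x i p)) = 0 := by
    intro i j
    rw [← fderiv_fderiv_apply hW (hx.contDiffOn_coord k) (contDiffOn_coordField hx hW j) hp]
    have : (fun q => fderiv 𝕜 (fun q => x q k) q (coordField x j q))
        =ᶠ[𝓝 p] fun _ => (Pi.single j 1 : Pt 𝕜 r) k := by
      filter_upwards [hW.mem_nhds hp] with q hq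
      rw [fderiv_coord_apply (hx.differentiableAt hW hq), fderiv_coordField hx hq]
    rw [this.fderiv_eq]; simp
  have h1 := key i j
  have h2 := key j i
  rw [fderiv_fderiv_symm hW (hx.contDiffOn_coord k) hp] at h1
  rw [← fderiv_coord_apply (hx.differentiableAt hW hp),
    ← fderiv_coord_apply (hx.differentiableAt hW hp)]
  linear_combination h1 - h2

theorem coordDeriv_comm (hx : IsCoordinateSystem W x) (hW : IsOpen W) {f : Pt 𝕜 r → 𝕜}
    (hf : ContDiffOn 𝕜 ∞ f W) {p : Pt 𝕜 r} (hp : p ∈ W) (i j : Fin r) :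
    coordDeriv x i (coordDeriv x j f) p = coordDeriv x j (coordDeriv x i f) p := by
  have h := fun i j => fderiv_fderiv_apply hW hf (contDiffOn_coordField hx hW j) hp
    (coordField x i p)
  change fderiv 𝕜 (fun q => fderiv 𝕜 f q (coordField x j q)) p _
    = fderiv 𝕜 (fun q => fderiv 𝕜 f q (coordField x i q)) p _
  rw [h i j, h j i, fderiv_coordField_symm hx hW hp, fderiv_fderiv_symm hW hf hp]

theorem coordDeriv_coord (hx : IsCoordinateSystem W x) (hW : IsOpen W) {p : Pt 𝕜 r} (hp : p ∈ W)
    (i k : Fin r) : coordDeriv x i (fun q => x q k) p = if k = i then 1 else 0 := by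
  rw [coordDeriv, fderiv_coord_apply (hx.differentiableAt hW hp), fderiv_coordField hx hp,
    Pi.single_apply]

/-- If the field `E` is diagonal in the coordinates `x`, with `E xᵏ = δₖ xᵏ`, then `∂/∂xⁱ` lowers
the `E`-degree by `δᵢ`. -/
theorem coordDeriv_homogeneous (hx : IsCoordinateSystem W x) (hW : IsOpen W)
    {E : Pt 𝕜 r → Pt 𝕜 r} {δ : Fin r → 𝕜}
    (hE : ∀ p ∈ W, ∀ k, fderiv 𝕜 x p (E p) k = δ k * x p k)
    {f : Pt 𝕜 r → 𝕜} {c : 𝕜} (hf : ContDiffOn 𝕜 ∞ f W)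
    (hc : ∀ p ∈ W, fderiv 𝕜 f p (E p) = c * f p) (i : Fin r) {p : Pt 𝕜 r} (hp : p ∈ W) :
    fderiv 𝕜 (coordDeriv x i f) p (E p) = (c - δ i) * coordDeriv x i f p := by
  have h1 : HasDirDeriv (fun q => ∑ k, δ k * x q k * coordDeriv x k f q)
      (∑ k, (δ k * (if k = i then 1 else 0) * coordDeriv x k f p
        + δ k * x p k * coordDeriv x i (coordDeriv x k f) p)) p (coordField x i p) := by
    refine HasDirDeriv.sum fun k _ => HasDirDeriv.mul (HasDirDeriv.const_mul _ ?_) ?_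
    · exact ⟨(hx.contDiffOn_coord k).differentiableAt_of_isOpen hW hp, coordDeriv_coord hx hW hp i k⟩
    · exact ⟨(contDiffOn_coordDeriv hx hW k hf).differentiableAt_of_isOpen hW hp, rfl⟩
  have h2 : HasDirDeriv (fun q => ∑ k, δ k * x q k * coordDeriv x k f q)
      (c * coordDeriv x i f p) p (coordField x i p) := by
    refine HasDirDeriv.congr_of_eventuallyEq (f := fun q => c * f q)
      (HasDirDeriv.const_mul c ⟨hf.differentiableAt_of_isOpen hW hp, rfl⟩) ?_
    filter_upwards [hW.mem_nhds hp] with q hq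
    rw [← hc q hq, fderiv_eq_sum_coordDeriv hx hq]
    exact Finset.sum_congr rfl fun k _ => by rw [hE q hq]
  have h3 := h1.2.symm.trans h2.2
  rw [fderiv_eq_sum_coordDeriv hx hp]
  simp only [hE p hp, Finset.sum_add_distrib, mul_ite, ite_mul, mul_one, mul_zero, zero_mul,
    Finset.sum_ite_eq', Finset.mem_univ, if_true, coordDeriv_comm hx hW hf hp i] at h3 ⊢
  linear_combination h3

end CoordinateSystem

/-! ### Polarization -/

/-- A totally symmetric array of order three is determined by its cubic form. -/
theorem eq_zero_of_cubic_form_eq_zero {T : Fin r → Fin r → Fin r → 𝕜}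
    (h12 : ∀ i j k, T i j k = T j i k) (h23 : ∀ i j k, T i j k = T i k j)
    (h : ∀ v : Fin r → 𝕜, ∑ i, ∑ j, ∑ k, v i * v j * v k * T i j k = 0) (i j k : Fin r) :
    T i j k = 0 := by
  set B : Pt 𝕜 r → Pt 𝕜 r → Pt 𝕜 r → 𝕜 := fun u v w => ∑ i, ∑ j, ∑ k, u i * v j * w k * T i j k
    with hB
  have a1 : ∀ u u' v w, B (u + u') v w = B u v w + B u' v w := fun u u' v w => by
    simp only [hB, Pi.add_apply, add_mul, Finset.sum_add_distrib]
  have a2 : ∀ u v v' w, B u (v + v') w = B u v w + B u v' w := fun u u' v w => by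
    simp only [hB, Pi.add_apply, mul_add, add_mul, Finset.sum_add_distrib]
  have a3 : ∀ u v w w', B u v (w + w') = B u v w + B u v w' := fun u u' v w => by
    simp only [hB, Pi.add_apply, mul_add, add_mul, Finset.sum_add_distrib]
  have s1 : ∀ u v w, B u v w = B v u w := fun u v w => by
    simp only [hB]
    rw [Finset.sum_comm]
    exact Finset.sum_congr rfl fun i _ => Finset.sum_congr rfl fun j _ =>
      Finset.sum_congr rfl fun k _ => by rw [h12]; ring
  have s2 : ∀ u v w, B u v w = B u w v := fun u v w => by
    simp only [hB]
    refine Finset.sum_congr rfl fun i _ => ?_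
    rw [Finset.sum_comm]
    exact Finset.sum_congr rfl fun j _ => Finset.sum_congr rfl fun k _ => by rw [h23]; ring
  have z : ∀ v, B v v v = 0 := h
  have e : ∀ u v w, B u v w = 0 := fun u v w => by
    have h6 : (6 : 𝕜) * B u v w = B (u + v + w) (u + v + w) (u + v + w) - B (u + v) (u + v) (u + v)
        - B (v + w) (v + w) (v + w) - B (u + w) (u + w) (u + w) + B u u u + B v v v + B w w w := by
      simp only [a1, a2, a3]
      linear_combination 2 * s2 u v w + 3 * s1 u v w + 2 * s2 v u w + s1 u w v + s1 v w u
    simp only [z] at h6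
    have : (6 : 𝕜) ≠ 0 := by norm_num
    simpa [this] using h6
  have := e (Pi.single i 1) (Pi.single j 1) (Pi.single k 1)
  simpa [hB, Pi.single_apply, Finset.sum_ite_eq', ite_mul, mul_ite] using this

end Calculus

/-! ### The antidiagonal metric and the Euler field -/

section AntiPair

variable {𝕜 : Type*} [RCLike 𝕜] {r : ℕ}

/-- The bilinear form `∑ᵢ vⁱ wʳ⁻ⁱ⁺¹` of the antidiagonal metric; its quadratic form is
`antiQuad`. -/
def antiPair (v w : Pt 𝕜 r) : 𝕜 := ∑ i, v i * w (Fin.rev i)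

theorem antiPair_comm (v w : Pt 𝕜 r) : antiPair v w = antiPair w v := by
  rw [antiPair, antiPair, ← Equiv.sum_comp Fin.revPerm]
  exact Finset.sum_congr rfl fun i _ => by simp [mul_comm]

theorem antiPair_add_left (u v w : Pt 𝕜 r) :
    antiPair (u + v) w = antiPair u w + antiPair v w := by
  simp [antiPair, add_mul, Finset.sum_add_distrib]

theorem antiPair_smul_left (a : 𝕜) (v w : Pt 𝕜 r) : antiPair (a • v) w = a * antiPair v w := by
  simp [antiPair, Finset.mul_sum, mul_assoc]

theorem antiPair_add_right (u v w : Pt 𝕜 r) :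
    antiPair u (v + w) = antiPair u v + antiPair u w := by
  simp [antiPair, mul_add, Finset.sum_add_distrib]

theorem antiPair_smul_right (a : 𝕜) (v w : Pt 𝕜 r) : antiPair v (a • w) = a * antiPair v w := by
  rw [antiPair_comm, antiPair_smul_left, antiPair_comm]

theorem antiPair_single_left (i : Fin r) (a : 𝕜) (w : Pt 𝕜 r) :
    antiPair (Pi.single i a) w = a * w (Fin.rev i) := by
  simp [antiPair, Pi.single_apply]

theorem antiPair_single_right (i : Fin r) (a : 𝕜) (w : Pt 𝕜 r) :
    antiPair w (Pi.single i a) = a * w (Fin.rev i) := by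
  rw [antiPair_comm, antiPair_single_left]

theorem antiQuad_eq_antiPair {m : ℕ} (t : Pt 𝕜 (m + 1)) : antiQuad t = antiPair t t := rfl

/-- The linear vector field `∑ᵢ dᵢ tⁱ ∂ᵢ`. -/
def diagField (d : Fin r → 𝕜) (t : Pt 𝕜 r) : Pt 𝕜 r := fun i => d i * t i

/-- If `dᵢ + d_{r-i+1}` does not depend on `i`, the field `diagField d` is conformal for the
antidiagonal metric. -/
theorem antiPair_diagField {d : Fin r → 𝕜} {c : 𝕜} (hd : ∀ i, d i + d (Fin.rev i) = c)
    (v w : Pt 𝕜 r) :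
    antiPair (diagField d v) w + antiPair v (diagField d w) = c * antiPair v w := by
  simp only [antiPair, diagField, ← Finset.sum_add_distrib, Finset.mul_sum]
  exact Finset.sum_congr rfl fun i _ => by rw [← hd i]; ring

theorem HasDirDeriv.antiPair {f g : Pt 𝕜 r → Pt 𝕜 r} {f' g' : Pt 𝕜 r} {p V : Pt 𝕜 r}
    (hf : ∀ i, HasDirDeriv (fun q => f q i) (f' i) p V)
    (hg : ∀ i, HasDirDeriv (fun q => g q i) (g' i) p V) :
    HasDirDeriv (fun q => _root_.antiPair (f q) (g q))
      (_root_.antiPair f' (g p) + _root_.antiPair (f p) g') p V := by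
  refine (HasDirDeriv.sum fun i _ => (hf i).mul (hg (Fin.rev i))).congr_deriv ?_
  simp [_root_.antiPair, Finset.sum_add_distrib]

theorem isCoordinateSystem_id (W : Set (Pt 𝕜 r)) : IsCoordinateSystem W (id : Pt 𝕜 r → Pt 𝕜 r) :=
  ⟨contDiffOn_id, injOn_id _, fun p _ => by
    rw [fderiv_id]; exact ⟨ContinuousLinearEquiv.refl 𝕜 _, rfl⟩⟩

theorem coordField_id (i : Fin r) (p : Pt 𝕜 r) :
    coordField (id : Pt 𝕜 r → Pt 𝕜 r) i p = Pi.single i 1 := by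
  rw [coordField, fderiv_id, ContinuousLinearMap.inverse_id]; rfl

theorem coordDeriv_id (i : Fin r) (f : Pt 𝕜 r → 𝕜) : coordDeriv id i f = pd i f := by
  funext p; rw [coordDeriv, coordField_id, pd]

theorem fderiv_eq_sum_pd (f : Pt 𝕜 r → 𝕜) (p v : Pt 𝕜 r) :
    fderiv 𝕜 f p v = ∑ k, v k * pd k f p := by
  rw [fderiv_eq_sum_coordDeriv (isCoordinateSystem_id univ) (mem_univ p)]
  simp [coordDeriv_id]

theorem contDiffOn_pd {W : Set (Pt 𝕜 r)} (hW : IsOpen W) (i : Fin r) {f : Pt 𝕜 r → 𝕜}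
    (hf : ContDiffOn 𝕜 ∞ f W) : ContDiffOn 𝕜 ∞ (pd i f) W := by
  rw [← coordDeriv_id]; exact contDiffOn_coordDeriv (isCoordinateSystem_id W) hW i hf

theorem pd_comm {W : Set (Pt 𝕜 r)} (hW : IsOpen W) {f : Pt 𝕜 r → 𝕜}
    (hf : ContDiffOn 𝕜 ∞ f W) {p : Pt 𝕜 r} (hp : p ∈ W) (i j : Fin r) :
    pd i (pd j f) p = pd j (pd i f) p := by
  simpa only [coordDeriv_id] using coordDeriv_comm (isCoordinateSystem_id W) hW hf hp i j

theorem pd_congr {W : Set (Pt 𝕜 r)} {f g : Pt 𝕜 r → 𝕜} (hW : IsOpen W) (h : EqOn f g W)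
    (i : Fin r) : EqOn (pd i f) (pd i g) W := by
  simpa only [coordDeriv_id] using coordDeriv_congr (x := id) hW h i

theorem pd_homogeneous {W : Set (Pt 𝕜 r)} (hW : IsOpen W) {d : Fin r → 𝕜} {f : Pt 𝕜 r → 𝕜}
    {c : 𝕜} (hf : ContDiffOn 𝕜 ∞ f W)
    (hc : ∀ p ∈ W, fderiv 𝕜 f p (diagField d p) = c * f p) (i : Fin r) {p : Pt 𝕜 r} (hp : p ∈ W) :
    fderiv 𝕜 (pd i f) p (diagField d p) = (c - d i) * pd i f p := by
  simpa only [coordDeriv_id] using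
    coordDeriv_homogeneous (isCoordinateSystem_id W) hW (E := diagField d) (δ := d)
      (fun p _ k => by simp [diagField]) hf hc i hp

end AntiPair

/-! ### Frobenius structures with a potential in standard form -/

section StandardForm

variable {𝕜 : Type*} [RCLike 𝕜] {n : ℕ}

/-- A Frobenius structure on `M` with antidiagonal metric in the standard coordinates, unit `∂ᵣ`,
linear diagonal Euler field, and a quasihomogeneous potential `F` with `∂ᵣF = ½ ∑ tⁱ tʳ⁻ⁱ⁺¹`. -/
structure StandardForm (M : Set (Pt 𝕜 (n + 2))) (S : FrobeniusData 𝕜 (n + 2))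
    (F : Pt 𝕜 (n + 2) → 𝕜) (d : Fin (n + 2) → 𝕜) : Prop where
  frobenius : IsFrobenius M S
  smooth : ContDiffOn 𝕜 ∞ F M
  metric_eq : ∀ t ∈ M, ∀ i j, S.metric t i j = if j = Fin.rev i then 1 else 0
  unit_eq : ∀ t ∈ M, S.unit t = Pi.single (Fin.last (n + 1)) 1
  euler_eq : ∀ t ∈ M, S.euler t = diagField d t
  c_eq : ∀ t ∈ M, ∀ i j k, S.c t i j k = pd i (pd j (pd (Fin.rev k) F)) t
  pd_last : ∀ t ∈ M, pd (Fin.last (n + 1)) F t = (1 / 2) * antiQuad t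
  homogeneous : ∀ t ∈ M, fderiv 𝕜 F t (diagField d t) = (3 - S.charge) * F t
  deg_add : ∀ i, d i + d (Fin.rev i) = 2 - S.charge
  deg_last : d (Fin.last (n + 1)) = 1
  charge_ne : S.charge ≠ 1

theorem hasDirDeriv_antiQuad {m : ℕ} (p V : Pt 𝕜 (m + 1)) :
    HasDirDeriv antiQuad (2 * antiPair p V) p V := by
  refine (HasDirDeriv.antiPair (f := id) (g := id) (fun i => HasDirDeriv.coord i p V)
    (fun i => HasDirDeriv.coord i p V)).congr_deriv ?_
  rw [antiPair_comm V]; simp; ring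

theorem antiQuad_split (t : Pt 𝕜 (n + 2)) :
    antiQuad t = 2 * t 0 * t (Fin.last (n + 1))
      + ∑ i ∈ Finset.Ioo (0 : Fin (n + 2)) (Fin.last (n + 1)), t i * t (Fin.rev i) := by
  have h : (Finset.univ : Finset (Fin (n + 2)))
      = insert 0 (insert (Fin.last (n + 1)) (Finset.Ioo 0 (Fin.last (n + 1)))) := by
    ext i
    simp only [Finset.mem_univ, Finset.mem_insert, Finset.mem_Ioo, true_iff]
    rcases eq_or_ne i 0 with h | h
    · exact Or.inl h
    · rcases eq_or_ne i (Fin.last (n + 1)) with h' | h'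
      · exact Or.inr (Or.inl h')
      · exact Or.inr (Or.inr ⟨Fin.pos_iff_ne_zero.2 h, lt_of_le_of_ne (Fin.le_last i) h'⟩)
  have h0 : (0 : Fin (n + 2)) ≠ Fin.last (n + 1) := (Fin.last_pos).ne
  rw [antiQuad, h, Finset.sum_insert (by simp [h0]), Finset.sum_insert (by simp)]
  simp only [Fin.rev_zero, Fin.rev_last]
  ring

theorem pair_mul_single {r : ℕ} (S : FrobeniusData 𝕜 r) (t : Pt 𝕜 r) (i j k : Fin r) :
    S.pair t (S.mul t (Pi.single i 1) (Pi.single j 1)) (Pi.single k 1)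
      = ∑ l, S.c t i j l * S.metric t l k := by
  have : S.mul t (Pi.single i 1) (Pi.single j 1) = fun l => S.c t i j l := by
    funext l
    simp [FrobeniusData.mul, Pi.single_apply]
  rw [this, FrobeniusData.pair]
  exact Finset.sum_congr rfl fun l _ => by simp [Pi.single_apply, mul_comm]

theorem pair_single {r : ℕ} (S : FrobeniusData 𝕜 r) (t : Pt 𝕜 r) (i j : Fin r) :
    S.pair t (Pi.single i 1) (Pi.single j 1) = S.metric t i j := by
  simp [FrobeniusData.pair, Pi.single_apply]

theorem standardForm_of_potential (M : Set (Pt 𝕜 (n + 2))) (S : FrobeniusData 𝕜 (n + 2))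
    (hS : IsFrobenius M S) (hcharge : S.charge ≠ 1) (hflat : IsFlatCoordinates M S id)
    (F : Pt 𝕜 (n + 2) → 𝕜) (hF : IsPotential M S id F) (G : Pt 𝕜 (n + 1) → 𝕜)
    (hstd : ∀ t ∈ M, F t = (1 / 2) * t (Fin.last (n + 1)) ^ 2 * t 0
      + (1 / 2) * t (Fin.last (n + 1)) *
          ∑ i ∈ Finset.Ioo (0 : Fin (n + 2)) (Fin.last (n + 1)), t i * t (Fin.rev i)
      + G (fun i => t i.castSucc))
    (d : Fin (n + 2) → 𝕜) (hE : ∀ t ∈ M, ∀ i, S.euler t i = d i * t i)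
    (hEF : ∀ t ∈ M, fderiv 𝕜 F t (S.euler t) = (3 - S.charge) * F t)
    (hlast : d (Fin.last (n + 1)) = 1) (hne : M.Nonempty) : StandardForm M S F d := by
  have hM := hS.isOpen
  have hunit : ∀ t ∈ M, S.unit t = Pi.single (Fin.last (n + 1)) 1 := fun t ht => by
    rw [hflat.2.2 t ht, coordField_id]
  have hpd : ∀ t ∈ M, pd (Fin.last (n + 1)) F t = (1 / 2) * antiQuad t := by
    intro t ht
    set V : Pt 𝕜 (n + 2) := Pi.single (Fin.last (n + 1)) 1 with hV
    -- `F` without the summand `G`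
    set P : Pt 𝕜 (n + 2) → 𝕜 := fun t => (1 / 2) * (t (Fin.last (n + 1)) * antiQuad t)
      - (1 / 2) * (t 0 * (t (Fin.last (n + 1)) * t (Fin.last (n + 1)))) with hP
    have hP' : HasDirDeriv P ((1 / 2) * antiQuad t) t V := by
      have hl := HasDirDeriv.coord (𝕜 := 𝕜) (Fin.last (n + 1)) t V
      have h0 := HasDirDeriv.coord (𝕜 := 𝕜) 0 t V
      refine (((hl.mul (hasDirDeriv_antiQuad t V)).const_mul (1 / 2)).sub
        ((h0.mul (hl.mul hl)).const_mul (1 / 2))).congr_deriv ?_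
      have e0 : (0 : Fin (n + 2)) ≠ Fin.last (n + 1) := (Fin.last_pos).ne
      rw [hV, antiPair_single_right]
      simp [e0]
      ring
    set g : Pt 𝕜 (n + 2) → 𝕜 := fun t => G (fun i => t i.castSucc) with hg
    have hFP : ∀ q ∈ M, F q = P q + g q := fun q hq => by
      simp only [hstd q hq, hP, antiQuad_split, hg]; ring
    have hgd : DifferentiableAt 𝕜 g t := by
      refine ((hF.1.differentiableAt_of_isOpen hM ht).sub hP'.1).congr_of_eventuallyEq ?_
      filter_upwards [hM.mem_nhds ht] with q hq
      simp [hFP q hq]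
    have hg' : HasDirDeriv g 0 t V := by
      refine ⟨hgd, ?_⟩
      rw [← hgd.lineDeriv_eq_fderiv, lineDeriv]
      have : (fun s : 𝕜 => g (t + s • V)) = fun _ => g t := by
        funext s
        simp only [hg, hV]
        congr 1
        funext i
        simp [(Fin.castSucc_lt_last i).ne]
      rw [this, deriv_const]
    have : HasDirDeriv F ((1 / 2) * antiQuad t + 0) t V := by
      refine (hP'.add hg').congr_of_eventuallyEq ?_
      filter_upwards [hM.mem_nhds ht] with q hq using hFP q hq
    simpa [pd] using this.2
  have hpd2 : ∀ t ∈ M, ∀ j, pd j (pd (Fin.last (n + 1)) F) t = t (Fin.rev j) := by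
    intro t ht j
    rw [pd_congr hM (g := fun t => (1 / 2) * antiQuad t) hpd j ht, pd,
      ((hasDirDeriv_antiQuad t _).const_mul (1 / 2)).2, antiPair_single_right]
    ring
  have hmet : ∀ t ∈ M, ∀ i j, S.metric t i j = if j = Fin.rev i then 1 else 0 := by
    intro t ht i j
    have h := hF.2.1 t ht i j (Fin.last (n + 1))
    simp only [coordDeriv_id, coordField_id] at h
    rw [pd_congr hM (g := fun t => t (Fin.rev j)) (fun q hq => hpd2 q hq j) i ht, pd,
      (HasDirDeriv.coord _ _ _).2, hS.pair_mul t ht, ← hunit t ht, hS.mul_comm t ht,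
      hS.unit_mul t ht, pair_single] at h
    rw [h, Pi.single_apply]
    simp only [Fin.rev_eq_iff]
  refine ⟨hS, hF.1, hmet, hunit, fun t ht => funext (hE t ht), ?_, hpd, ?_, ?_, hlast, hcharge⟩
  · intro t ht i j k
    have h := hF.2.1 t ht i j (Fin.rev k)
    simp only [coordDeriv_id, coordField_id] at h
    rw [← h, pair_mul_single]
    simp [hmet t ht]
  · intro t ht
    rw [← hEF t ht]; congr 1; exact (funext (hE t ht)).symm
  · intro i
    obtain ⟨t, ht⟩ := hne
    have h := hS.lie_metric t ht i (Fin.rev i)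
    have e1 : fderiv 𝕜 (fun q => S.metric q i (Fin.rev i)) t (S.euler t) = 0 := by
      have : (fun q => S.metric q i (Fin.rev i)) =ᶠ[𝓝 t] fun _ => (1 : 𝕜) := by
        filter_upwards [hM.mem_nhds ht] with q hq
        simp [hmet q hq]
      rw [this.fderiv_eq]; simp
    have e2 : ∀ k l, pd k (fun q => S.euler q l) t = if l = k then d l else 0 := fun k l => by
      rw [pd_congr hM (g := fun q => d l * q l) (fun q hq => hE q hq l) k ht, pd,
        ((HasDirDeriv.coord _ _ _).const_mul _).2, Pi.single_apply]
      simp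
    simpa [e1, e2, hmet t ht] using h

namespace StandardForm

variable {M : Set (Pt 𝕜 (n + 2))} {S : FrobeniusData 𝕜 (n + 2)}
  {F : Pt 𝕜 (n + 2) → 𝕜} {d : Fin (n + 2) → 𝕜}

theorem isOpen (h : StandardForm M S F d) : IsOpen M := h.frobenius.isOpen

theorem deg_zero (h : StandardForm M S F d) : d 0 = 1 - S.charge := by
  have := h.deg_add 0
  rw [Fin.rev_zero, h.deg_last] at this
  linear_combination this

theorem deg_zero_ne (h : StandardForm M S F d) : d 0 ≠ 0 := by
  rw [h.deg_zero, sub_ne_zero]; exact h.charge_ne.symm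

theorem charge_eq (h : StandardForm M S F d) : S.charge = 1 - d 0 := by
  rw [h.deg_zero]; ring

theorem deg_add' (h : StandardForm M S F d) (i : Fin (n + 2)) : d i + d (Fin.rev i) = 1 + d 0 := by
  rw [h.deg_add, h.charge_eq]; ring

theorem smooth_pd (h : StandardForm M S F d) (i : Fin (n + 2)) : ContDiffOn 𝕜 ∞ (pd i F) M :=
  contDiffOn_pd h.isOpen i h.smooth

theorem smooth_pd_pd (h : StandardForm M S F d) (i j : Fin (n + 2)) :
    ContDiffOn 𝕜 ∞ (pd i (pd j F)) M :=
  contDiffOn_pd h.isOpen i (h.smooth_pd j)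

theorem homogeneous' (h : StandardForm M S F d) {t : Pt 𝕜 (n + 2)} (ht : t ∈ M) :
    fderiv 𝕜 F t (diagField d t) = (2 + d 0) * F t := by
  rw [h.homogeneous t ht, h.charge_eq]; ring

theorem homogeneous_pd (h : StandardForm M S F d) {t : Pt 𝕜 (n + 2)} (ht : t ∈ M)
    (i : Fin (n + 2)) :
    fderiv 𝕜 (pd i F) t (diagField d t) = (2 + d 0 - d i) * pd i F t :=
  pd_homogeneous h.isOpen h.smooth (fun _ hp => h.homogeneous' hp) i ht

theorem homogeneous_pd_pd (h : StandardForm M S F d) {t : Pt 𝕜 (n + 2)} (ht : t ∈ M)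
    (i j : Fin (n + 2)) :
    fderiv 𝕜 (pd i (pd j F)) t (diagField d t) = (2 + d 0 - d j - d i) * pd i (pd j F) t :=
  pd_homogeneous h.isOpen (h.smooth_pd j) (fun _ hp => h.homogeneous_pd hp j) i ht

theorem pd_pd_last (h : StandardForm M S F d) {t : Pt 𝕜 (n + 2)} (ht : t ∈ M) (j : Fin (n + 2)) :
    pd j (pd (Fin.last (n + 1)) F) t = t (Fin.rev j) := by
  rw [pd_congr h.isOpen (g := fun t => (1 / 2) * antiQuad t) h.pd_last j ht, pd,
    ((hasDirDeriv_antiQuad t _).const_mul (1 / 2)).2, antiPair_single_right]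
  ring

theorem pd_last_pd (h : StandardForm M S F d) {t : Pt 𝕜 (n + 2)} (ht : t ∈ M) (j : Fin (n + 2)) :
    pd (Fin.last (n + 1)) (pd j F) t = t (Fin.rev j) := by
  rw [pd_comm h.isOpen h.smooth ht, h.pd_pd_last ht]

theorem pd_last_pd_pd (h : StandardForm M S F d) {t : Pt 𝕜 (n + 2)} (ht : t ∈ M)
    (i j : Fin (n + 2)) :
    pd (Fin.last (n + 1)) (pd i (pd j F)) t = if j = Fin.rev i then 1 else 0 := by
  rw [pd_comm h.isOpen (h.smooth_pd j) ht,
    pd_congr h.isOpen (g := fun t => t (Fin.rev j)) (fun q hq => h.pd_last_pd hq j) i ht, pd,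
    (HasDirDeriv.coord _ _ _).2, Pi.single_apply]
  simp only [Fin.rev_eq_iff]

end StandardForm

end StandardForm

/-! ### Branches of powers -/

section Branches

variable {𝕜 : Type*} [RCLike 𝕜] {Λ : Set 𝕜} {ℓ : 𝕜 → 𝕜}

theorem exp_add_rclike (x y : 𝕜) :
    NormedSpace.exp (x + y) = NormedSpace.exp x * NormedSpace.exp y :=
  NormedSpace.exp_add_of_commute (Commute.all x y)

theorem exp_ne_zero_rclike (x : 𝕜) : NormedSpace.exp x ≠ 0 := fun h => by
  have := exp_add_rclike x (-x)
  rw [add_neg_cancel, NormedSpace.exp_zero, h, zero_mul] at this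
  exact one_ne_zero this

theorem hasDerivAt_exp_rclike (x : 𝕜) :
    HasDerivAt (NormedSpace.exp : 𝕜 → 𝕜) (NormedSpace.exp x) x := hasDerivAt_exp

theorem contDiff_exp_rclike : ContDiff 𝕜 ∞ (NormedSpace.exp : 𝕜 → 𝕜) := by
  have hd : deriv (NormedSpace.exp : 𝕜 → 𝕜) = NormedSpace.exp :=
    funext fun x => (hasDerivAt_exp_rclike x).deriv
  refine contDiff_infty.2 fun n => ?_
  induction n with
  | zero =>
    exact contDiff_zero.2 (continuous_iff_continuousAt.2 fun x =>
      (hasDerivAt_exp_rclike x).continuousAt)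
  | succ n ih =>
    have : ((n + 1 : ℕ) : WithTop ℕ∞) = (n : WithTop ℕ∞) + 1 := by push_cast; rfl
    rw [this, contDiff_succ_iff_deriv]
    refine ⟨fun x => (hasDerivAt_exp_rclike x).differentiableAt, by simp, ?_⟩
    rw [hd]; exact ih

theorem powBranch_add (a b x : 𝕜) :
    powBranch ℓ (a + b) x = powBranch ℓ a x * powBranch ℓ b x := by
  rw [powBranch, powBranch, powBranch, ← exp_add_rclike]; congr 1; ring

theorem powBranch_zero (x : 𝕜) : powBranch ℓ 0 x = 1 := by simp [powBranch]

theorem powBranch_ne_zero (a x : 𝕜) : powBranch ℓ a x ≠ 0 := exp_ne_zero_rclike _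

theorem powBranch_neg (a x : 𝕜) : powBranch ℓ (-a) x = (powBranch ℓ a x)⁻¹ := by
  refine eq_inv_of_mul_eq_one_left ?_
  rw [← powBranch_add, neg_add_cancel, powBranch_zero]

theorem IsLogSqBranch.ne_zero (h : IsLogSqBranch Λ ℓ) {x : 𝕜} (hx : x ∈ Λ) : x ≠ 0 :=
  fun h0 => h.zero_notMem (h0 ▸ hx)

theorem IsLogSqBranch.powBranch_two (h : IsLogSqBranch Λ ℓ) {x : 𝕜} (hx : x ∈ Λ) :
    powBranch ℓ 2 x = x ^ 2 := by
  rw [powBranch, ← h.exp_eq x hx]; congr 1; ring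

theorem IsLogSqBranch.powBranch_neg_two (h : IsLogSqBranch Λ ℓ) {x : 𝕜} (hx : x ∈ Λ) :
    powBranch ℓ (-2) x = (x ^ 2)⁻¹ := by
  rw [powBranch_neg, h.powBranch_two hx]

theorem IsLogSqBranch.hasDerivAt (h : IsLogSqBranch Λ ℓ) {x : 𝕜} (hx : x ∈ Λ) :
    HasDerivAt ℓ (2 / x) x := by
  have hx0 := h.ne_zero hx
  have hd : HasDerivAt ℓ (deriv ℓ x) x :=
    ((h.smooth.contDiffAt (h.isOpen.mem_nhds hx)).differentiableAt (by simp)).hasDerivAt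
  have h1 := (hasDerivAt_exp_rclike (ℓ x)).comp x hd
  have h2 : HasDerivAt (NormedSpace.exp ∘ ℓ) (2 * x) x := by
    refine HasDerivAt.congr_of_eventuallyEq (f := fun y => y ^ 2) ?_ ?_
    · simpa using hasDerivAt_pow 2 x
    · filter_upwards [h.isOpen.mem_nhds hx] with y hy using h.exp_eq y hy
  have h3 := h1.unique h2
  rw [h.exp_eq x hx] at h3
  convert hd using 1
  field_simp
  have : x * (x * deriv ℓ x) = x * 2 := by linear_combination h3
  exact (mul_left_cancel₀ hx0 this).symm

theorem IsLogSqBranch.hasDerivAt_powBranch (h : IsLogSqBranch Λ ℓ) (a : 𝕜) {x : 𝕜} (hx : x ∈ Λ) :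
    HasDerivAt (powBranch ℓ a) (a * x⁻¹ * powBranch ℓ a x) x := by
  have h1 := (hasDerivAt_exp_rclike (a / 2 * ℓ x)).comp x ((h.hasDerivAt hx).const_mul (a / 2))
  refine h1.congr_deriv ?_
  rw [powBranch]; field_simp

theorem IsLogSqBranch.contDiffOn_powBranch (h : IsLogSqBranch Λ ℓ) (a : 𝕜) :
    ContDiffOn 𝕜 ∞ (powBranch ℓ a) Λ :=
  contDiff_exp_rclike.comp_contDiffOn (contDiffOn_const.mul h.smooth)

end Branches

/-! ### The conjugate coordinates and their frame -/

section Frame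

variable {𝕜 : Type*} [RCLike 𝕜] {n : ℕ}

/-- The weights of a linear Euler field `∑ dᵢ tⁱ ∂ᵢ` that is conformal for the antidiagonal
metric and for which `∂ᵣ` has degree `-1`. -/
structure IsEulerWeight (d : Fin (n + 2) → 𝕜) : Prop where
  ne_zero : d 0 ≠ 0
  last : d (Fin.last (n + 1)) = 1
  add_rev : ∀ i, d i + d (Fin.rev i) = 1 + d 0

/-- The map `v ↦ v - 2 (dt¹(v) / dt¹(E)) E`, which fixes `dt¹ = 0` and maps the Euler field `E`
to `-E`. -/
def eulerReflection (d : Fin (n + 2) → 𝕜) (t v : Pt 𝕜 (n + 2)) : Pt 𝕜 (n + 2) :=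
  v - (2 * v 0 / (d 0 * t 0)) • diagField d t

/-- The conformal factor `(t¹) ^ (-2/d₁)`. -/
def confFactor (d : Fin (n + 2) → 𝕜) (ℓ : 𝕜 → 𝕜) (t : Pt 𝕜 (n + 2)) : 𝕜 :=
  powBranch ℓ (-2 / d 0) (t 0)

/-- The factor `(t¹) ^ (-2dᵢ/d₁)` by which the Euler flow at time `-ℓ(t¹)/d₁` multiplies `tⁱ`. -/
def flowFactor (d : Fin (n + 2) → 𝕜) (ℓ : 𝕜 → 𝕜) (i : Fin (n + 2)) (t : Pt 𝕜 (n + 2)) : 𝕜 :=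
  powBranch ℓ (-2 * d i / d 0) (t 0)

/-- The components `vⁱ (t¹)^(2dᵢ/d₁ - 1)`, `1 < i < r`, of `frameVec`. -/
def frameMid (d : Fin (n + 2) → 𝕜) (ℓ : 𝕜 → 𝕜) (v t : Pt 𝕜 (n + 2)) : Pt 𝕜 (n + 2) :=
  fun i => if i = 0 ∨ i = Fin.last (n + 1) then 0
    else v i * ((flowFactor d ℓ i t)⁻¹ * (t 0)⁻¹)

/-- The coefficient of `∂ᵣ` in `frameVec`. -/
def frameLast (d : Fin (n + 2) → 𝕜) (ℓ : 𝕜 → 𝕜) (v t : Pt 𝕜 (n + 2)) : 𝕜 :=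
  v (Fin.last (n + 1)) * (confFactor d ℓ t)⁻¹
    - (t 0)⁻¹ * ((1 / 2) * (v 0 * (t 0)⁻¹ * antiQuad t) + antiPair t (frameMid d ℓ v t))

/-- The image under `eulerReflection` of the vector field `∑ vⁱ ∂/∂sⁱ`, where `v` is constant and
`s` are the conjugate coordinates. -/
def frameVec (d : Fin (n + 2) → 𝕜) (ℓ : 𝕜 → 𝕜) (v t : Pt 𝕜 (n + 2)) : Pt 𝕜 (n + 2) :=
  (v 0 * (t 0)⁻¹) • t + frameMid d ℓ v t
    + frameLast d ℓ v t • (Pi.single (Fin.last (n + 1)) 1 : Pt 𝕜 (n + 2))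

/-- The vector field `∑ vⁱ ∂/∂sⁱ`, where `v` is constant and `s` are the conjugate coordinates. -/
def conjField (d : Fin (n + 2) → 𝕜) (ℓ : 𝕜 → 𝕜) (v t : Pt 𝕜 (n + 2)) : Pt 𝕜 (n + 2) :=
  eulerReflection d t (frameVec d ℓ v t)

theorem zero_ne_last : (0 : Fin (n + 2)) ≠ Fin.last (n + 1) := (Fin.last_pos).ne

variable {d : Fin (n + 2) → 𝕜} {Λ : Set 𝕜} {ℓ : 𝕜 → 𝕜} {t : Pt 𝕜 (n + 2)}

@[simp] theorem frameMid_zero (v : Pt 𝕜 (n + 2)) : frameMid d ℓ v t 0 = 0 := by simp [frameMid]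

@[simp] theorem frameMid_last (v : Pt 𝕜 (n + 2)) : frameMid d ℓ v t (Fin.last (n + 1)) = 0 := by
  simp [frameMid]

theorem eulerReflection_add (v w : Pt 𝕜 (n + 2)) :
    eulerReflection d t (v + w) = eulerReflection d t v + eulerReflection d t w := by
  ext i; simp only [eulerReflection, Pi.sub_apply, Pi.add_apply, Pi.smul_apply, smul_eq_mul]; ring

theorem eulerReflection_smul (a : 𝕜) (v : Pt 𝕜 (n + 2)) :
    eulerReflection d t (a • v) = a • eulerReflection d t v := by
  ext i; simp only [eulerReflection, Pi.sub_apply, Pi.smul_apply, smul_eq_mul]; ring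

theorem eulerReflection_sum {ι : Type*} (s : Finset ι) (v : ι → Pt 𝕜 (n + 2)) :
    eulerReflection d t (∑ i ∈ s, v i) = ∑ i ∈ s, eulerReflection d t (v i) :=
  map_sum (AddMonoidHom.mk' (eulerReflection d t) eulerReflection_add) v s

theorem eulerReflection_of_zero {v : Pt 𝕜 (n + 2)} (hv : v 0 = 0) : eulerReflection d t v = v := by
  simp [eulerReflection, hv]

theorem eulerReflection_diagField (hd : IsEulerWeight d) (h0 : t 0 ≠ 0) :
    eulerReflection d t (diagField d t) = -diagField d t := by
  have := hd.ne_zero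
  ext i
  simp only [eulerReflection, Pi.sub_apply, Pi.smul_apply, smul_eq_mul, diagField, Pi.neg_apply]
  field_simp; ring

theorem eulerReflection_zero (hd : IsEulerWeight d) (h0 : t 0 ≠ 0) (v : Pt 𝕜 (n + 2)) :
    eulerReflection d t v 0 = -v 0 := by
  have := hd.ne_zero
  simp only [eulerReflection, Pi.sub_apply, Pi.smul_apply, smul_eq_mul, diagField]
  field_simp; ring

theorem eulerReflection_eulerReflection (hd : IsEulerWeight d) (h0 : t 0 ≠ 0)
    (v : Pt 𝕜 (n + 2)) : eulerReflection d t (eulerReflection d t v) = v := by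
  rw [eulerReflection, eulerReflection_zero hd h0, eulerReflection]
  ext i
  simp only [Pi.sub_apply, Pi.smul_apply, smul_eq_mul]; ring

theorem flowFactor_mul_rev (hd : IsEulerWeight d) (hℓ : IsLogSqBranch Λ ℓ) (ht : t 0 ∈ Λ)
    (i : Fin (n + 2)) : flowFactor d ℓ i t * flowFactor d ℓ (Fin.rev i) t
      = confFactor d ℓ t * (t 0 ^ 2)⁻¹ := by
  have := hd.ne_zero
  rw [flowFactor, flowFactor, confFactor, ← hℓ.powBranch_neg_two ht, ← powBranch_add,
    ← powBranch_add]
  congr 1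
  have := hd.add_rev i
  field_simp
  linear_combination -this

theorem flowFactor_zero (hd : IsEulerWeight d) (hℓ : IsLogSqBranch Λ ℓ) (ht : t 0 ∈ Λ) :
    flowFactor d ℓ 0 t = (t 0 ^ 2)⁻¹ := by
  rw [flowFactor, ← hℓ.powBranch_neg_two ht, mul_div_cancel_right₀ _ hd.ne_zero]

theorem flowFactor_last (hd : IsEulerWeight d) :
    flowFactor d ℓ (Fin.last (n + 1)) t = confFactor d ℓ t := by
  rw [flowFactor, confFactor, hd.last, mul_one]

theorem flowFactor_ne_zero (i : Fin (n + 2)) : flowFactor d ℓ i t ≠ 0 := powBranch_ne_zero _ _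

theorem confFactor_ne_zero : confFactor d ℓ t ≠ 0 := powBranch_ne_zero _ _

theorem frameVec_zero (h0 : t 0 ≠ 0) (v : Pt 𝕜 (n + 2)) : frameVec d ℓ v t 0 = v 0 := by
  simp [frameVec, h0]

theorem conjField_apply (h0 : t 0 ≠ 0) (v : Pt 𝕜 (n + 2)) (i : Fin (n + 2)) :
    conjField d ℓ v t i
      = frameVec d ℓ v t i - (2 * v 0 / (d 0 * t 0)) * (d i * t i) := by
  simp [conjField, eulerReflection, frameVec_zero h0, diagField]

theorem conjField_zero (hd : IsEulerWeight d) (h0 : t 0 ≠ 0) (v : Pt 𝕜 (n + 2)) :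
    conjField d ℓ v t 0 = -v 0 := by
  rw [conjField, eulerReflection_zero hd h0, frameVec_zero h0]

theorem eulerReflection_conjField (hd : IsEulerWeight d) (h0 : t 0 ≠ 0) (v : Pt 𝕜 (n + 2)) :
    eulerReflection d t (conjField d ℓ v t) = frameVec d ℓ v t :=
  eulerReflection_eulerReflection hd h0 _

theorem antiPair_frameMid (hd : IsEulerWeight d) (hℓ : IsLogSqBranch Λ ℓ) (ht : t 0 ∈ Λ)
    (v : Pt 𝕜 (n + 2)) :
    confFactor d ℓ t * antiPair (frameMid d ℓ v t) (frameMid d ℓ v t)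
      = antiQuad v - 2 * v 0 * v (Fin.last (n + 1)) := by
  have h0 := hℓ.ne_zero ht
  rw [← antiQuad_eq_antiPair, antiQuad_split, antiQuad_split v, frameMid_zero, frameMid_last]
  simp only [mul_zero, zero_add, add_sub_cancel_left, Finset.mul_sum]
  refine Finset.sum_congr rfl fun i hi => ?_
  rw [Finset.mem_Ioo] at hi
  have h1 : ¬ (i = 0 ∨ i = Fin.last (n + 1)) := by
    rintro (rfl | rfl) <;> simp at hi
  have h2 : ¬ (Fin.rev i = 0 ∨ Fin.rev i = Fin.last (n + 1)) := by
    rw [Fin.rev_eq_iff, Fin.rev_eq_iff, Fin.rev_zero, Fin.rev_last]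
    exact fun h => h1 h.symm
  rw [frameMid, frameMid, if_neg h1, if_neg h2]
  have h3 := flowFactor_mul_rev hd hℓ ht i
  have h4 := flowFactor_ne_zero (d := d) (ℓ := ℓ) (t := t) i
  have h5 := flowFactor_ne_zero (d := d) (ℓ := ℓ) (t := t) (Fin.rev i)
  field_simp at h3 ⊢
  linear_combination (-v i * v (Fin.rev i)) * h3

theorem antiPair_self_frameVec (h0 : t 0 ≠ 0) (v : Pt 𝕜 (n + 2)) :
    confFactor d ℓ t * antiPair t (frameVec d ℓ v t)
      = v (Fin.last (n + 1)) * t 0 + (1 / 2) * (v 0 * (t 0)⁻¹ * (confFactor d ℓ t * antiQuad t)) := by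
  have hc := confFactor_ne_zero (d := d) (ℓ := ℓ) (t := t)
  rw [frameVec, antiPair_add_right, antiPair_add_right, antiPair_smul_right, antiPair_smul_right,
    antiPair_single_right, Fin.rev_last, frameLast, ← antiQuad_eq_antiPair]
  field_simp
  ring

theorem antiPair_frameVec_aux (v : Pt 𝕜 (n + 2)) :
    antiPair (frameVec d ℓ v t) (frameVec d ℓ v t)
      = 2 * (v 0 * (t 0)⁻¹) * antiPair t (frameVec d ℓ v t)
        - (v 0 * (t 0)⁻¹) ^ 2 * antiQuad t
        + antiPair (frameMid d ℓ v t) (frameMid d ℓ v t) := by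
  simp only [frameVec, antiPair_add_right, antiPair_smul_right, antiPair_add_left,
    antiPair_smul_left, antiPair_single_right, antiPair_single_left, Fin.rev_last,
    Pi.add_apply, Pi.smul_apply, Pi.single_apply, zero_ne_last, if_false, smul_eq_mul,
    frameMid_zero, antiQuad_eq_antiPair, antiPair_comm (frameMid d ℓ v t) t]
  ring

/-- Up to the conformal factor, the reflected frame has the antidiagonal Gram matrix. -/
theorem antiPair_frameVec (hd : IsEulerWeight d) (hℓ : IsLogSqBranch Λ ℓ) (ht : t 0 ∈ Λ)
    (v : Pt 𝕜 (n + 2)) :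
    confFactor d ℓ t * antiPair (frameVec d ℓ v t) (frameVec d ℓ v t) = antiQuad v := by
  have h0 := hℓ.ne_zero ht
  have h1 := antiPair_self_frameVec (d := d) (ℓ := ℓ) h0 v
  have h2 := antiPair_frameMid hd hℓ ht v
  rw [antiPair_frameVec_aux, mul_add, mul_sub, h2]
  have h3 : confFactor d ℓ t * (2 * (v 0 * (t 0)⁻¹) * antiPair t (frameVec d ℓ v t))
      = 2 * (v 0 * (t 0)⁻¹) * (confFactor d ℓ t * antiPair t (frameVec d ℓ v t)) := by ring
  rw [h3, h1]
  field_simp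
  ring

/-! ### Derivatives along the frame -/

theorem hasDirDeriv_coord_conjField (h0 : t 0 ≠ 0) (v : Pt 𝕜 (n + 2)) (i : Fin (n + 2)) :
    HasDirDeriv (fun q => q i)
      (frameVec d ℓ v t i - (2 * v 0 / (d 0 * t 0)) * (d i * t i)) t (conjField d ℓ v t) :=
  (HasDirDeriv.coord i _ _).congr_deriv (conjField_apply h0 v i)

theorem hasDirDeriv_zero_conjField (hd : IsEulerWeight d) (h0 : t 0 ≠ 0) (v : Pt 𝕜 (n + 2)) :
    HasDirDeriv (fun q => q 0) (-v 0) t (conjField d ℓ v t) :=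
  (HasDirDeriv.coord 0 _ _).congr_deriv (conjField_zero hd h0 v)

theorem hasDirDeriv_inv_conjField (hd : IsEulerWeight d) (h0 : t 0 ≠ 0) (v : Pt 𝕜 (n + 2)) :
    HasDirDeriv (fun q => (q 0)⁻¹) (v 0 * (t 0)⁻¹ * (t 0)⁻¹) t (conjField d ℓ v t) :=
  ((hasDirDeriv_zero_conjField hd h0 v).inv h0).congr_deriv (by ring)

theorem hasDirDeriv_confFactor (hd : IsEulerWeight d) (hℓ : IsLogSqBranch Λ ℓ) (ht : t 0 ∈ Λ)
    (v : Pt 𝕜 (n + 2)) :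
    HasDirDeriv (confFactor d ℓ) (2 * v 0 / (d 0 * t 0) * confFactor d ℓ t) t
      (conjField d ℓ v t) := by
  have h0 := hℓ.ne_zero ht
  have := hd.ne_zero
  refine (HasDirDeriv.scomp (hℓ.hasDerivAt_powBranch _ ht)
    (hasDirDeriv_zero_conjField (ℓ := ℓ) hd h0 v)).congr_deriv ?_
  rw [confFactor]; field_simp

theorem hasDirDeriv_flowFactor (hd : IsEulerWeight d) (hℓ : IsLogSqBranch Λ ℓ) (ht : t 0 ∈ Λ)
    (v : Pt 𝕜 (n + 2)) (i : Fin (n + 2)) :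
    HasDirDeriv (flowFactor d ℓ i) (2 * v 0 / (d 0 * t 0) * d i * flowFactor d ℓ i t) t
      (conjField d ℓ v t) := by
  have h0 := hℓ.ne_zero ht
  have := hd.ne_zero
  refine (HasDirDeriv.scomp (hℓ.hasDerivAt_powBranch _ ht)
    (hasDirDeriv_zero_conjField (ℓ := ℓ) hd h0 v)).congr_deriv ?_
  rw [flowFactor]; field_simp

theorem hasDirDeriv_frameMid (hd : IsEulerWeight d) (hℓ : IsLogSqBranch Λ ℓ) (ht : t 0 ∈ Λ)
    (v : Pt 𝕜 (n + 2)) (i : Fin (n + 2)) :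
    HasDirDeriv (fun q => frameMid d ℓ v q i)
      ((v 0 * (t 0)⁻¹ - 2 * v 0 / (d 0 * t 0) * d i) * frameMid d ℓ v t i) t
      (conjField d ℓ v t) := by
  have h0 := hℓ.ne_zero ht
  by_cases hi : i = 0 ∨ i = Fin.last (n + 1)
  · simp only [frameMid, if_pos hi, mul_zero]
    exact HasDirDeriv.const 0 _ _
  · simp only [frameMid, if_neg hi]
    have hw := flowFactor_ne_zero (d := d) (ℓ := ℓ) (t := t) i
    refine ((((hasDirDeriv_flowFactor hd hℓ ht v i).inv hw).mul
      (hasDirDeriv_inv_conjField hd h0 v)).const_mul (v i)).congr_deriv ?_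
    field_simp
    ring

theorem antiPair_self_conjField (hd : IsEulerWeight d) (h0 : t 0 ≠ 0) (v : Pt 𝕜 (n + 2)) :
    antiPair t (conjField d ℓ v t) = antiPair t (frameVec d ℓ v t)
      - (1 / 2) * (2 * v 0 / (d 0 * t 0) + 2 * (v 0 * (t 0)⁻¹)) * antiQuad t := by
  have h1 := antiPair_diagField hd.add_rev t t
  have h2 : conjField d ℓ v t
      = frameVec d ℓ v t + (-(2 * v 0 / (d 0 * t 0))) • diagField d t := by
    ext i; rw [conjField_apply h0]; simp [diagField]; ring
  have h3 : 2 * v 0 / (d 0 * t 0) * d 0 = 2 * (v 0 * (t 0)⁻¹) := by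
    have := hd.ne_zero
    field_simp
  rw [antiPair_comm (diagField d t)] at h1
  rw [h2, antiPair_add_right, antiPair_smul_right, antiQuad_eq_antiPair]
  linear_combination (-(2 * v 0 / (d 0 * t 0)) / 2) * h1 - (1 / 2) * antiPair t t * h3

theorem hasDirDeriv_confFactor_antiQuad (hd : IsEulerWeight d) (hℓ : IsLogSqBranch Λ ℓ)
    (ht : t 0 ∈ Λ) (v : Pt 𝕜 (n + 2)) :
    HasDirDeriv (fun q => (1 / 2) * (confFactor d ℓ q * antiQuad q))
      (confFactor d ℓ t * antiPair t (frameVec d ℓ v t)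
        - 2 * (v 0 * (t 0)⁻¹) * ((1 / 2) * (confFactor d ℓ t * antiQuad t))) t
      (conjField d ℓ v t) := by
  have h0 := hℓ.ne_zero ht
  refine (((hasDirDeriv_confFactor hd hℓ ht v).mul (hasDirDeriv_antiQuad t _)).const_mul
    (1 / 2)).congr_deriv ?_
  rw [antiPair_self_conjField hd h0]
  ring

theorem hasDirDeriv_antiPair_frameMid (hd : IsEulerWeight d) (hℓ : IsLogSqBranch Λ ℓ)
    (ht : t 0 ∈ Λ) (v : Pt 𝕜 (n + 2)) :
    HasDirDeriv (fun q => antiPair q (frameMid d ℓ v q))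
      (antiPair (frameMid d ℓ v t) (frameMid d ℓ v t)
        - 2 * v 0 / (d 0 * t 0) * antiPair t (frameMid d ℓ v t)) t (conjField d ℓ v t) := by
  have h0 := hℓ.ne_zero ht
  refine (HasDirDeriv.antiPair (f := id) (g := fun q => frameMid d ℓ v q)
    (f' := conjField d ℓ v t)
    (g' := (v 0 * (t 0)⁻¹) • frameMid d ℓ v t
      + (-(2 * v 0 / (d 0 * t 0))) • diagField d (frameMid d ℓ v t))
    (fun i => HasDirDeriv.coord i _ _)
    (fun i => (hasDirDeriv_frameMid hd hℓ ht v i).congr_deriv ?_)).congr_deriv ?_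
  · simp [diagField]; ring
  · have h1 := antiPair_diagField hd.add_rev t (frameMid d ℓ v t)
    have h2 : conjField d ℓ v t
        = frameVec d ℓ v t + (-(2 * v 0 / (d 0 * t 0))) • diagField d t := by
      ext i; rw [conjField_apply h0]; simp [diagField]; ring
    have h3 : 2 * v 0 / (d 0 * t 0) * d 0 = 2 * (v 0 * (t 0)⁻¹) := by
      have := hd.ne_zero
      field_simp
    simp only [h2, frameVec, id, antiPair_add_left, antiPair_add_right, antiPair_smul_left,
      antiPair_smul_right, antiPair_single_left, Fin.rev_last, frameMid_zero]
    linear_combination (-(2 * v 0 / (d 0 * t 0))) * h1 - antiPair t (frameMid d ℓ v t) * h3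

theorem hasDirDeriv_frameLast (hd : IsEulerWeight d) (hℓ : IsLogSqBranch Λ ℓ)
    (ht : t 0 ∈ Λ) (v : Pt 𝕜 (n + 2)) :
    HasDirDeriv (frameLast d ℓ v)
      ((v 0 * (t 0)⁻¹ - 2 * v 0 / (d 0 * t 0)) * frameLast d ℓ v t
        - antiPair (frameVec d ℓ v t) (frameVec d ℓ v t) * (t 0)⁻¹) t (conjField d ℓ v t) := by
  have h0 := hℓ.ne_zero ht
  have hd0 := hd.ne_zero
  have hc := confFactor_ne_zero (d := d) (ℓ := ℓ) (t := t)
  have hi := hasDirDeriv_inv_conjField (ℓ := ℓ) hd h0 v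
  refine ((((hasDirDeriv_confFactor hd hℓ ht v).inv hc).const_mul (v (Fin.last (n + 1)))).sub
    (hi.mul ((((hi.const_mul (v 0)).mul (hasDirDeriv_antiQuad t _)).const_mul (1 / 2)).add
      (hasDirDeriv_antiPair_frameMid hd hℓ ht v)))).congr_deriv ?_
  have h1 := antiPair_self_frameVec (d := d) (ℓ := ℓ) h0 v
  rw [antiPair_frameVec_aux, antiPair_self_conjField hd h0]
  have h2 : antiPair t (frameVec d ℓ v t) = (v (Fin.last (n + 1)) * t 0
      + (1 / 2) * (v 0 * (t 0)⁻¹ * (confFactor d ℓ t * antiQuad t))) * (confFactor d ℓ t)⁻¹ := by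
    rw [← h1]; field_simp
  rw [h2, frameLast]
  field_simp
  ring

/-- The components of the derivative of `frameVec` along `conjField`, that is, of the reflected
field `A X` along the field `X = ∑ vⁱ ∂/∂sⁱ`. -/
theorem hasDirDeriv_frameVec (hd : IsEulerWeight d) (hℓ : IsLogSqBranch Λ ℓ)
    (ht : t 0 ∈ Λ) (v : Pt 𝕜 (n + 2)) (i : Fin (n + 2)) :
    HasDirDeriv (fun q => frameVec d ℓ v q i)
      ((2 * (v 0 * (t 0)⁻¹) - 2 * v 0 / (d 0 * t 0) * d i) * frameVec d ℓ v t i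
        - if i = Fin.last (n + 1) then
          antiPair (frameVec d ℓ v t) (frameVec d ℓ v t) * (t 0)⁻¹ else 0) t
      (conjField d ℓ v t) := by
  have h0 := hℓ.ne_zero ht
  have hi := hasDirDeriv_inv_conjField (ℓ := ℓ) hd h0 v
  refine (((hi.const_mul (v 0)).mul (hasDirDeriv_coord_conjField h0 v i)).add
    (hasDirDeriv_frameMid hd hℓ ht v i) |>.add ((hasDirDeriv_frameLast hd hℓ ht v).mul
    (HasDirDeriv.const ((Pi.single (Fin.last (n + 1)) 1 : Pt 𝕜 (n + 2)) i) _ _))).congr_deriv ?_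
  have he : frameVec d ℓ v t i = v 0 * (t 0)⁻¹ * t i + frameMid d ℓ v t i
    + frameLast d ℓ v t * (Pi.single (Fin.last (n + 1)) 1 : Pt 𝕜 (n + 2)) i := rfl
  by_cases hl : i = Fin.last (n + 1)
  · subst hl
    simp only [he, Pi.single_eq_same, hd.last, if_true, mul_one, mul_zero, add_zero]
    ring
  · rw [he, Pi.single_eq_of_ne hl]
    simp only [if_neg hl, mul_zero, add_zero, sub_zero]
    ring

/-! ### The conjugate coordinates form a coordinate system -/

theorem hasDirDeriv_conjCoord (hd : IsEulerWeight d) (hℓ : IsLogSqBranch Λ ℓ)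
    (ht : t 0 ∈ Λ) (v : Pt 𝕜 (n + 2)) (i : Fin (n + 2)) :
    HasDirDeriv (fun q => conjCoord d ℓ q i) (v i) t (conjField d ℓ v t) := by
  have h0 := hℓ.ne_zero ht
  by_cases hi : i = 0
  · subst hi
    simp only [conjCoord, if_true]
    exact (hasDirDeriv_zero_conjField hd h0 v).neg.congr_deriv (neg_neg _)
  by_cases hl : i = Fin.last (n + 1)
  · subst hl
    simp only [conjCoord, if_neg hi, if_true]
    refine (((hasDirDeriv_confFactor_antiQuad hd hℓ ht v).mul
      (hasDirDeriv_inv_conjField hd h0 v)).congr_of_eventuallyEq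
        (Eventually.of_forall fun q => ?_)).congr_deriv ?_
    · simp only [confFactor]; ring
    · rw [antiPair_self_frameVec h0]
      field_simp
      ring
  · simp only [conjCoord, if_neg hi, if_neg hl]
    refine ((hasDirDeriv_coord_conjField h0 v i).mul ((hasDirDeriv_zero_conjField hd h0 v).mul
      (hasDirDeriv_flowFactor hd hℓ ht v i))).congr_deriv ?_
    have hm : frameMid d ℓ v t i = v i * ((flowFactor d ℓ i t)⁻¹ * (t 0)⁻¹) := by
      rw [frameMid, if_neg (by tauto)]
    have he : frameVec d ℓ v t i = v 0 * (t 0)⁻¹ * t i + frameMid d ℓ v t i := by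
      simp [frameVec, Pi.single_eq_of_ne hl]
    have hw := flowFactor_ne_zero (d := d) (ℓ := ℓ) (t := t) i
    have := hd.ne_zero
    change _ * (t 0 * flowFactor d ℓ i t) + _ = _
    rw [he, hm]
    field_simp
    ring

theorem isOpen_preimage_zero (hℓ : IsLogSqBranch Λ ℓ) :
    IsOpen {t : Pt 𝕜 (n + 2) | t 0 ∈ Λ} := hℓ.isOpen.preimage (continuous_apply 0)

theorem contDiffOn_coord (i : Fin (n + 2)) (s : Set (Pt 𝕜 (n + 2))) :
    ContDiffOn 𝕜 ∞ (fun q => q i) s := (contDiff_apply 𝕜 𝕜 i).contDiffOn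

theorem contDiffOn_inv_zero (hℓ : IsLogSqBranch Λ ℓ) :
    ContDiffOn 𝕜 ∞ (fun q : Pt 𝕜 (n + 2) => (q 0)⁻¹) {t | t 0 ∈ Λ} :=
  (contDiffOn_coord 0 _).inv fun _ hx => hℓ.ne_zero hx

theorem contDiffOn_powBranch_zero (hℓ : IsLogSqBranch Λ ℓ) (a : 𝕜) :
    ContDiffOn 𝕜 ∞ (fun q : Pt 𝕜 (n + 2) => powBranch ℓ a (q 0)) {t | t 0 ∈ Λ} :=
  (hℓ.contDiffOn_powBranch a).comp (contDiffOn_coord 0 _) fun _ hx => hx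

theorem contDiffOn_antiQuad {m : ℕ} (s : Set (Pt 𝕜 (m + 1))) : ContDiffOn 𝕜 ∞ antiQuad s :=
  ContDiffOn.sum fun i _ => ((contDiff_apply 𝕜 𝕜 i).mul (contDiff_apply 𝕜 𝕜 _)).contDiffOn

/-- A point is determined by the quadratic form and all coordinates but the last, if its first
coordinate is not `0`. -/
theorem eq_of_antiQuad_eq {p q : Pt 𝕜 (n + 2)} (hp0 : p 0 ≠ 0)
    (hmid : ∀ i, i ≠ Fin.last (n + 1) → p i = q i) (hQ : antiQuad p = antiQuad q) : p = q := by
  have h0 : p 0 = q 0 := hmid 0 zero_ne_last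
  have hsum : ∑ i ∈ Finset.Ioo (0 : Fin (n + 2)) (Fin.last (n + 1)), p i * p (Fin.rev i)
      = ∑ i ∈ Finset.Ioo (0 : Fin (n + 2)) (Fin.last (n + 1)), q i * q (Fin.rev i) := by
    refine Finset.sum_congr rfl fun i hi => ?_
    rw [Finset.mem_Ioo] at hi
    rw [hmid i hi.2.ne, hmid _ (by
      rw [Ne, Fin.rev_eq_iff, Fin.rev_last]; exact hi.1.ne')]
  rw [antiQuad_split, antiQuad_split q, hsum, ← h0] at hQ
  have hlast : p (Fin.last (n + 1)) = q (Fin.last (n + 1)) :=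
    mul_left_cancel₀ (mul_ne_zero two_ne_zero hp0) (add_right_cancel hQ)
  ext i
  by_cases hl : i = Fin.last (n + 1)
  · rw [hl, hlast]
  · exact hmid i hl

theorem injOn_conjCoord (hℓ : IsLogSqBranch Λ ℓ) :
    InjOn (conjCoord d ℓ) {t : Pt 𝕜 (n + 2) | t 0 ∈ Λ} := by
  intro p hp q hq h
  have hp0 := hℓ.ne_zero hp
  have h0 : p 0 = q 0 := by simpa [conjCoord] using congrFun h 0
  have hmid : ∀ i, i ≠ Fin.last (n + 1) → p i = q i := by
    intro i hl
    by_cases hi : i = 0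
    · rw [hi, h0]
    · have := congrFun h i
      simp only [conjCoord, if_neg hi, if_neg hl, ← h0] at this
      exact mul_right_cancel₀ (mul_ne_zero hp0 (powBranch_ne_zero _ _)) this
  have hQ : antiQuad p = antiQuad q := by
    have := congrFun h (Fin.last (n + 1))
    simp only [conjCoord, if_neg zero_ne_last.symm, if_true, ← h0] at this
    have := mul_right_cancel₀ (mul_ne_zero (powBranch_ne_zero _ _) (inv_ne_zero hp0)) this
    exact mul_left_cancel₀ (by norm_num) this
  exact eq_of_antiQuad_eq hp0 hmid hQ

theorem fderiv_conjCoord_conjField (hd : IsEulerWeight d) (hℓ : IsLogSqBranch Λ ℓ)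
    (ht : t 0 ∈ Λ) (v : Pt 𝕜 (n + 2)) :
    fderiv 𝕜 (conjCoord d ℓ) t (conjField d ℓ v t) = v := by
  have hdiff : DifferentiableAt 𝕜 (conjCoord d ℓ) t :=
    differentiableAt_pi.2 fun i => (hasDirDeriv_conjCoord hd hℓ ht v i).1
  ext i
  rw [← fderiv_coord_apply hdiff]
  exact (hasDirDeriv_conjCoord hd hℓ ht v i).2

theorem isCoordinateSystem_conjCoord (hd : IsEulerWeight d) (hℓ : IsLogSqBranch Λ ℓ) :
    IsCoordinateSystem {t : Pt 𝕜 (n + 2) | t 0 ∈ Λ} (conjCoord d ℓ) := by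
  refine ⟨contDiffOn_pi.2 fun i => ?_, injOn_conjCoord hℓ, fun t ht => ?_⟩
  · by_cases hi : i = 0
    · simp only [conjCoord, if_pos hi]
      exact (contDiffOn_coord 0 _).neg
    by_cases hl : i = Fin.last (n + 1)
    · simp only [conjCoord, if_neg hi, if_pos hl]
      exact (contDiffOn_const.mul (contDiffOn_antiQuad _)).mul
        ((contDiffOn_powBranch_zero hℓ _).mul (contDiffOn_inv_zero hℓ))
    · simp only [conjCoord, if_neg hi, if_neg hl]
      exact (contDiffOn_coord i _).mul
        ((contDiffOn_coord 0 _).mul (contDiffOn_powBranch_zero hℓ _))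
  · have hsurj : Function.Surjective (fderiv 𝕜 (conjCoord d ℓ) t) := fun v =>
      ⟨_, fderiv_conjCoord_conjField hd hℓ ht v⟩
    have hinj : Function.Injective (fderiv 𝕜 (conjCoord d ℓ) t) :=
      LinearMap.injective_iff_surjective (f := (fderiv 𝕜 (conjCoord d ℓ) t).toLinearMap) |>.2 hsurj
    exact ⟨(LinearEquiv.ofBijective (fderiv 𝕜 (conjCoord d ℓ) t).toLinearMap
      ⟨hinj, hsurj⟩).toContinuousLinearEquiv, by ext; rfl⟩

theorem coordField_conjCoord (hd : IsEulerWeight d) (hℓ : IsLogSqBranch Λ ℓ)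
    (ht : t 0 ∈ Λ) (i : Fin (n + 2)) :
    coordField (conjCoord d ℓ) i t = conjField d ℓ (Pi.single i 1) t := by
  have hx := isCoordinateSystem_conjCoord hd hℓ
  apply (hx.2.2 t ht).injective
  rw [fderiv_coordField hx ht, fderiv_conjCoord_conjField hd hℓ ht]

theorem conjField_eq_sum (hd : IsEulerWeight d) (hℓ : IsLogSqBranch Λ ℓ)
    (ht : t 0 ∈ Λ) (v : Pt 𝕜 (n + 2)) :
    conjField d ℓ v t = ∑ i, v i • coordField (conjCoord d ℓ) i t := by
  have hx := isCoordinateSystem_conjCoord hd hℓ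
  rw [eq_sum_coordField hx ht (conjField d ℓ v t), fderiv_conjCoord_conjField hd hℓ ht]

end Frame

/-! ### Cubic forms -/

section CubicForm

variable {𝕜 : Type*} [RCLike 𝕜] {r : ℕ}

/-- The trilinear form with the components `C`. -/
def cubicForm (C : Fin r → Fin r → Fin r → 𝕜) (u v w : Pt 𝕜 r) : 𝕜 :=
  ∑ i, ∑ j, ∑ k, u i * v j * w k * C i j k

theorem isLinearMap_cubicForm_left (C : Fin r → Fin r → Fin r → 𝕜) (v w : Pt 𝕜 r) :
    IsLinearMap 𝕜 fun u => cubicForm C u v w where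
  map_add u u' := by simp only [cubicForm, Pi.add_apply, add_mul, Finset.sum_add_distrib]
  map_smul a u := by
    simp only [cubicForm, Pi.smul_apply, smul_eq_mul, Finset.mul_sum, mul_assoc]

theorem isLinearMap_cubicForm_middle (C : Fin r → Fin r → Fin r → 𝕜) (u w : Pt 𝕜 r) :
    IsLinearMap 𝕜 fun v => cubicForm C u v w where
  map_add v v' := by simp only [cubicForm, Pi.add_apply, mul_add, add_mul, Finset.sum_add_distrib]
  map_smul a v := by
    simp only [cubicForm, Pi.smul_apply, smul_eq_mul, Finset.mul_sum, mul_assoc, mul_left_comm]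

theorem isLinearMap_cubicForm_right (C : Fin r → Fin r → Fin r → 𝕜) (u v : Pt 𝕜 r) :
    IsLinearMap 𝕜 fun w => cubicForm C u v w where
  map_add w w' := by simp only [cubicForm, Pi.add_apply, mul_add, add_mul, Finset.sum_add_distrib]
  map_smul a w := by
    simp only [cubicForm, Pi.smul_apply, smul_eq_mul, Finset.mul_sum, mul_assoc, mul_left_comm]

theorem cubicForm_sum (C : Fin r → Fin r → Fin r → 𝕜) (Y : Fin r → Pt 𝕜 r) (u v w : Pt 𝕜 r) :
    cubicForm C (∑ i, u i • Y i) (∑ i, v i • Y i) (∑ i, w i • Y i)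
      = cubicForm (fun i j k => cubicForm C (Y i) (Y j) (Y k)) u v w := by
  have h1 : ∀ v w, cubicForm C (∑ i, u i • Y i) v w = ∑ i, u i * cubicForm C (Y i) v w :=
    fun v w => by
      have := map_sum (IsLinearMap.mk' _ (isLinearMap_cubicForm_left C v w))
        (fun i => u i • Y i) Finset.univ
      simpa only [map_smul, IsLinearMap.mk'_apply, smul_eq_mul] using this
  have h2 : ∀ u w, cubicForm C u (∑ i, v i • Y i) w = ∑ i, v i * cubicForm C u (Y i) w :=
    fun u w => by
      have := map_sum (IsLinearMap.mk' _ (isLinearMap_cubicForm_middle C u w))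
        (fun i => v i • Y i) Finset.univ
      simpa only [map_smul, IsLinearMap.mk'_apply, smul_eq_mul] using this
  have h3 : ∀ u v, cubicForm C u v (∑ i, w i • Y i) = ∑ i, w i * cubicForm C u v (Y i) :=
    fun u v => by
      have := map_sum (IsLinearMap.mk' _ (isLinearMap_cubicForm_right C u v))
        (fun i => w i • Y i) Finset.univ
      simpa only [map_smul, IsLinearMap.mk'_apply, smul_eq_mul] using this
  rw [h1]
  simp only [h2, h3]
  simp only [cubicForm, Finset.mul_sum]
  refine Finset.sum_congr rfl fun i _ => Finset.sum_congr rfl fun j _ =>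
    Finset.sum_congr rfl fun k _ => ?_
  simp only [mul_assoc]

theorem cubicForm_sub (C C' : Fin r → Fin r → Fin r → 𝕜) (u v w : Pt 𝕜 r) :
    cubicForm (fun i j k => C i j k - C' i j k) u v w = cubicForm C u v w - cubicForm C' u v w := by
  simp only [cubicForm, mul_sub, Finset.sum_sub_distrib]

theorem cubicForm_comm_left {C : Fin r → Fin r → Fin r → 𝕜} (h : ∀ i j k, C i j k = C j i k)
    (u v w : Pt 𝕜 r) : cubicForm C u v w = cubicForm C v u w := by
  rw [cubicForm, Finset.sum_comm]
  exact Finset.sum_congr rfl fun i _ => Finset.sum_congr rfl fun j _ =>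
    Finset.sum_congr rfl fun k _ => by rw [h]; ring

theorem cubicForm_comm_right {C : Fin r → Fin r → Fin r → 𝕜} (h : ∀ i j k, C i j k = C i k j)
    (u v w : Pt 𝕜 r) : cubicForm C u v w = cubicForm C u w v := by
  refine Finset.sum_congr rfl fun i _ => ?_
  rw [Finset.sum_comm]
  exact Finset.sum_congr rfl fun j _ => Finset.sum_congr rfl fun k _ => by rw [h]; ring

/-- `Π(u ∘ v, w)` as a cubic form. -/
theorem pair_mul_eq_cubicForm (S : FrobeniusData 𝕜 r) (p u v w : Pt 𝕜 r) :
    S.pair p (S.mul p u v) w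
      = cubicForm (fun i j k => ∑ l, S.c p i j l * S.metric p l k) u v w := by
  simp only [FrobeniusData.pair, FrobeniusData.mul, cubicForm, Finset.mul_sum, Finset.sum_mul]
  rw [Finset.sum_comm]
  calc _ = ∑ k, ∑ i, ∑ l, ∑ j, S.metric p l k * (S.c p i j l * u i * v j) * w k :=
        Finset.sum_congr rfl fun k _ => Finset.sum_comm
    _ = ∑ i, ∑ k, ∑ l, ∑ j, S.metric p l k * (S.c p i j l * u i * v j) * w k := Finset.sum_comm
    _ = ∑ i, ∑ k, ∑ j, ∑ l, S.metric p l k * (S.c p i j l * u i * v j) * w k :=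
        Finset.sum_congr rfl fun i _ => Finset.sum_congr rfl fun k _ => Finset.sum_comm
    _ = ∑ i, ∑ j, ∑ k, ∑ l, S.metric p l k * (S.c p i j l * u i * v j) * w k :=
        Finset.sum_congr rfl fun i _ => Finset.sum_comm
    _ = _ := Finset.sum_congr rfl fun i _ => Finset.sum_congr rfl fun j _ =>
        Finset.sum_congr rfl fun k _ => Finset.sum_congr rfl fun l _ => by ring

end CubicForm

/-! ### Third derivatives of the conjugate potential -/

section ConjPotential

variable {𝕜 : Type*} [RCLike 𝕜] {n : ℕ}

theorem StandardForm.isEulerWeight {M : Set (Pt 𝕜 (n + 2))} {S : FrobeniusData 𝕜 (n + 2)}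
    {F : Pt 𝕜 (n + 2) → 𝕜} {d : Fin (n + 2) → 𝕜} (h : StandardForm M S F d) : IsEulerWeight d :=
  ⟨h.deg_zero_ne, h.deg_last, h.deg_add'⟩

/-- The third derivative of `F` as an array. -/
def thirdPd (F : Pt 𝕜 (n + 2) → 𝕜) (t : Pt 𝕜 (n + 2)) (i j k : Fin (n + 2)) : 𝕜 :=
  pd i (pd j (pd k F)) t

/-- `ρ² F'(Y)`, where `ρ` is `confFactor` and `Y` is `frameVec`. -/
def jetOne (d : Fin (n + 2) → 𝕜) (ℓ : 𝕜 → 𝕜) (F : Pt 𝕜 (n + 2) → 𝕜) (v t : Pt 𝕜 (n + 2)) : 𝕜 :=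
  confFactor d ℓ t ^ 2 * ∑ i, frameVec d ℓ v t i * pd i F t

/-- `ρ² F''(Y, Y)`, where `ρ` is `confFactor` and `Y` is `frameVec`. -/
def jetTwo (d : Fin (n + 2) → 𝕜) (ℓ : 𝕜 → 𝕜) (F : Pt 𝕜 (n + 2) → 𝕜) (v t : Pt 𝕜 (n + 2)) : 𝕜 :=
  confFactor d ℓ t ^ 2 *
    ∑ i, ∑ j, frameVec d ℓ v t i * (frameVec d ℓ v t j * pd i (pd j F) t)

variable {M : Set (Pt 𝕜 (n + 2))} {S : FrobeniusData 𝕜 (n + 2)} {F : Pt 𝕜 (n + 2) → 𝕜}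
  {d : Fin (n + 2) → 𝕜} {Λ : Set 𝕜} {ℓ : 𝕜 → 𝕜} {t : Pt 𝕜 (n + 2)}

theorem HasDirDeriv.sq {f : Pt 𝕜 (n + 2) → 𝕜} {c : 𝕜} {p V : Pt 𝕜 (n + 2)}
    (h : HasDirDeriv f c p V) : HasDirDeriv (fun q => f q ^ 2) (2 * c * f p) p V := by
  simp only [pow_two]
  exact (h.mul h).congr_deriv (by ring)

/-- The derivative of a quasihomogeneous function along a constant combination of the conjugate
coordinate fields. -/
theorem hasDirDeriv_conjField_of_homogeneous (h0 : t 0 ≠ 0)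
    {f : Pt 𝕜 (n + 2) → 𝕜} {c : 𝕜} (hf : DifferentiableAt 𝕜 f t)
    (hc : fderiv 𝕜 f t (diagField d t) = c * f t) (v : Pt 𝕜 (n + 2)) :
    HasDirDeriv f (∑ k, frameVec d ℓ v t k * pd k f t - 2 * v 0 / (d 0 * t 0) * (c * f t)) t
      (conjField d ℓ v t) := by
  refine ⟨hf, ?_⟩
  have h2 : conjField d ℓ v t
      = frameVec d ℓ v t - (2 * v 0 / (d 0 * t 0)) • diagField d t := by
    ext i; rw [conjField_apply h0]; simp [diagField]
  rw [h2, map_sub, map_smul, hc, fderiv_eq_sum_pd, smul_eq_mul]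

theorem two_mul_div_mul_zero (hd : IsEulerWeight d) (v : Pt 𝕜 (n + 2)) :
    2 * v 0 / (d 0 * t 0) * d 0 = 2 * (v 0 * (t 0)⁻¹) := by
  have := hd.ne_zero
  field_simp

variable (h : StandardForm M S F d) (hℓ : IsLogSqBranch Λ ℓ) (ht : t ∈ M) (hΛ : t 0 ∈ Λ)

include h hℓ ht hΛ in
theorem hasDirDeriv_jetZero (v : Pt 𝕜 (n + 2)) :
    HasDirDeriv (fun q => confFactor d ℓ q ^ 2 * F q)
      (jetOne d ℓ F v t - 2 * (v 0 * (t 0)⁻¹) * (confFactor d ℓ t ^ 2 * F t)) t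
      (conjField d ℓ v t) := by
  have hd := h.isEulerWeight
  have h0 := hℓ.ne_zero hΛ
  have hF := hasDirDeriv_conjField_of_homogeneous (ℓ := ℓ) h0
    (h.smooth.differentiableAt_of_isOpen h.isOpen ht) (h.homogeneous' ht) v
  refine ((hasDirDeriv_confFactor hd hℓ hΛ v).sq.mul hF).congr_deriv ?_
  rw [jetOne]
  linear_combination (-confFactor d ℓ t ^ 2 * F t) * two_mul_div_mul_zero (t := t) hd v

include h hℓ ht hΛ in
theorem hasDirDeriv_jetOne (v : Pt 𝕜 (n + 2)) :
    HasDirDeriv (jetOne d ℓ F v)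
      (jetTwo d ℓ F v t - antiQuad v * (t 0)⁻¹ * ((1 / 2) * (confFactor d ℓ t * antiQuad t))) t
      (conjField d ℓ v t) := by
  have hd := h.isEulerWeight
  have h0 := hℓ.ne_zero hΛ
  set κ := 2 * v 0 / (d 0 * t 0) with hκ
  set a := v 0 * (t 0)⁻¹ with ha
  set Y := frameVec d ℓ v t with hY
  have hκa : κ * d 0 = 2 * a := two_mul_div_mul_zero hd v
  have hsum : HasDirDeriv (fun q => ∑ i, frameVec d ℓ v q i * pd i F q)
      (∑ i, ((Y i * ∑ k, Y k * pd k (pd i F) t) + (2 * a - κ * (2 + d 0)) * (Y i * pd i F t)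
        - if i = Fin.last (n + 1) then antiPair Y Y * (t 0)⁻¹ * pd i F t else 0)) t
      (conjField d ℓ v t) := by
    refine HasDirDeriv.sum fun i _ => ((hasDirDeriv_frameVec hd hℓ hΛ v i).mul
      (hasDirDeriv_conjField_of_homogeneous h0
        ((h.smooth_pd i).differentiableAt_of_isOpen h.isOpen ht)
        (h.homogeneous_pd ht i) v)).congr_deriv ?_
    rw [← hκ, ← ha, ← hY]
    split_ifs <;> ring
  refine ((hasDirDeriv_confFactor hd hℓ hΛ v).sq.mul hsum).congr_deriv ?_
  rw [Finset.sum_sub_distrib, Finset.sum_add_distrib, ← Finset.mul_sum, Finset.sum_ite_eq',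
    if_pos (Finset.mem_univ _), h.pd_last t ht, ← antiPair_frameVec hd hℓ hΛ v, ← hY, ← hκ, jetTwo]
  have e : ∑ i, Y i * ∑ k, Y k * pd k (pd i F) t = ∑ i, ∑ j, Y i * (Y j * pd i (pd j F) t) := by
    refine Finset.sum_congr rfl fun i _ => ?_
    rw [Finset.mul_sum]
    exact Finset.sum_congr rfl fun j _ => by rw [pd_comm h.isOpen h.smooth ht]
  rw [e]
  linear_combination (-confFactor d ℓ t ^ 2 * ∑ i, Y i * pd i F t) * hκa

include h hℓ ht hΛ in
theorem hasDirDeriv_jetTwo (v : Pt 𝕜 (n + 2)) :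
    HasDirDeriv (jetTwo d ℓ F v)
      (confFactor d ℓ t ^ 2 * cubicForm (thirdPd F t) (frameVec d ℓ v t) (frameVec d ℓ v t)
          (frameVec d ℓ v t) + 2 * (v 0 * (t 0)⁻¹) * jetTwo d ℓ F v t
        - 2 * (antiQuad v * (t 0)⁻¹ * (confFactor d ℓ t * antiPair t (frameVec d ℓ v t)))) t
      (conjField d ℓ v t) := by
  have hd := h.isEulerWeight
  have h0 := hℓ.ne_zero hΛ
  set κ := 2 * v 0 / (d 0 * t 0) with hκ
  set a := v 0 * (t 0)⁻¹ with ha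
  set Y := frameVec d ℓ v t with hY
  have hκa : κ * d 0 = 2 * a := two_mul_div_mul_zero hd v
  have hsum : HasDirDeriv (fun q => ∑ i, ∑ j, frameVec d ℓ v q i *
        (frameVec d ℓ v q j * pd i (pd j F) q))
      (∑ i, ∑ j, ((Y i * (Y j * ∑ k, Y k * pd k (pd i (pd j F)) t))
        + (4 * a - κ * (2 + d 0)) * (Y i * (Y j * pd i (pd j F) t))
        - (if i = Fin.last (n + 1) then antiPair Y Y * (t 0)⁻¹ * (Y j * pd i (pd j F) t) else 0)
        - (if j = Fin.last (n + 1) then antiPair Y Y * (t 0)⁻¹ * (Y i * pd i (pd j F) t) else 0))) t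
      (conjField d ℓ v t) := by
    refine HasDirDeriv.sum fun i _ => HasDirDeriv.sum fun j _ =>
      ((hasDirDeriv_frameVec hd hℓ hΛ v i).mul ((hasDirDeriv_frameVec hd hℓ hΛ v j).mul
        (hasDirDeriv_conjField_of_homogeneous h0
          ((h.smooth_pd_pd i j).differentiableAt_of_isOpen h.isOpen ht)
          (h.homogeneous_pd_pd ht i j) v))).congr_deriv ?_
    rw [← hκ, ← ha, ← hY]
    split_ifs <;> ring
  refine ((hasDirDeriv_confFactor hd hℓ hΛ v).sq.mul hsum).congr_deriv ?_
  have e1 : ∑ i, ∑ j, (if i = Fin.last (n + 1) then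
      antiPair Y Y * (t 0)⁻¹ * (Y j * pd i (pd j F) t) else 0)
      = antiPair Y Y * (t 0)⁻¹ * antiPair t Y := by
    rw [Finset.sum_comm]
    simp only [Finset.sum_ite_eq', Finset.mem_univ, if_true, h.pd_last_pd ht]
    rw [← Finset.mul_sum, antiPair_comm t Y]; rfl
  have e2 : ∑ i, ∑ j, (if j = Fin.last (n + 1) then
      antiPair Y Y * (t 0)⁻¹ * (Y i * pd i (pd j F) t) else 0)
      = antiPair Y Y * (t 0)⁻¹ * antiPair t Y := by
    simp only [Finset.sum_ite_eq', Finset.mem_univ, if_true, h.pd_pd_last ht]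
    rw [← Finset.mul_sum, antiPair_comm t Y]; rfl
  have e3 : ∑ i, ∑ j, Y i * (Y j * ∑ k, Y k * pd k (pd i (pd j F)) t)
      = cubicForm (thirdPd F t) Y Y Y := by
    rw [cubicForm]
    refine Finset.sum_congr rfl fun i _ => Finset.sum_congr rfl fun j _ => ?_
    simp only [Finset.mul_sum]
    refine Finset.sum_congr rfl fun k _ => ?_
    rw [thirdPd, pd_comm h.isOpen (h.smooth_pd j) ht,
      pd_congr h.isOpen (fun q hq => pd_comm h.isOpen h.smooth hq k j) i ht]
    ring
  simp only [Finset.sum_sub_distrib, Finset.sum_add_distrib, e1, e2, e3]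
  rw [← antiPair_frameVec hd hℓ hΛ v, ← hY, ← hκ, jetTwo, ← hY]
  simp only [← Finset.mul_sum]
  linear_combination (-confFactor d ℓ t ^ 2 * ∑ i, Y i * ∑ j, Y j * pd i (pd j F) t) * hκa

include h hℓ hΛ in
theorem hasDirDeriv_confFactor_last (v : Pt 𝕜 (n + 2)) :
    HasDirDeriv (fun q => confFactor d ℓ q * q (Fin.last (n + 1)))
      (confFactor d ℓ t * frameVec d ℓ v t (Fin.last (n + 1))) t (conjField d ℓ v t) := by
  have hd := h.isEulerWeight
  have h0 := hℓ.ne_zero hΛ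
  refine ((hasDirDeriv_confFactor hd hℓ hΛ v).mul
    (hasDirDeriv_coord_conjField h0 v _)).congr_deriv ?_
  rw [hd.last]; ring

include h hℓ hΛ in
theorem hasDirDeriv_confFactor_frameVec_last (v : Pt 𝕜 (n + 2)) :
    HasDirDeriv (fun q => confFactor d ℓ q * frameVec d ℓ v q (Fin.last (n + 1)))
      (2 * (v 0 * (t 0)⁻¹) * (confFactor d ℓ t * frameVec d ℓ v t (Fin.last (n + 1)))
        - antiQuad v * (t 0)⁻¹) t (conjField d ℓ v t) := by
  have hd := h.isEulerWeight
  refine ((hasDirDeriv_confFactor hd hℓ hΛ v).mul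
    (hasDirDeriv_frameVec hd hℓ hΛ v _)).congr_deriv ?_
  rw [if_pos rfl, ← antiPair_frameVec hd hℓ hΛ v, hd.last]
  ring

include h hℓ hΛ in
/-- `ρ ⟨t, Y⟩` is constant along the flow lines of a constant combination of the conjugate
coordinate fields. -/
theorem hasDirDeriv_confFactor_antiPair (v : Pt 𝕜 (n + 2)) :
    HasDirDeriv (fun q => confFactor d ℓ q * antiPair q (frameVec d ℓ v q)) 0 t
      (conjField d ℓ v t) := by
  have hd := h.isEulerWeight
  have h0 := hℓ.ne_zero hΛ
  refine ((((hasDirDeriv_zero_conjField hd h0 v).const_mul (v (Fin.last (n + 1)))).add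
    (((hasDirDeriv_inv_conjField hd h0 v).const_mul (v 0)).mul
      (hasDirDeriv_confFactor_antiQuad hd hℓ hΛ v))).congr_of_eventuallyEq ?_).congr_deriv ?_
  · filter_upwards [(isOpen_preimage_zero hℓ).mem_nhds hΛ] with q hq
    rw [antiPair_self_frameVec (hℓ.ne_zero hq)]
    ring
  · rw [antiPair_self_frameVec h0]
    field_simp
    ring

/-- The derivative of the conjugate potential along `conjField d ℓ v`. -/
def conjPotentialOne (d : Fin (n + 2) → 𝕜) (ℓ : 𝕜 → 𝕜) (F : Pt 𝕜 (n + 2) → 𝕜)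
    (v q : Pt 𝕜 (n + 2)) : 𝕜 :=
  jetOne d ℓ F v q - 2 * (v 0 * (q 0)⁻¹) * (confFactor d ℓ q ^ 2 * F q)
    - confFactor d ℓ q * frameVec d ℓ v q (Fin.last (n + 1)) *
      ((1 / 2) * (confFactor d ℓ q * antiQuad q))
    - confFactor d ℓ q * q (Fin.last (n + 1)) *
      (confFactor d ℓ q * antiPair q (frameVec d ℓ v q)
        - 2 * (v 0 * (q 0)⁻¹) * ((1 / 2) * (confFactor d ℓ q * antiQuad q)))

/-- The second derivative of the conjugate potential along `conjField d ℓ v`. -/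
def conjPotentialTwo (d : Fin (n + 2) → 𝕜) (ℓ : 𝕜 → 𝕜) (F : Pt 𝕜 (n + 2) → 𝕜)
    (v q : Pt 𝕜 (n + 2)) : 𝕜 :=
  jetTwo d ℓ F v q - 2 * (v 0 * (q 0)⁻¹) * jetOne d ℓ F v q
    + 2 * ((v 0 * (q 0)⁻¹) ^ 2 * (confFactor d ℓ q ^ 2 * F q))
    + 2 * ((v 0 * (q 0)⁻¹) * (confFactor d ℓ q * frameVec d ℓ v q (Fin.last (n + 1)) *
      ((1 / 2) * (confFactor d ℓ q * antiQuad q))))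
    - 2 * (confFactor d ℓ q * frameVec d ℓ v q (Fin.last (n + 1)) *
      (confFactor d ℓ q * antiPair q (frameVec d ℓ v q)))
    - 2 * ((v 0 * (q 0)⁻¹) ^ 2 * (confFactor d ℓ q * q (Fin.last (n + 1)) *
      ((1 / 2) * (confFactor d ℓ q * antiQuad q))))
    + 2 * ((v 0 * (q 0)⁻¹) * (confFactor d ℓ q * q (Fin.last (n + 1)) *
      (confFactor d ℓ q * antiPair q (frameVec d ℓ v q))))

theorem conjPotential_eq (q : Pt 𝕜 (n + 2)) :
    conjPotential d ℓ F q = confFactor d ℓ q ^ 2 * F q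
      - confFactor d ℓ q * q (Fin.last (n + 1)) *
        ((1 / 2) * (confFactor d ℓ q * antiQuad q)) := by
  have : powBranch ℓ (-4 / d 0) (q 0) = confFactor d ℓ q ^ 2 := by
    rw [pow_two, confFactor, ← powBranch_add]; congr 1; ring
  rw [conjPotential, this]; ring

include h hℓ ht hΛ in
theorem hasDirDeriv_conjPotential (v : Pt 𝕜 (n + 2)) :
    HasDirDeriv (conjPotential d ℓ F) (conjPotentialOne d ℓ F v t) t (conjField d ℓ v t) := by
  have hd := h.isEulerWeight
  refine (((hasDirDeriv_jetZero h hℓ ht hΛ v).sub ((hasDirDeriv_confFactor_last h hℓ hΛ v).mul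
    (hasDirDeriv_confFactor_antiQuad hd hℓ hΛ v))).congr_of_eventuallyEq
      (Eventually.of_forall fun q => conjPotential_eq q)).congr_deriv ?_
  rw [conjPotentialOne]; ring

include h hℓ ht hΛ in
theorem hasDirDeriv_conjPotentialOne (v : Pt 𝕜 (n + 2)) :
    HasDirDeriv (conjPotentialOne d ℓ F v) (conjPotentialTwo d ℓ F v t) t
      (conjField d ℓ v t) := by
  have hd := h.isEulerWeight
  have ha := (hasDirDeriv_inv_conjField (ℓ := ℓ) hd (hℓ.ne_zero hΛ) v).const_mul (v 0)
  have hQ := hasDirDeriv_confFactor_antiQuad hd hℓ hΛ v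
  refine ((((hasDirDeriv_jetOne h hℓ ht hΛ v).sub ((ha.const_mul 2).mul
    (hasDirDeriv_jetZero h hℓ ht hΛ v))).sub
    ((hasDirDeriv_confFactor_frameVec_last h hℓ hΛ v).mul hQ)).sub
    ((hasDirDeriv_confFactor_last h hℓ hΛ v).mul
      ((hasDirDeriv_confFactor_antiPair h hℓ hΛ v).sub ((ha.const_mul 2).mul hQ)))).congr_deriv ?_
  rw [conjPotentialTwo]; ring

include h hℓ ht hΛ in
/-- Along straight lines in the conjugate coordinates, the third derivative of the conjugate
potential has no lower order terms: this is the analogue of Bol's lemma, by which the third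
derivative of a density of weight `-1` on the projective line is covariant under Möbius maps. -/
theorem hasDirDeriv_conjPotentialTwo (v : Pt 𝕜 (n + 2)) :
    HasDirDeriv (conjPotentialTwo d ℓ F v)
      (confFactor d ℓ t ^ 2 * cubicForm (thirdPd F t) (frameVec d ℓ v t) (frameVec d ℓ v t)
        (frameVec d ℓ v t)) t (conjField d ℓ v t) := by
  have hd := h.isEulerWeight
  have ha := (hasDirDeriv_inv_conjField (ℓ := ℓ) hd (hℓ.ne_zero hΛ) v).const_mul (v 0)
  have hQ := hasDirDeriv_confFactor_antiQuad hd hℓ hΛ v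
  have hy := hasDirDeriv_confFactor_frameVec_last h hℓ hΛ v
  have hτ := hasDirDeriv_confFactor_last h hℓ hΛ v
  have hm := hasDirDeriv_confFactor_antiPair h hℓ hΛ v
  refine (((((((hasDirDeriv_jetTwo h hℓ ht hΛ v).sub ((ha.const_mul 2).mul
    (hasDirDeriv_jetOne h hℓ ht hΛ v))).add
    ((ha.sq.mul (hasDirDeriv_jetZero h hℓ ht hΛ v)).const_mul 2)).add
    ((ha.mul (hy.mul hQ)).const_mul 2)).sub ((hy.mul hm).const_mul 2)).sub
    ((ha.sq.mul (hτ.mul hQ)).const_mul 2)).add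
    ((ha.mul (hτ.mul hm)).const_mul 2)).congr_deriv ?_
  ring

end ConjPotential

/-! ### The conjugate potential in the conjugate coordinates -/

section ConjPotentialCoordinates

variable {𝕜 : Type*} [RCLike 𝕜] {n : ℕ}

/-- The part of `M` over the domain `Λ` of a branch of the powers of `t¹`. -/
def conjDomain (M : Set (Pt 𝕜 (n + 2))) (Λ : Set 𝕜) : Set (Pt 𝕜 (n + 2)) :=
  {t | t ∈ M ∧ t 0 ∈ Λ}

variable {M : Set (Pt 𝕜 (n + 2))} {S : FrobeniusData 𝕜 (n + 2)} {F : Pt 𝕜 (n + 2) → 𝕜}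
  {d : Fin (n + 2) → 𝕜} {Λ : Set 𝕜} {ℓ : 𝕜 → 𝕜} {t : Pt 𝕜 (n + 2)}

theorem isOpen_conjDomain (hM : IsOpen M) (hℓ : IsLogSqBranch Λ ℓ) : IsOpen (conjDomain M Λ) :=
  hM.inter (isOpen_preimage_zero hℓ)

theorem isCoordinateSystem_conjDomain (hd : IsEulerWeight d) (hℓ : IsLogSqBranch Λ ℓ) :
    IsCoordinateSystem (conjDomain M Λ) (conjCoord d ℓ) :=
  (isCoordinateSystem_conjCoord hd hℓ).mono fun _ hq => hq.2

theorem frameVec_eq_sum (hd : IsEulerWeight d) (hℓ : IsLogSqBranch Λ ℓ) (hΛ : t 0 ∈ Λ)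
    (v : Pt 𝕜 (n + 2)) :
    frameVec d ℓ v t = ∑ i, v i • frameVec d ℓ (Pi.single i 1) t := by
  have h0 := hℓ.ne_zero hΛ
  rw [← eulerReflection_conjField hd h0, conjField_eq_sum hd hℓ hΛ, eulerReflection_sum]
  refine Finset.sum_congr rfl fun i _ => ?_
  rw [eulerReflection_smul, coordField_conjCoord hd hℓ hΛ, eulerReflection_conjField hd h0]

theorem frameVec_add (hd : IsEulerWeight d) (hℓ : IsLogSqBranch Λ ℓ) (hΛ : t 0 ∈ Λ)
    (v w : Pt 𝕜 (n + 2)) :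
    frameVec d ℓ (v + w) t = frameVec d ℓ v t + frameVec d ℓ w t := by
  rw [frameVec_eq_sum hd hℓ hΛ, frameVec_eq_sum hd hℓ hΛ v, frameVec_eq_sum hd hℓ hΛ w,
    ← Finset.sum_add_distrib]
  exact Finset.sum_congr rfl fun i _ => by rw [Pi.add_apply, add_smul]

theorem antiPair_frameVec_frameVec (hd : IsEulerWeight d) (hℓ : IsLogSqBranch Λ ℓ)
    (hΛ : t 0 ∈ Λ) (v w : Pt 𝕜 (n + 2)) :
    confFactor d ℓ t * antiPair (frameVec d ℓ v t) (frameVec d ℓ w t) = antiPair v w := by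
  have h1 := antiPair_frameVec hd hℓ hΛ (v + w)
  rw [frameVec_add hd hℓ hΛ] at h1
  simp only [antiQuad_eq_antiPair, antiPair_add_left, antiPair_add_right] at h1
  have h2 := antiPair_frameVec hd hℓ hΛ v
  have h3 := antiPair_frameVec hd hℓ hΛ w
  rw [antiQuad_eq_antiPair] at h2 h3
  rw [antiPair_comm (frameVec d ℓ w t), antiPair_comm w] at h1
  linear_combination (1 / 2) * (h1 - h2 - h3)

theorem contDiffOn_conjPotential (h : StandardForm M S F d) (hℓ : IsLogSqBranch Λ ℓ) :
    ContDiffOn 𝕜 ∞ (conjPotential d ℓ F) (conjDomain M Λ) :=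
  ((contDiffOn_powBranch_zero hℓ _).mono fun _ hq => hq.2).mul
    ((h.smooth.mono fun _ hq => hq.1).sub
      ((contDiffOn_const.mul (contDiffOn_coord _ _)).mul (contDiffOn_antiQuad _)))

/-- The cubic form of the third derivatives in a coordinate system is the third derivative along
the constant combinations of the coordinate fields. -/
theorem cubicForm_coordDeriv {r : ℕ} {W : Set (Pt 𝕜 r)} {x : Pt 𝕜 r → Pt 𝕜 r}
    (hx : IsCoordinateSystem W x) (hW : IsOpen W) {f f₁ f₂ f₃ : Pt 𝕜 r → 𝕜}
    (hf : ContDiffOn 𝕜 ∞ f W) (v : Pt 𝕜 r) {V : Pt 𝕜 r → Pt 𝕜 r}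
    (hV : ∀ p ∈ W, V p = ∑ i, v i • coordField x i p)
    (h₁ : ∀ p ∈ W, fderiv 𝕜 f p (V p) = f₁ p) (h₂ : ∀ p ∈ W, fderiv 𝕜 f₁ p (V p) = f₂ p)
    (h₃ : ∀ p ∈ W, fderiv 𝕜 f₂ p (V p) = f₃ p) {p : Pt 𝕜 r} (hp : p ∈ W) :
    cubicForm (fun i j k => coordDeriv x i (coordDeriv x j (coordDeriv x k f)) p) v v v
      = f₃ p := by
  have hD : ∀ (g : Pt 𝕜 r → 𝕜), ∀ p ∈ W, fderiv 𝕜 g p (V p) = ∑ i, v i * coordDeriv x i g p :=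
    fun g p hp => by rw [hV p hp, map_sum]; simp [coordDeriv]
  -- the derivative of a constant combination of smooth functions
  have hL : ∀ (g : Fin r → Pt 𝕜 r → 𝕜), (∀ j, ContDiffOn 𝕜 ∞ (g j) W) → ∀ i, ∀ p ∈ W,
      coordDeriv x i (fun q => ∑ j, v j * g j q) p = ∑ j, v j * coordDeriv x i (g j) p :=
    fun g hg i p hp => (HasDirDeriv.sum fun j _ => HasDirDeriv.const_mul (v j)
      (⟨(hg j).differentiableAt_of_isOpen hW hp, rfl⟩ :
        HasDirDeriv (g j) (coordDeriv x i (g j) p) p (coordField x i p))).2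
  have s1 : ∀ k, ContDiffOn 𝕜 ∞ (coordDeriv x k f) W := fun k => contDiffOn_coordDeriv hx hW k hf
  have s2 : ∀ j k, ContDiffOn 𝕜 ∞ (coordDeriv x j (coordDeriv x k f)) W := fun j k =>
    contDiffOn_coordDeriv hx hW j (s1 k)
  have e1 : EqOn f₁ (fun q => ∑ k, v k * coordDeriv x k f q) W := fun q hq => by
    rw [← h₁ q hq, hD f q hq]
  have e2 : EqOn f₂ (fun q => ∑ j, v j * ∑ k, v k * coordDeriv x j (coordDeriv x k f) q) W :=
    fun q hq => by
      rw [← h₂ q hq, hD f₁ q hq]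
      exact Finset.sum_congr rfl fun j _ => by
        rw [coordDeriv_congr hW e1 j hq, hL _ s1 j q hq]
  rw [← h₃ p hp, hD f₂ p hp, cubicForm]
  refine Finset.sum_congr rfl fun i _ => ?_
  rw [coordDeriv_congr hW e2 i hp, hL _ (fun j => ContDiffOn.sum fun k _ =>
    contDiffOn_const.mul (s2 j k)) i p hp, Finset.mul_sum]
  refine Finset.sum_congr rfl fun j _ => ?_
  rw [hL _ (s2 j) i p hp, Finset.mul_sum, Finset.mul_sum]
  exact Finset.sum_congr rfl fun k _ => by ring

theorem thirdPd_comm_left (h : StandardForm M S F d) (ht : t ∈ M) (i j k : Fin (n + 2)) :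
    thirdPd F t i j k = thirdPd F t j i k := pd_comm h.isOpen (h.smooth_pd k) ht i j

theorem thirdPd_comm_right (h : StandardForm M S F d) (ht : t ∈ M) (i j k : Fin (n + 2)) :
    thirdPd F t i j k = thirdPd F t i k j :=
  pd_congr h.isOpen (fun _ hq => pd_comm h.isOpen h.smooth hq j k) i ht

/-- The third derivatives of the conjugate potential in the conjugate coordinates are `ρ²` times
those of `F` in the reflected frame. -/
theorem coordDeriv_conjPotential (h : StandardForm M S F d) (hℓ : IsLogSqBranch Λ ℓ)
    (ht : t ∈ conjDomain M Λ) (i j k : Fin (n + 2)) :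
    coordDeriv (conjCoord d ℓ) i (coordDeriv (conjCoord d ℓ) j
        (coordDeriv (conjCoord d ℓ) k (conjPotential d ℓ F))) t
      = confFactor d ℓ t ^ 2 * cubicForm (thirdPd F t) (frameVec d ℓ (Pi.single i 1) t)
          (frameVec d ℓ (Pi.single j 1) t) (frameVec d ℓ (Pi.single k 1) t) := by
  have hd := h.isEulerWeight
  have hx := isCoordinateSystem_conjDomain (M := M) hd hℓ
  have hW := isOpen_conjDomain h.isOpen hℓ
  have hf := contDiffOn_conjPotential h hℓ
  rw [← sub_eq_zero]
  refine eq_zero_of_cubic_form_eq_zero (T := fun i j k =>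
    coordDeriv (conjCoord d ℓ) i (coordDeriv (conjCoord d ℓ) j
        (coordDeriv (conjCoord d ℓ) k (conjPotential d ℓ F))) t
      - confFactor d ℓ t ^ 2 * cubicForm (thirdPd F t) (frameVec d ℓ (Pi.single i 1) t)
          (frameVec d ℓ (Pi.single j 1) t) (frameVec d ℓ (Pi.single k 1) t)) ?_ ?_ ?_ i j k
  · intro i j k
    rw [coordDeriv_comm hx hW (contDiffOn_coordDeriv hx hW k hf) ht,
      cubicForm_comm_left (thirdPd_comm_left h ht.1)]
  · intro i j k
    rw [coordDeriv_congr hW (fun q hq => coordDeriv_comm hx hW hf hq j k) i ht,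
      cubicForm_comm_right (thirdPd_comm_right h ht.1)]
  · intro v
    have e1 := cubicForm_coordDeriv hx hW hf v (V := conjField d ℓ v)
      (fun p hp => conjField_eq_sum hd hℓ hp.2 v)
      (fun p hp => (hasDirDeriv_conjPotential h hℓ hp.1 hp.2 v).2)
      (fun p hp => (hasDirDeriv_conjPotentialOne h hℓ hp.1 hp.2 v).2)
      (f₃ := fun p => confFactor d ℓ p ^ 2 * cubicForm (thirdPd F p) (frameVec d ℓ v p)
        (frameVec d ℓ v p) (frameVec d ℓ v p))
      (fun p hp => (hasDirDeriv_conjPotentialTwo h hℓ hp.1 hp.2 v).2) ht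
    have e2 := cubicForm_sum (thirdPd F t) (fun i => frameVec d ℓ (Pi.single i 1) t) v v v
    rw [← frameVec_eq_sum hd hℓ ht.2] at e2
    have e3 : cubicForm (fun i j k => confFactor d ℓ t ^ 2 * cubicForm (thirdPd F t)
        (frameVec d ℓ (Pi.single i 1) t) (frameVec d ℓ (Pi.single j 1) t)
        (frameVec d ℓ (Pi.single k 1) t)) v v v
        = confFactor d ℓ t ^ 2 * cubicForm (thirdPd F t) (frameVec d ℓ v t)
          (frameVec d ℓ v t) (frameVec d ℓ v t) := by
      rw [e2]
      simp only [cubicForm, Finset.mul_sum]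
      exact Finset.sum_congr rfl fun i _ => Finset.sum_congr rfl fun j _ =>
        Finset.sum_congr rfl fun k _ => Finset.sum_congr rfl fun a _ =>
        Finset.sum_congr rfl fun b _ => Finset.sum_congr rfl fun c _ => by ring
    exact (cubicForm_sub _ _ v v v).trans (by rw [e1, e3, sub_self])

end ConjPotentialCoordinates

/-! ### Quasihomogeneous functions -/

section Degree

variable {𝕜 : Type*} [RCLike 𝕜] {r : ℕ} {d : Fin r → 𝕜}

/-- `f` is quasihomogeneous of degree `c` at `p`, infinitesimally: `E f = c f` for the Euler field
`E = ∑ dᵢ tⁱ ∂ᵢ`. -/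
def HasDegree (d : Fin r → 𝕜) (f : Pt 𝕜 r → 𝕜) (c : 𝕜) (p : Pt 𝕜 r) : Prop :=
  HasDirDeriv f (c * f p) p (diagField d p)

namespace HasDegree

variable {f g : Pt 𝕜 r → 𝕜} {c c' : 𝕜} {p : Pt 𝕜 r}

theorem congr_degree (h : HasDegree d f c p) (hc : c = c') : HasDegree d f c' p := hc ▸ h

theorem congr_of_eventuallyEq (h : HasDegree d f c p) (hg : g =ᶠ[𝓝 p] f) : HasDegree d g c p :=
  (HasDirDeriv.congr_of_eventuallyEq h hg).congr_deriv (by rw [hg.self_of_nhds])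

theorem const (a : 𝕜) (p : Pt 𝕜 r) : HasDegree d (fun _ => a) 0 p :=
  (HasDirDeriv.const a _ _).congr_deriv (by simp)

theorem coord (i : Fin r) (p : Pt 𝕜 r) : HasDegree d (fun q => q i) (d i) p :=
  HasDirDeriv.coord i _ _

theorem mul (hf : HasDegree d f c p) (hg : HasDegree d g c' p) :
    HasDegree d (fun q => f q * g q) (c + c') p :=
  (HasDirDeriv.mul hf hg).congr_deriv (by ring)

theorem const_mul (a : 𝕜) (hf : HasDegree d f c p) : HasDegree d (fun q => a * f q) c p :=
  ((const a p).mul hf).congr_degree (by simp)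

theorem sub (hf : HasDegree d f c p) (hg : HasDegree d g c p) :
    HasDegree d (fun q => f q - g q) c p :=
  (HasDirDeriv.sub hf hg).congr_deriv (by ring)

theorem neg (hf : HasDegree d f c p) : HasDegree d (fun q => -f q) c p :=
  (HasDirDeriv.neg hf).congr_deriv (by ring)

theorem sum {ι : Type*} {s : Finset ι} {f : ι → Pt 𝕜 r → 𝕜}
    (h : ∀ i ∈ s, HasDegree d (f i) c p) : HasDegree d (fun q => ∑ i ∈ s, f i q) c p :=
  (HasDirDeriv.sum h).congr_deriv (by rw [Finset.mul_sum])

theorem inv (hf : HasDegree d f c p) (h0 : f p ≠ 0) : HasDegree d (fun q => (f q)⁻¹) (-c) p :=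
  (HasDirDeriv.inv hf h0).congr_deriv (by field_simp)

end HasDegree

end Degree

section DegreeConj

variable {𝕜 : Type*} [RCLike 𝕜] {n : ℕ} {M : Set (Pt 𝕜 (n + 2))} {S : FrobeniusData 𝕜 (n + 2)}
  {F : Pt 𝕜 (n + 2) → 𝕜} {d : Fin (n + 2) → 𝕜} {Λ : Set 𝕜} {ℓ : 𝕜 → 𝕜} {t : Pt 𝕜 (n + 2)}

theorem hasDegree_powBranch (hℓ : IsLogSqBranch Λ ℓ) (hΛ : t 0 ∈ Λ) (a : 𝕜) :
    HasDegree d (fun q => powBranch ℓ a (q 0)) (a * d 0) t := by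
  have h0 := hℓ.ne_zero hΛ
  refine (HasDirDeriv.scomp (hℓ.hasDerivAt_powBranch a hΛ)
    (HasDegree.coord (d := d) 0 t)).congr_deriv ?_
  field_simp

theorem hasDegree_confFactor (hd : IsEulerWeight d) (hℓ : IsLogSqBranch Λ ℓ) (hΛ : t 0 ∈ Λ) :
    HasDegree d (confFactor d ℓ) (-2) t :=
  (hasDegree_powBranch hℓ hΛ _).congr_degree (div_mul_cancel₀ _ hd.ne_zero)

theorem hasDegree_antiQuad (hd : IsEulerWeight d) : HasDegree d antiQuad (1 + d 0) t :=
  HasDegree.sum fun i _ => ((HasDegree.coord i t).mul (HasDegree.coord _ t)).congr_degree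
    (hd.add_rev i)

theorem StandardForm.hasDegree (h : StandardForm M S F d) (ht : t ∈ M) :
    HasDegree d F (2 + d 0) t :=
  ⟨h.smooth.differentiableAt_of_isOpen h.isOpen ht, h.homogeneous' ht⟩

theorem hasDegree_conjPotential (h : StandardForm M S F d) (hℓ : IsLogSqBranch Λ ℓ)
    (ht : t ∈ conjDomain M Λ) : HasDegree d (conjPotential d ℓ F) (d 0 - 2) t := by
  have hd := h.isEulerWeight
  refine ((hasDegree_powBranch hℓ ht.2 (-4 / d 0)).mul ((h.hasDegree ht.1).sub
    ((((HasDegree.coord (Fin.last (n + 1)) t).const_mul (1 / 2)).mul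
      (hasDegree_antiQuad hd)).congr_degree ?_))).congr_degree ?_
  · rw [hd.last]; ring
  · rw [div_mul_cancel₀ _ hd.ne_zero]; ring

/-- The degrees of the conjugate coordinates. -/
def conjDegree (d : Fin (n + 2) → 𝕜) (i : Fin (n + 2)) : 𝕜 :=
  if i = 0 then d 0 else if i = Fin.last (n + 1) then -1 else d 0 - d i

theorem hasDegree_conjCoord (hd : IsEulerWeight d) (hℓ : IsLogSqBranch Λ ℓ) (hΛ : t 0 ∈ Λ)
    (i : Fin (n + 2)) :
    HasDegree d (fun q => conjCoord d ℓ q i) (conjDegree d i) t := by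
  have h0 := hℓ.ne_zero hΛ
  have hd0 := hd.ne_zero
  by_cases hi : i = 0
  · subst hi
    simp only [conjCoord, conjDegree, if_true]
    exact (HasDegree.coord 0 t).neg
  by_cases hl : i = Fin.last (n + 1)
  · subst hl
    simp only [conjCoord, conjDegree, if_neg hi, if_true]
    refine (((hasDegree_antiQuad hd).const_mul (1 / 2)).mul ((hasDegree_powBranch hℓ hΛ _).mul
      ((HasDegree.coord 0 t).inv h0))).congr_degree ?_
    field_simp; ring
  · simp only [conjCoord, conjDegree, if_neg hi, if_neg hl]
    refine ((HasDegree.coord i t).mul ((HasDegree.coord 0 t).mul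
      (hasDegree_powBranch hℓ hΛ _))).congr_degree ?_
    field_simp; ring

theorem fderiv_conjCoord_diagField (hd : IsEulerWeight d) (hℓ : IsLogSqBranch Λ ℓ)
    (hΛ : t 0 ∈ Λ) (i : Fin (n + 2)) :
    fderiv 𝕜 (conjCoord d ℓ) t (diagField d t) i = conjDegree d i * conjCoord d ℓ t i := by
  rw [← fderiv_coord_apply ((isCoordinateSystem_conjCoord hd hℓ).differentiableAt
    (isOpen_preimage_zero hℓ) hΛ)]
  exact (hasDegree_conjCoord hd hℓ hΛ i).2

theorem hasDegree_eulerReflection (hd : IsEulerWeight d) (h0 : t 0 ≠ 0) {V : Pt 𝕜 (n + 2) →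
    Pt 𝕜 (n + 2)} {c : 𝕜} (hV : ∀ k, HasDegree d (fun q => V q k) (c + d k) t)
    (k : Fin (n + 2)) : HasDegree d (fun q => eulerReflection d q (V q) k) (c + d k) t := by
  have hd0 := hd.ne_zero
  refine HasDegree.congr_of_eventuallyEq ((hV k).sub (((((hV 0).const_mul 2).mul
    ((HasDegree.coord 0 t).inv h0)).mul ((HasDegree.coord k t).const_mul
      (d k * (d 0)⁻¹))).congr_degree (c' := c + d k) (by ring))) (Eventually.of_forall fun q => ?_)
  simp only [eulerReflection, Pi.sub_apply, Pi.smul_apply, smul_eq_mul, diagField, div_eq_mul_inv,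
    mul_inv]
  ring

theorem hasDegree_eulerReflection_single (hd : IsEulerWeight d) (h0 : t 0 ≠ 0)
    (i k : Fin (n + 2)) :
    HasDegree d (fun q => eulerReflection d q (Pi.single i 1) k) (-d i + d k) t := by
  refine hasDegree_eulerReflection hd h0 (V := fun _ => Pi.single i 1) (fun k => ?_) k
  by_cases hk : k = i
  · subst hk
    exact (HasDegree.const _ t).congr_degree (by ring)
  · refine (HasDirDeriv.const _ _ _).congr_deriv ?_
    simp [hk]

theorem StandardForm.hasDegree_c (h : StandardForm M S F d) (ht : t ∈ M) (i j k : Fin (n + 2)) :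
    HasDegree d (fun q => S.c q i j k) (1 + d k - d i - d j) t := by
  refine HasDegree.congr_of_eventuallyEq (f := pd i (pd j (pd (Fin.rev k) F)))
    (HasDegree.congr_degree (c := 2 + d 0 - d (Fin.rev k) - d j - d i)
      ⟨(contDiffOn_pd h.isOpen i (h.smooth_pd_pd _ _)).differentiableAt_of_isOpen h.isOpen ht,
        pd_homogeneous h.isOpen (h.smooth_pd_pd _ _)
        (fun _ hp => h.homogeneous_pd_pd hp j (Fin.rev k)) i ht⟩ ?_) ?_
  · linear_combination -h.deg_add' k
  · filter_upwards [h.isOpen.mem_nhds ht] with q hq using h.c_eq q hq i j k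

end DegreeConj

/-! ### Multiplication and pairing as bilinear maps -/

section Bilinear

variable {𝕜 : Type*} [RCLike 𝕜] {r : ℕ}

theorem FrobeniusData.mul_smul_left (S : FrobeniusData 𝕜 r) (p : Pt 𝕜 r) (a : 𝕜) (v w : Pt 𝕜 r) :
    S.mul p (a • v) w = a • S.mul p v w := by
  ext k
  simp only [FrobeniusData.mul, Pi.smul_apply, smul_eq_mul, Finset.mul_sum]
  exact Finset.sum_congr rfl fun i _ => Finset.sum_congr rfl fun j _ => by ring

theorem FrobeniusData.mul_smul_right (S : FrobeniusData 𝕜 r) (p : Pt 𝕜 r) (a : 𝕜) (v w : Pt 𝕜 r) :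
    S.mul p v (a • w) = a • S.mul p v w := by
  ext k
  simp only [FrobeniusData.mul, Pi.smul_apply, smul_eq_mul, Finset.mul_sum]
  exact Finset.sum_congr rfl fun i _ => Finset.sum_congr rfl fun j _ => by ring

theorem FrobeniusData.mul_add_left (S : FrobeniusData 𝕜 r) (p u v w : Pt 𝕜 r) :
    S.mul p (u + v) w = S.mul p u w + S.mul p v w := by
  ext k
  simp only [FrobeniusData.mul, Pi.add_apply, mul_add, add_mul, Finset.sum_add_distrib]

theorem FrobeniusData.mul_add_right (S : FrobeniusData 𝕜 r) (p u v w : Pt 𝕜 r) :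
    S.mul p u (v + w) = S.mul p u v + S.mul p u w := by
  ext k
  simp only [FrobeniusData.mul, Pi.add_apply, mul_add, Finset.sum_add_distrib]

/-- A bilinear form, evaluated on a change of frame. -/
theorem sum_sum_mul_change_frame (C : Fin r → Fin r → 𝕜) (Y : Fin r → Pt 𝕜 r) (v w : Pt 𝕜 r) :
    ∑ i, ∑ j, C i j * (∑ a, v a • Y a) i * (∑ b, w b • Y b) j
      = ∑ a, ∑ b, (∑ i, ∑ j, C i j * Y a i * Y b j) * v a * w b := by
  have h : ∀ i j, C i j * (∑ a, v a • Y a) i * (∑ b, w b • Y b) j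
      = ∑ a, ∑ b, C i j * Y a i * Y b j * v a * w b := fun i j => by
    simp only [Finset.sum_apply, Pi.smul_apply, smul_eq_mul, Finset.mul_sum, Finset.sum_mul]
    rw [Finset.sum_comm]
    exact Finset.sum_congr rfl fun a _ => Finset.sum_congr rfl fun b _ => by ring
  simp only [h, Finset.sum_mul]
  calc _ = ∑ i, ∑ a, ∑ j, ∑ b, C i j * Y a i * Y b j * v a * w b :=
        Finset.sum_congr rfl fun i _ => Finset.sum_comm
    _ = ∑ a, ∑ i, ∑ j, ∑ b, C i j * Y a i * Y b j * v a * w b := Finset.sum_comm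
    _ = ∑ a, ∑ i, ∑ b, ∑ j, C i j * Y a i * Y b j * v a * w b :=
        Finset.sum_congr rfl fun a _ => Finset.sum_congr rfl fun i _ => Finset.sum_comm
    _ = _ := Finset.sum_congr rfl fun a _ => Finset.sum_comm

end Bilinear

/-! ### The conjugate structure -/

section ConjData

variable {𝕜 : Type*} [RCLike 𝕜] {n : ℕ}

/-- The conjugate structure: with `ρ = confFactor` and the reflection `A = eulerReflection`, its
metric is `ρ Π(A v, A w)`, its multiplication is `ρ A (A v ∘ A w)`, its identity is `ρ⁻¹ e` and its
Euler field is `-E`. It is the pullback of Dubrovin's inversion under the time `-ℓ(t¹)/d₁` map of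
the Euler flow, whose differential is `A` followed by that of the flow at the fixed time. -/
def conjData (S : FrobeniusData 𝕜 (n + 2)) (d : Fin (n + 2) → 𝕜) (ℓ : 𝕜 → 𝕜) :
    FrobeniusData 𝕜 (n + 2) where
  metric p := Matrix.of fun i j => confFactor d ℓ p *
    antiPair (eulerReflection d p (Pi.single i 1)) (eulerReflection d p (Pi.single j 1))
  c p i j k := confFactor d ℓ p * eulerReflection d p
    (S.mul p (eulerReflection d p (Pi.single i 1)) (eulerReflection d p (Pi.single j 1))) k
  unit p := (confFactor d ℓ p)⁻¹ • Pi.single (Fin.last (n + 1)) 1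
  euler p := -diagField d p
  charge := 2 - S.charge

variable {M : Set (Pt 𝕜 (n + 2))} {S : FrobeniusData 𝕜 (n + 2)} {F : Pt 𝕜 (n + 2) → 𝕜}
  {d : Fin (n + 2) → 𝕜} {Λ : Set 𝕜} {ℓ : 𝕜 → 𝕜} {t : Pt 𝕜 (n + 2)}

theorem eulerReflection_eq_sum (v : Pt 𝕜 (n + 2)) :
    eulerReflection d t v = ∑ i, v i • eulerReflection d t (Pi.single i 1) := by
  conv_lhs => rw [show v = ∑ i, v i • (Pi.single i 1 : Pt 𝕜 (n + 2)) from pi_eq_sum_univ' v]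
  rw [eulerReflection_sum]
  exact Finset.sum_congr rfl fun i _ => eulerReflection_smul _ _

theorem antiPair_eq_sum (v w : Pt 𝕜 (n + 2)) :
    antiPair v w = ∑ i, ∑ j, (if j = Fin.rev i then 1 else 0) * v i * w j := by
  simp [antiPair]

theorem pair_conjData (v w : Pt 𝕜 (n + 2)) :
    (conjData S d ℓ).pair t v w
      = confFactor d ℓ t * antiPair (eulerReflection d t v) (eulerReflection d t w) := by
  rw [eulerReflection_eq_sum v, eulerReflection_eq_sum w, antiPair_eq_sum,
    sum_sum_mul_change_frame]
  simp only [FrobeniusData.pair, conjData, Matrix.of_apply, Finset.mul_sum, antiPair_eq_sum]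
  refine Finset.sum_congr rfl fun i _ => Finset.sum_congr rfl fun j _ => ?_
  simp only [← Finset.mul_sum]
  ring

theorem mul_conjData (v w : Pt 𝕜 (n + 2)) :
    (conjData S d ℓ).mul t v w = confFactor d ℓ t • eulerReflection d t
      (S.mul t (eulerReflection d t v) (eulerReflection d t w)) := by
  have h : S.mul t (eulerReflection d t v) (eulerReflection d t w)
      = ∑ i, ∑ j, (v i * w j) • S.mul t (eulerReflection d t (Pi.single i 1))
        (eulerReflection d t (Pi.single j 1)) := by
    rw [eulerReflection_eq_sum v, eulerReflection_eq_sum w]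
    ext k
    have := sum_sum_mul_change_frame (fun a b => S.c t a b k)
      (fun i => eulerReflection d t (Pi.single i 1)) v w
    rw [FrobeniusData.mul, this]
    simp only [Finset.sum_apply, Pi.smul_apply, smul_eq_mul, FrobeniusData.mul]
    exact Finset.sum_congr rfl fun i _ => Finset.sum_congr rfl fun j _ => by ring
  rw [h]
  simp only [eulerReflection_sum, eulerReflection_smul]
  ext k
  simp only [FrobeniusData.mul, conjData, Pi.smul_apply, Finset.sum_apply, smul_eq_mul,
    Finset.mul_sum]
  exact Finset.sum_congr rfl fun i _ => Finset.sum_congr rfl fun j _ => by ring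

theorem StandardForm.pair_eq (h : StandardForm M S F d) (ht : t ∈ M) (v w : Pt 𝕜 (n + 2)) :
    S.pair t v w = antiPair v w := by
  rw [antiPair_eq_sum, FrobeniusData.pair]
  simp only [h.metric_eq t ht]

theorem StandardForm.antiPair_mul (h : StandardForm M S F d) (ht : t ∈ M)
    (u v w : Pt 𝕜 (n + 2)) : antiPair (S.mul t u v) w = cubicForm (thirdPd F t) u v w := by
  rw [← h.pair_eq ht, pair_mul_eq_cubicForm]
  congr 1
  funext i j k
  simp [h.metric_eq t ht, h.c_eq t ht, ← Fin.rev_eq_iff, thirdPd]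

theorem contDiffOn_confFactor (hℓ : IsLogSqBranch Λ ℓ) :
    ContDiffOn 𝕜 ∞ (confFactor d ℓ) (conjDomain M Λ) :=
  (contDiffOn_powBranch_zero hℓ _).mono fun _ hq => hq.2

theorem contDiffOn_diagField (s : Set (Pt 𝕜 (n + 2))) (k : Fin (n + 2)) :
    ContDiffOn 𝕜 ∞ (fun q => diagField d q k) s :=
  contDiffOn_const.mul (contDiffOn_coord k s)

theorem contDiffOn_eulerReflection (hd : IsEulerWeight d) (hℓ : IsLogSqBranch Λ ℓ)
    {V : Pt 𝕜 (n + 2) → Pt 𝕜 (n + 2)}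
    (hV : ∀ k, ContDiffOn 𝕜 ∞ (fun q => V q k) (conjDomain M Λ)) (k : Fin (n + 2)) :
    ContDiffOn 𝕜 ∞ (fun q => eulerReflection d q (V q) k) (conjDomain M Λ) := by
  refine (hV k).sub (ContDiffOn.mul ?_ (contDiffOn_diagField _ k))
  refine (contDiffOn_const.mul (hV 0)).div (contDiffOn_const.mul (contDiffOn_coord 0 _)) ?_
  exact fun q hq => mul_ne_zero hd.ne_zero (hℓ.ne_zero hq.2)

theorem contDiffOn_eulerReflection_single (hd : IsEulerWeight d) (hℓ : IsLogSqBranch Λ ℓ)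
    (i k : Fin (n + 2)) :
    ContDiffOn 𝕜 ∞ (fun q => eulerReflection d q (Pi.single i 1) k) (conjDomain M Λ) :=
  contDiffOn_eulerReflection hd hℓ (V := fun _ => Pi.single i 1) (fun _ => contDiffOn_const) k

theorem pair_mul_conjData (h : StandardForm M S F d) (hℓ : IsLogSqBranch Λ ℓ)
    (ht : t ∈ conjDomain M Λ) (u v w : Pt 𝕜 (n + 2)) :
    (conjData S d ℓ).pair t ((conjData S d ℓ).mul t u v) w
      = confFactor d ℓ t ^ 2 * cubicForm (thirdPd F t) (eulerReflection d t u)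
        (eulerReflection d t v) (eulerReflection d t w) := by
  rw [pair_conjData, mul_conjData, eulerReflection_smul,
    eulerReflection_eulerReflection h.isEulerWeight (hℓ.ne_zero ht.2), antiPair_smul_left,
    h.antiPair_mul ht.1]
  ring

theorem pair_coordField_conjData (hd : IsEulerWeight d) (hℓ : IsLogSqBranch Λ ℓ) (hΛ : t 0 ∈ Λ)
    (i j : Fin (n + 2)) :
    (conjData S d ℓ).pair t (coordField (conjCoord d ℓ) i t) (coordField (conjCoord d ℓ) j t)
      = if j = Fin.rev i then 1 else 0 := by
  have h0 := hℓ.ne_zero hΛ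
  rw [pair_conjData, coordField_conjCoord hd hℓ hΛ, coordField_conjCoord hd hℓ hΛ,
    eulerReflection_conjField hd h0, eulerReflection_conjField hd h0,
    antiPair_frameVec_frameVec hd hℓ hΛ, antiPair_single_left, one_mul, Pi.single_apply]
  simp only [eq_comm]

theorem isFlatCoordinates_conjData (h : StandardForm M S F d) (hℓ : IsLogSqBranch Λ ℓ) :
    IsFlatCoordinates (conjDomain M Λ) (conjData S d ℓ) (conjCoord d ℓ) := by
  have hd := h.isEulerWeight
  refine ⟨isCoordinateSystem_conjDomain hd hℓ,
    ⟨Matrix.of fun i j => if j = Fin.rev i then 1 else 0, fun t ht i j =>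
      pair_coordField_conjData hd hℓ ht.2 i j⟩, fun t ht => ?_⟩
  have hm : frameMid d ℓ (Pi.single (Fin.last (n + 1)) 1) t = 0 := by
    ext i
    by_cases hi : i = 0 ∨ i = Fin.last (n + 1)
    · simp [frameMid, hi]
    · have : i ≠ Fin.last (n + 1) := fun h => hi (Or.inr h)
      simp [frameMid, this]
  rw [coordField_conjCoord hd hℓ ht.2, conjField,
    eulerReflection_of_zero (by rw [frameVec_zero (hℓ.ne_zero ht.2)]; simp)]
  simp [conjData, frameVec, frameLast, hm, antiPair]

theorem isPotential_conjData (h : StandardForm M S F d) (hℓ : IsLogSqBranch Λ ℓ) :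
    IsPotential (conjDomain M Λ) (conjData S d ℓ) (conjCoord d ℓ) (conjPotential d ℓ F) := by
  have hd := h.isEulerWeight
  refine ⟨contDiffOn_conjPotential h hℓ, fun t ht i j k => ?_, 0, 0, 0, fun t ht => ?_⟩
  · have h0 := hℓ.ne_zero ht.2
    rw [coordDeriv_conjPotential h hℓ ht, pair_mul_conjData h hℓ ht]
    simp only [coordField_conjCoord hd hℓ ht.2, eulerReflection_conjField hd h0]
  · have := (hasDegree_conjPotential h hℓ ht).2
    simp only [conjData, map_neg, this, h.charge_eq]
    simp
    ring

theorem unit_mul_conjData (h : StandardForm M S F d) (hℓ : IsLogSqBranch Λ ℓ)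
    (ht : t ∈ conjDomain M Λ) (v : Pt 𝕜 (n + 2)) :
    (conjData S d ℓ).mul t ((conjData S d ℓ).unit t) v = v := by
  have hd := h.isEulerWeight
  have h0 := hℓ.ne_zero ht.2
  have e : (conjData S d ℓ).unit t = (confFactor d ℓ t)⁻¹ • S.unit t := by
    rw [h.unit_eq t ht.1]; rfl
  have e' : eulerReflection d t (S.unit t) = S.unit t :=
    eulerReflection_of_zero (by rw [h.unit_eq t ht.1]; simp)
  rw [mul_conjData, e, eulerReflection_smul, e', S.mul_smul_left,
    h.frobenius.unit_mul t ht.1, eulerReflection_smul, eulerReflection_eulerReflection hd h0,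
    smul_smul, mul_inv_cancel₀ confFactor_ne_zero, one_smul]

theorem lie_unit_conjData (hd : IsEulerWeight d) (hℓ : IsLogSqBranch Λ ℓ) (hΛ : t 0 ∈ Λ) :
    VectorField.lieBracket 𝕜 (conjData S d ℓ).unit (conjData S d ℓ).euler t
      = (conjData S d ℓ).unit t := by
  have hρ := hasDegree_confFactor hd hℓ hΛ
  have hu : ∀ i, HasDirDeriv (fun q => (conjData S d ℓ).unit q i)
      (-(2 * (conjData S d ℓ).unit t i)) t ((conjData S d ℓ).euler t) := fun i => by
    have h1 := (hρ.inv confFactor_ne_zero).mul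
      (HasDegree.const ((Pi.single (Fin.last (n + 1)) 1 : Pt 𝕜 (n + 2)) i) t)
    refine ⟨h1.1, ?_⟩
    have h2 : (conjData S d ℓ).euler t = -diagField d t := rfl
    rw [h2, map_neg]
    refine (congrArg Neg.neg h1.2).trans ?_
    simp [conjData]
  have he : ∀ i, HasDirDeriv (fun q => (conjData S d ℓ).euler q i)
      (-(d i * (conjData S d ℓ).unit t i)) t ((conjData S d ℓ).unit t) := fun i =>
    ((HasDirDeriv.coord i t _).const_mul (d i)).neg
  ext i
  rw [VectorField.lieBracket, Pi.sub_apply,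
    ← fderiv_coord_apply (differentiableAt_pi.2 fun i => (hu i).1),
    ← fderiv_coord_apply (differentiableAt_pi.2 fun i => (he i).1), (hu i).2, (he i).2]
  by_cases hi : i = Fin.last (n + 1)
  · subst hi; rw [hd.last]; ring
  · simp [conjData, hi]

theorem pd_euler_conjData (i l : Fin (n + 2)) (p : Pt 𝕜 (n + 2)) :
    pd i (fun q => (conjData S d ℓ).euler q l) p = if l = i then -d l else 0 := by
  have := ((HasDirDeriv.coord l p (Pi.single i 1)).const_mul (d l)).neg.2
  rw [pd]
  refine this.trans ?_
  simp only [Pi.single_apply, mul_ite, mul_one, mul_zero]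
  split_ifs <;> simp

theorem hasDegree_metric_conjData (hd : IsEulerWeight d) (hℓ : IsLogSqBranch Λ ℓ) (hΛ : t 0 ∈ Λ)
    (i j : Fin (n + 2)) :
    HasDegree d (fun q => (conjData S d ℓ).metric q i j) (d 0 - 1 - d i - d j) t := by
  have h0 := hℓ.ne_zero hΛ
  refine ((hasDegree_confFactor hd hℓ hΛ).mul (HasDegree.sum (c := 1 + d 0 - d i - d j)
    fun k _ => ((hasDegree_eulerReflection_single hd h0 i k).mul
      (hasDegree_eulerReflection_single hd h0 j (Fin.rev k))).congr_degree ?_)).congr_degree ?_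
  · linear_combination hd.add_rev k
  · ring

theorem hasDegree_c_conjData (h : StandardForm M S F d) (hℓ : IsLogSqBranch Λ ℓ)
    (ht : t ∈ conjDomain M Λ) (i j k : Fin (n + 2)) :
    HasDegree d (fun q => (conjData S d ℓ).c q i j k) (d k - d i - d j - 1) t := by
  have hd := h.isEulerWeight
  have h0 := hℓ.ne_zero ht.2
  refine ((hasDegree_confFactor hd hℓ ht.2).mul (hasDegree_eulerReflection hd h0
    (c := 1 - d i - d j) (fun k => ?_) k)).congr_degree (by ring)
  refine HasDegree.sum fun a _ => HasDegree.sum fun b _ =>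
    (((h.hasDegree_c ht.1 a b k).mul (hasDegree_eulerReflection_single hd h0 i a)).mul
      (hasDegree_eulerReflection_single hd h0 j b)).congr_degree (by ring)

/-- The contravariant metric `Lie_{f(τ) e} Ω₂` in closed form. -/
def conjCometric (d : Fin (n + 2) → 𝕜) (ℓ : 𝕜 → 𝕜) (t : Pt 𝕜 (n + 2)) :
    Matrix (Fin (n + 2)) (Fin (n + 2)) 𝕜 :=
  Matrix.of fun i => (confFactor d ℓ t)⁻¹ • eulerReflection d t (Pi.single (Fin.rev i) 1
    - (2 / (d 0 * t 0) * diagField d t i) • Pi.single (Fin.last (n + 1)) 1)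

theorem pair_conjCometric (hd : IsEulerWeight d) (h0 : t 0 ≠ 0) (i : Fin (n + 2))
    (v : Pt 𝕜 (n + 2)) :
    (conjData S d ℓ).pair t (conjCometric d ℓ t i) v = v i := by
  have e : conjCometric d ℓ t i = (confFactor d ℓ t)⁻¹ • eulerReflection d t
      (Pi.single (Fin.rev i) 1 + (-(2 / (d 0 * t 0) * diagField d t i)) •
        Pi.single (Fin.last (n + 1)) 1) := by
    rw [neg_smul, ← sub_eq_add_neg]; rfl
  rw [pair_conjData, e, eulerReflection_smul, eulerReflection_eulerReflection hd h0,
    antiPair_smul_left, antiPair_add_left, antiPair_smul_left, antiPair_single_left,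
    antiPair_single_left, Fin.rev_rev, Fin.rev_last, eulerReflection_zero hd h0,
    eulerReflection, Pi.sub_apply, Pi.smul_apply, smul_eq_mul]
  have := confFactor_ne_zero (d := d) (ℓ := ℓ) (t := t)
  field_simp
  ring

theorem conjCometric_mul_metric (hd : IsEulerWeight d) (h0 : t 0 ≠ 0) :
    conjCometric d ℓ t * (conjData S d ℓ).metric t = 1 := by
  ext i j
  have := pair_conjCometric (S := S) (ℓ := ℓ) hd h0 i (Pi.single j 1)
  rw [Matrix.mul_apply, Matrix.one_apply]
  rw [Pi.single_apply] at this
  rw [← this, FrobeniusData.pair]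
  exact Finset.sum_congr rfl fun k _ => by simp [Pi.single_apply, mul_comm]

theorem cometric_conjData (hd : IsEulerWeight d) (h0 : t 0 ≠ 0) :
    (conjData S d ℓ).cometric t = conjCometric d ℓ t :=
  Matrix.inv_eq_left_inv (conjCometric_mul_metric hd h0)

theorem isFrobenius_conjData (h : StandardForm M S F d) (hℓ : IsLogSqBranch Λ ℓ) :
    IsFrobenius (conjDomain M Λ) (conjData S d ℓ) := by
  have hd := h.isEulerWeight
  have hA := fun {t} (ht : t ∈ conjDomain M Λ) (v : Pt 𝕜 (n + 2)) =>
    eulerReflection_eulerReflection hd (hℓ.ne_zero ht.2) v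
  constructor
  · exact isOpen_conjDomain h.isOpen hℓ
  · intro i j
    exact (contDiffOn_confFactor hℓ).mul (ContDiffOn.sum fun k _ =>
      (contDiffOn_eulerReflection_single hd hℓ i k).mul
        (contDiffOn_eulerReflection_single hd hℓ j _))
  · intro i j k
    refine (contDiffOn_confFactor hℓ).mul (contDiffOn_eulerReflection hd hℓ (fun k => ?_) k)
    exact ContDiffOn.sum fun a _ => ContDiffOn.sum fun b _ =>
      (((h.frobenius.smooth_mul a b k).mono fun _ hq => hq.1).mul
        (contDiffOn_eulerReflection_single hd hℓ i a)).mul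
        (contDiffOn_eulerReflection_single hd hℓ j b)
  · exact ((contDiffOn_confFactor hℓ).inv fun _ _ => confFactor_ne_zero).smul contDiffOn_const
  · exact contDiffOn_pi.2 fun i => (contDiffOn_diagField _ i).neg
  · intro t _ v w
    rw [pair_conjData, pair_conjData, antiPair_comm]
  · intro t ht
    exact Matrix.isUnit_det_of_left_inverse (conjCometric_mul_metric hd (hℓ.ne_zero ht.2))
  · intro t ht v w
    rw [mul_conjData, mul_conjData, h.frobenius.mul_comm t ht.1]
  · intro t ht u v w
    simp only [mul_conjData, eulerReflection_smul, hA ht, S.mul_smul_left, S.mul_smul_right]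
    rw [h.frobenius.mul_assoc t ht.1]
  · intro t ht v
    exact unit_mul_conjData h hℓ ht v
  · intro t ht u v w
    simp only [mul_conjData, pair_conjData, eulerReflection_smul, hA ht, antiPair_smul_left,
      antiPair_smul_right]
    rw [← h.pair_eq ht.1, ← h.pair_eq ht.1, h.frobenius.pair_mul t ht.1]
  · intro t ht
    refine ⟨conjDomain M Λ, isOpen_conjDomain h.isOpen hℓ, ht, subset_rfl, conjCoord d ℓ,
      conjPotential d ℓ F, isFlatCoordinates_conjData h hℓ, isPotential_conjData h hℓ,
      Matrix.of fun i j => if i = j then -conjDegree d j else 0, 0, fun q hq j => ?_⟩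
    have := fderiv_conjCoord_diagField hd hℓ hq.2 j
    simp [conjData, this]
  · intro t ht
    exact lie_unit_conjData hd hℓ ht.2
  · intro t ht i j
    have h1 := (hasDegree_metric_conjData (S := S) hd hℓ ht.2 i j).2
    have h2 : fderiv 𝕜 (fun q => (conjData S d ℓ).metric q i j) t ((conjData S d ℓ).euler t)
        = -((d 0 - 1 - d i - d j) * (conjData S d ℓ).metric t i j) := by
      rw [← h1, ← map_neg]; rfl
    have h3 : (conjData S d ℓ).charge = 1 + d 0 := by
      simp only [conjData, h.charge_eq]; ring
    rw [h2, h3]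
    simp only [pd_euler_conjData, mul_ite, mul_zero, Finset.sum_ite_eq', Finset.mem_univ, if_true]
    ring
  · intro t ht i j k
    have h1 := (hasDegree_c_conjData h hℓ ht i j k).2
    have h2 : fderiv 𝕜 (fun q => (conjData S d ℓ).c q i j k) t ((conjData S d ℓ).euler t)
        = -((d k - d i - d j - 1) * (conjData S d ℓ).c t i j k) := by
      rw [← h1, ← map_neg]; rfl
    rw [h2]
    simp only [pd_euler_conjData, mul_ite, mul_zero, Finset.sum_ite_eq, Finset.sum_ite_eq',
      Finset.mem_univ, if_true]
    ring

/-! ### The conjugate pencil -/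

theorem StandardForm.cometric_apply (h : StandardForm M S F d) (ht : t ∈ M) (i : Fin (n + 2)) :
    S.cometric t i = Pi.single (Fin.rev i) 1 := by
  have hinv : S.cometric t = S.metric t := by
    refine Matrix.inv_eq_left_inv ?_
    ext i j
    rw [Matrix.mul_apply, Matrix.one_apply]
    simp only [h.metric_eq t ht, ite_mul, one_mul, zero_mul, Finset.sum_ite_eq', Finset.mem_univ,
      if_true, Fin.rev_rev]
    simp only [eq_comm]
  ext j
  rw [hinv, h.metric_eq t ht, Pi.single_apply]

theorem StandardForm.intersectionForm_eq_antiPair (h : StandardForm M S F d) (ht : t ∈ M)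
    (i j : Fin (n + 2)) :
    S.intersectionForm t i j = antiPair (S.mul t (Pi.single (Fin.rev i) 1)
      (Pi.single (Fin.rev j) 1)) (diagField d t) := by
  rw [FrobeniusData.intersectionForm, Matrix.of_apply, h.pair_eq ht, h.euler_eq t ht]
  exact congrArg₂ (fun a b => antiPair (S.mul t a b) (diagField d t))
    (h.cometric_apply ht i) (h.cometric_apply ht j)

/-- The intersection form in terms of the Hessian of the potential. -/
theorem StandardForm.intersectionForm_apply (h : StandardForm M S F d) (ht : t ∈ M)
    (i j : Fin (n + 2)) :
    S.intersectionForm t i j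
      = (d i + d j - d 0) * pd (Fin.rev i) (pd (Fin.rev j) F) t := by
  rw [h.intersectionForm_eq_antiPair ht, h.antiPair_mul ht]
  have h1 := h.homogeneous_pd_pd ht (Fin.rev i) (Fin.rev j)
  rw [fderiv_eq_sum_pd] at h1
  have h2 : cubicForm (thirdPd F t) (Pi.single (Fin.rev i) 1) (Pi.single (Fin.rev j) 1)
      (diagField d t) = ∑ k, diagField d t k * pd k (pd (Fin.rev i) (pd (Fin.rev j) F)) t := by
    simp only [cubicForm, Pi.single_apply, ite_mul, one_mul, zero_mul]
    rw [Finset.sum_eq_single (Fin.rev i) (fun b _ hb => by simp [hb]) (by simp),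
      Finset.sum_eq_single (Fin.rev j) (fun b _ hb => by simp [hb]) (by simp)]
    refine Finset.sum_congr rfl fun k _ => ?_
    simp only [if_true]
    rw [thirdPd_comm_right h ht, thirdPd_comm_left h ht]; rfl
  rw [h2, h1]
  linear_combination (-pd (Fin.rev i) (pd (Fin.rev j) F) t) * (h.deg_add' i + h.deg_add' j)

theorem StandardForm.intersectionForm_zero_right (h : StandardForm M S F d) (ht : t ∈ M)
    (i : Fin (n + 2)) : S.intersectionForm t i 0 = d i * t i := by
  rw [h.intersectionForm_apply ht, Fin.rev_zero, h.pd_pd_last ht, Fin.rev_rev]; ring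

theorem StandardForm.intersectionForm_zero_left (h : StandardForm M S F d) (ht : t ∈ M)
    (i : Fin (n + 2)) : S.intersectionForm t 0 i = d i * t i := by
  rw [h.intersectionForm_apply ht, Fin.rev_zero, h.pd_last_pd ht, Fin.rev_rev]; ring

theorem gradField_coord_zero {r : ℕ} (Ω : Pt 𝕜 (r + 1) → Matrix (Fin (r + 1)) (Fin (r + 1)) 𝕜)
    (p : Pt 𝕜 (r + 1)) (i : Fin (r + 1)) :
    gradField Ω (fun t => t 0) p i = Ω p i 0 := by
  have : ∀ j, pd j (fun t : Pt 𝕜 (r + 1) => t 0) p = if 0 = j then 1 else 0 := fun j => by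
    rw [pd, (HasDirDeriv.coord _ _ _).2, Pi.single_apply]
  simp [gradField, this]

theorem gradField_neg_coord_zero {r : ℕ}
    (Ω : Pt 𝕜 (r + 1) → Matrix (Fin (r + 1)) (Fin (r + 1)) 𝕜)
    (p : Pt 𝕜 (r + 1)) (i : Fin (r + 1)) :
    gradField Ω (fun t => -t 0) p i = -Ω p i 0 := by
  have : ∀ j, pd j (fun t : Pt 𝕜 (r + 1) => -t 0) p = -if 0 = j then 1 else 0 := fun j => by
    rw [pd, (HasDirDeriv.coord _ _ _).neg.2, Pi.single_apply]
  simp [gradField, this]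

theorem conjCometric_apply (i j : Fin (n + 2)) :
    conjCometric d ℓ t i j = (confFactor d ℓ t)⁻¹ * ((if j = Fin.rev i then 1 else 0)
      - 2 / (d 0 * t 0) * ((if i = Fin.last (n + 1) then d j * t j else 0)
        + if j = Fin.last (n + 1) then d i * t i else 0)) := by
  have e : ((0 : Fin (n + 2)) = Fin.rev i) ↔ i = Fin.last (n + 1) := by
    rw [eq_comm, Fin.rev_eq_iff, Fin.rev_zero]
  simp only [conjCometric, Matrix.of_apply, Pi.smul_apply, smul_eq_mul, eulerReflection,
    Pi.sub_apply, Pi.single_apply, zero_ne_last, if_false, e, diagField]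
  split_ifs <;> ring

theorem powBranch_charge (h : StandardForm M S F d) (x : 𝕜) :
    powBranch ℓ (2 / (1 - S.charge)) x = (powBranch ℓ (-2 / d 0) x)⁻¹ := by
  rw [← powBranch_neg, ← h.deg_zero]; congr 1; ring

theorem lieContra_intersectionForm (h : StandardForm M S F d) (hℓ : IsLogSqBranch Λ ℓ)
    (ht : t ∈ conjDomain M Λ) :
    lieContra (fun p => powBranch ℓ (2 / (1 - S.charge)) (p 0) • S.unit p) S.intersectionForm t
      = conjCometric d ℓ t := by
  have hd := h.isEulerWeight
  have h0 := hℓ.ne_zero ht.2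
  have hd0 := hd.ne_zero
  ext i j
  have h1 : HasDirDeriv (fun q => S.intersectionForm q i j)
      ((d i + d j - d 0) * ((confFactor d ℓ t)⁻¹ * if j = Fin.rev i then 1 else 0)) t
      ((confFactor d ℓ t)⁻¹ • Pi.single (Fin.last (n + 1)) 1) := by
    refine HasDirDeriv.congr_of_eventuallyEq (HasDirDeriv.const_mul _
      (f := pd (Fin.rev i) (pd (Fin.rev j) F)) ⟨(h.smooth_pd_pd _ _).differentiableAt_of_isOpen
        h.isOpen ht.1, ?_⟩) ?_
    · rw [map_smul, ← pd, h.pd_last_pd_pd ht.1, smul_eq_mul]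
      simp only [Fin.rev_inj]
    · filter_upwards [h.isOpen.mem_nhds ht.1] with q hq using h.intersectionForm_apply hq i j
  have h2 : ∀ i l, pd l (fun q => (powBranch ℓ (2 / (1 - S.charge)) (q 0) • S.unit q) i) t
      = if l = 0 then (if i = Fin.last (n + 1) then
        2 / (d 0 * t 0) * (confFactor d ℓ t)⁻¹ else 0) else 0 := by
    intro i l
    have h3 := (HasDirDeriv.scomp (hℓ.hasDerivAt_powBranch (2 / d 0) ht.2)
      (HasDirDeriv.coord 0 t (Pi.single l 1))).mul
      (HasDirDeriv.const ((Pi.single (Fin.last (n + 1)) 1 : Pt 𝕜 (n + 2)) i) t (Pi.single l 1))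
    have h4 : (fun q => (powBranch ℓ (2 / (1 - S.charge)) (q 0) • S.unit q) i) =ᶠ[𝓝 t]
        fun q => powBranch ℓ (2 / d 0) (q 0)
          * (Pi.single (Fin.last (n + 1)) 1 : Pt 𝕜 (n + 2)) i := by
      filter_upwards [h.isOpen.mem_nhds ht.1] with q hq
      rw [h.unit_eq q hq, h.deg_zero]; rfl
    rw [pd, h4.fderiv_eq, h3.2]
    have h5 : powBranch ℓ (2 / d 0) (t 0) = (confFactor d ℓ t)⁻¹ := by
      rw [confFactor, ← powBranch_neg]; congr 1; ring
    rw [h5]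
    simp only [Pi.single_apply, eq_comm (a := (0 : Fin (n + 2)))]
    split_ifs
    · field_simp; ring
    all_goals simp
  have hV : powBranch ℓ (2 / (1 - S.charge)) (t 0) • S.unit t
      = (confFactor d ℓ t)⁻¹ • (Pi.single (Fin.last (n + 1)) 1 : Pt 𝕜 (n + 2)) := by
    rw [powBranch_charge h, h.unit_eq t ht.1]; rfl
  simp only [lieContra, Matrix.of_apply, h2, hV, h1.2]
  simp only [mul_ite, mul_zero, Finset.sum_ite_eq', Finset.mem_univ, if_true,
    h.intersectionForm_zero_left ht.1, h.intersectionForm_zero_right ht.1]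
  rw [conjCometric_apply]
  have hij : j = Fin.rev i → d i + d j - d 0 = 1 := by
    rintro rfl
    rw [hd.add_rev]; ring
  by_cases hj : j = Fin.rev i
  · simp only [hij hj, if_pos hj]
    split_ifs <;> ring
  · simp only [if_neg hj]
    split_ifs <;> ring

theorem intersectionForm_conjData (h : StandardForm M S F d) (hℓ : IsLogSqBranch Λ ℓ)
    (ht : t ∈ conjDomain M Λ) :
    (conjData S d ℓ).intersectionForm t = S.intersectionForm t := by
  have hd := h.isEulerWeight
  have h0 := hℓ.ne_zero ht.2
  have hd0 := hd.ne_zero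
  have hc := confFactor_ne_zero (d := d) (ℓ := ℓ) (t := t)
  have hrow : ∀ i, eulerReflection d t ((conjData S d ℓ).cometric t i)
      = (confFactor d ℓ t)⁻¹ • ((Pi.single (Fin.rev i) 1 : Pt 𝕜 (n + 2))
        + (-(2 / (d 0 * t 0) * diagField d t i)) • S.unit t) := fun i => by
    rw [cometric_conjData hd h0, h.unit_eq t ht.1, neg_smul, ← sub_eq_add_neg]
    change eulerReflection d t ((confFactor d ℓ t)⁻¹ • eulerReflection d t _) = _
    rw [eulerReflection_smul, eulerReflection_eulerReflection hd h0]
  ext i j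
  rw [h.intersectionForm_eq_antiPair ht.1, FrobeniusData.intersectionForm, Matrix.of_apply]
  have e : (conjData S d ℓ).euler t = -diagField d t := rfl
  have e' : eulerReflection d t (-diagField d t) = diagField d t := by
    rw [← eulerReflection_diagField hd h0, eulerReflection_eulerReflection hd h0]
  rw [pair_mul_conjData h hℓ ht, hrow, hrow, e, e', ← h.antiPair_mul ht.1]
  have hu := h.frobenius.unit_mul t ht.1
  have hu' : ∀ v, S.mul t v (S.unit t) = v := fun v => by
    rw [h.frobenius.mul_comm t ht.1, hu]
  simp only [S.mul_smul_left, S.mul_smul_right, S.mul_add_left, S.mul_add_right, hu, hu',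
    antiPair_smul_left, antiPair_add_left]
  rw [h.unit_eq t ht.1]
  simp only [antiPair_single_left, Fin.rev_rev, Fin.rev_last, diagField]
  field_simp
  ring

theorem isConjugate_conjData (h : StandardForm M S F d) (hℓ : IsLogSqBranch Λ ℓ) :
    IsConjugate (conjDomain M Λ) S (fun t => t 0) (powBranch ℓ (2 / (1 - S.charge)))
      (conjData S d ℓ) := by
  have hd := h.isEulerWeight
  refine ⟨⟨contDiffOn_coord 0 _, fun t ht => ⟨rfl, rfl, ?_, ?_⟩⟩, fun t ht => ⟨?_, ?_⟩,
    isFrobenius_conjData h hℓ, rfl, (contDiffOn_coord 0 _).neg, fun t ht => ⟨?_, ?_, ?_, ?_⟩⟩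
  · ext i
    rw [gradField_coord_zero, h.unit_eq t ht.1, h.cometric_apply ht.1]
    simp only [Pi.single_apply, eq_comm (a := (0 : Fin (n + 2))), Fin.rev_eq_iff, Fin.rev_zero]
  · ext i
    rw [gradField_coord_zero, h.euler_eq t ht.1, h.intersectionForm_zero_right ht.1]; rfl
  · rw [(HasDirDeriv.coord _ _ _).2, h.unit_eq t ht.1, Pi.single_apply, if_neg zero_ne_last]
  · rw [(HasDirDeriv.coord _ _ _).2, h.euler_eq t ht.1, ← h.deg_zero]; rfl
  · rw [lieContra_intersectionForm h hℓ ht, cometric_conjData hd (hℓ.ne_zero ht.2)]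
  · rw [intersectionForm_conjData h hℓ ht]
  · ext i
    rw [gradField_neg_coord_zero, lieContra_intersectionForm h hℓ ht, conjCometric_apply]
    have e : ((0 : Fin (n + 2)) = Fin.rev i) ↔ i = Fin.last (n + 1) := by
      rw [eq_comm, Fin.rev_eq_iff, Fin.rev_zero]
    have h0 := hℓ.ne_zero ht.2
    have hd0 := hd.ne_zero
    simp only [conjData, Pi.smul_apply, Pi.single_apply, e, zero_ne_last, if_false, smul_eq_mul]
    split_ifs
    · field_simp; ring
    · simp
  · ext i
    rw [gradField_neg_coord_zero, h.intersectionForm_zero_right ht.1]; rfl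

end ConjData

/-! ### Flat coordinates of a Frobenius structure -/

section FlatCoordinates

variable {𝕜 : Type*} [RCLike 𝕜] {m : ℕ} {U W : Set (Pt 𝕜 (m + 1))}
  {S : FrobeniusData 𝕜 (m + 1)} {x y : Pt 𝕜 (m + 1) → Pt 𝕜 (m + 1)} {p : Pt 𝕜 (m + 1)}

theorem coordField_eq_sum (hy : IsCoordinateSystem W y)
    (hW : IsOpen W) (hp : p ∈ W) (i : Fin (m + 1)) :
    coordField x i p = ∑ a, coordDeriv x i (fun q => y q a) p • coordField y a p := by
  conv_lhs => rw [eq_sum_coordField hy hp (coordField x i p)]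
  exact Finset.sum_congr rfl fun a _ => by
    rw [coordDeriv, fderiv_coord_apply (hy.differentiableAt hW hp)]

theorem FrobeniusData.pair_sum_smul (S : FrobeniusData 𝕜 (m + 1)) (p : Pt 𝕜 (m + 1))
    (Y : Fin (m + 1) → Pt 𝕜 (m + 1)) (v w : Pt 𝕜 (m + 1)) :
    S.pair p (∑ a, v a • Y a) (∑ b, w b • Y b) = ∑ a, ∑ b, S.pair p (Y a) (Y b) * v a * w b :=
  sum_sum_mul_change_frame (fun i j => S.metric p i j) Y v w

theorem IsFrobenius.eq_zero_of_pair_eq_zero (hS : IsFrobenius U S) (hp : p ∈ U)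
    {z : Pt 𝕜 (m + 1)} (h : ∀ w, S.pair p z w = 0) : z = 0 := by
  refine Matrix.eq_zero_of_vecMul_eq_zero (hS.metric_nondeg p hp).ne_zero ?_
  ext j
  rw [Pi.zero_apply, ← h (Pi.single j 1), FrobeniusData.pair, Matrix.vecMul, dotProduct]
  exact Finset.sum_congr rfl fun i _ => by simp [Pi.single_apply, _root_.mul_comm]

/-- Two systems of coordinates in which the metric is constant are affinely related: the
transition Jacobian is parallel. -/
theorem coordDeriv_coordDeriv_flat (hS : IsFrobenius U S) (hW : IsOpen W) (hWU : W ⊆ U)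
    (hx : IsCoordinateSystem W x) (hy : IsCoordinateSystem W y)
    {ηx ηy : Matrix (Fin (m + 1)) (Fin (m + 1)) 𝕜}
    (hηx : ∀ p ∈ W, ∀ i j, S.pair p (coordField x i p) (coordField x j p) = ηx i j)
    (hηy : ∀ p ∈ W, ∀ i j, S.pair p (coordField y i p) (coordField y j p) = ηy i j)
    (hp : p ∈ W) (k i a : Fin (m + 1)) :
    coordDeriv x k (coordDeriv x i fun q => y q a) p = 0 := by
  set B : Fin (m + 1) → Fin (m + 1) → Pt 𝕜 (m + 1) → 𝕜 :=
    fun i a => coordDeriv x i fun q => y q a with hB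
  set β : Fin (m + 1) → Fin (m + 1) → Fin (m + 1) → 𝕜 := fun k i a => coordDeriv x k (B i a) p
  have hBs : ∀ i a, ContDiffOn 𝕜 ∞ (B i a) W := fun i a =>
    contDiffOn_coordDeriv hx hW i (hy.contDiffOn_coord a)
  have hβ : ∀ k i a, β k i a = β i k a := fun k i a =>
    coordDeriv_comm hx hW (hy.contDiffOn_coord a) hp k i
  have hηs : ∀ a b, ηy a b = ηy b a := fun a b => by
    rw [← hηy p hp, ← hηy p hp, hS.metric_symm p (hWU hp)]
  have hexp : ∀ i j, ∀ q ∈ W, ∑ a, ∑ b, ηy a b * B i a q * B j b q = ηx i j := fun i j q hq => by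
    rw [← hηx q hq, coordField_eq_sum hy hW hq i, coordField_eq_sum hy hW hq j]
    have := S.pair_sum_smul q (fun a => coordField y a q) (fun a => B i a q) (fun a => B j a q)
    rw [this]
    exact Finset.sum_congr rfl fun a _ => Finset.sum_congr rfl fun b _ => by rw [hηy q hq]
  set N : Fin (m + 1) → Fin (m + 1) → Fin (m + 1) → 𝕜 :=
    fun k i j => ∑ a, ∑ b, ηy a b * β k i a * B j b p with hN
  -- Koszul's argument: `N` is symmetric in the first and skew in the last two indices
  have hskew : ∀ k i j, N k i j + N k j i = 0 := by
    intro k i j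
    have hBd : ∀ i a, HasDirDeriv (B i a) (β k i a) p (coordField x k p) := fun i a =>
      ⟨(hBs i a).differentiableAt_of_isOpen hW hp, rfl⟩
    have h1 : HasDirDeriv (fun q => ∑ a, ∑ b, ηy a b * B i a q * B j b q)
        (∑ a, ∑ b, (ηy a b * β k i a * B j b p + ηy a b * B i a p * β k j b)) p
        (coordField x k p) :=
      HasDirDeriv.sum fun a _ => HasDirDeriv.sum fun b _ =>
        ((hBd i a).const_mul (ηy a b)).mul (hBd j b)
    have h2 : HasDirDeriv (fun q => ∑ a, ∑ b, ηy a b * B i a q * B j b q) 0 p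
        (coordField x k p) := by
      refine (HasDirDeriv.const (ηx i j) _ _).congr_of_eventuallyEq ?_
      filter_upwards [hW.mem_nhds hp] with q hq using hexp i j q hq
    have h3 := h1.2.symm.trans h2.2
    simp only [Finset.sum_add_distrib] at h3
    rw [← h3]
    congr 1
    rw [hN]
    simp only
    rw [Finset.sum_comm]
    exact Finset.sum_congr rfl fun a _ => Finset.sum_congr rfl fun b _ => by rw [hηs]; ring
  have hsymm : ∀ k i j, N k i j = N i k j := fun k i j => by simp only [hN, hβ k i]
  have hzero : ∀ k i j, N k i j = 0 := fun k i j => by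
    have e1 := hskew k i j
    have e2 := hskew i k j
    have e3 := hskew j k i
    rw [hsymm i k j] at e2
    rw [hsymm j k i, hsymm j i k] at e3
    have : (2 : 𝕜) * N k i j = 0 := by linear_combination e1 + e2 - e3
    simpa using this
  have hz : ∑ a, β k i a • coordField y a p = 0 := by
    refine hS.eq_zero_of_pair_eq_zero (hWU hp) fun w => ?_
    rw [eq_sum_coordField hx hp w]
    have h1 : ∀ j, S.pair p (∑ a, β k i a • coordField y a p) (coordField x j p) = 0 :=
      fun j => by
        rw [coordField_eq_sum hy hW hp j]
        have := S.pair_sum_smul p (fun a => coordField y a p) (fun a => β k i a)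
          (fun a => B j a p)
        rw [this, ← hzero k i j]
        exact Finset.sum_congr rfl fun a _ => Finset.sum_congr rfl fun b _ => by rw [hηy p hp]
    generalize ∑ a, β k i a • coordField y a p = z at h1
    have h2 : ∀ w, S.pair p z w = ∑ b, (∑ a, S.metric p a b * z a) * w b := fun w => by
      rw [FrobeniusData.pair, Finset.sum_comm]
      exact Finset.sum_congr rfl fun b _ => by rw [Finset.sum_mul]
    simp only [h2] at h1 ⊢
    simp only [Finset.sum_apply, Pi.smul_apply, smul_eq_mul, Finset.mul_sum]
    rw [Finset.sum_comm]
    refine Finset.sum_eq_zero fun j _ => ?_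
    have := congrArg (fun c => fderiv 𝕜 x p w j * c) (h1 j)
    rw [mul_zero, Finset.mul_sum] at this
    rw [← this]
    exact Finset.sum_congr rfl fun b _ => by ring
  have h4 := congrArg (fun v => fderiv 𝕜 y p v a) hz
  simpa [fderiv_coordField hy hp, Pi.single_apply] using h4

/-- The components `Π(∂ᵢ ∘ ∂ⱼ, ∂ₖ)` of the multiplication in a coordinate system. -/
def coordMul (S : FrobeniusData 𝕜 (m + 1)) (x : Pt 𝕜 (m + 1) → Pt 𝕜 (m + 1))
    (i j k : Fin (m + 1)) (p : Pt 𝕜 (m + 1)) : 𝕜 :=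
  S.pair p (S.mul p (coordField x i p) (coordField x j p)) (coordField x k p)

theorem coordMul_comm_left (hS : IsFrobenius U S) (hp : p ∈ U) (i j k : Fin (m + 1)) :
    coordMul S x i j k p = coordMul S x j i k p := by
  rw [coordMul, coordMul, hS.mul_comm p hp]

theorem coordMul_comm_right (hS : IsFrobenius U S) (hp : p ∈ U) (i j k : Fin (m + 1)) :
    coordMul S x i j k p = coordMul S x i k j p := by
  rw [coordMul, coordMul, hS.pair_mul p hp, hS.mul_comm p hp (coordField x j p),
    ← hS.pair_mul p hp]

theorem contDiffOn_coordMul (hS : IsFrobenius U S) (hx : IsCoordinateSystem U x)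
    (i j k : Fin (m + 1)) : ContDiffOn 𝕜 ∞ (coordMul S x i j k) U := by
  have hX := fun i a => contDiffOn_pi.1 (contDiffOn_coordField hx hS.isOpen i) a
  unfold coordMul FrobeniusData.pair FrobeniusData.mul
  exact ContDiffOn.sum fun l _ => ContDiffOn.sum fun c _ =>
    ((hS.smooth_metric l c).mul (ContDiffOn.sum fun a _ => ContDiffOn.sum fun b _ =>
      ((hS.smooth_mul a b l).mul (hX i a)).mul (hX j b))).mul (hX k c)

/-- In any coordinates in which the metric is constant, the first derivatives of the components of
the multiplication are totally symmetric. -/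
theorem coordDeriv_coordMul_comm (hS : IsFrobenius U S) (hx : IsCoordinateSystem U x)
    {η : Matrix (Fin (m + 1)) (Fin (m + 1)) 𝕜}
    (hη : ∀ p ∈ U, ∀ i j, S.pair p (coordField x i p) (coordField x j p) = η i j)
    (hp : p ∈ U) (l i j k : Fin (m + 1)) :
    coordDeriv x l (coordMul S x i j k) p = coordDeriv x i (coordMul S x l j k) p := by
  obtain ⟨W, hW, hpW, hWU, y, Φ, ⟨hy, ⟨ηy, hηy⟩, -⟩, ⟨hΦ, hpot, -⟩, -⟩ := hS.flat p hp
  have hxW := hx.mono hWU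
  set B : Fin (m + 1) → Fin (m + 1) → Pt 𝕜 (m + 1) → 𝕜 :=
    fun i a => coordDeriv x i fun q => y q a with hB
  have hBd : ∀ l i a, HasDirDeriv (B i a) 0 p (coordField x l p) := fun l i a =>
    ⟨(contDiffOn_coordDeriv hxW hW i (hy.contDiffOn_coord a)).differentiableAt_of_isOpen hW hpW,
      coordDeriv_coordDeriv_flat hS hW hWU hxW hy (fun q hq => hη q (hWU hq)) hηy hpW l i a⟩
  set P : Fin (m + 1) → Fin (m + 1) → Fin (m + 1) → Pt 𝕜 (m + 1) → 𝕜 :=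
    fun a b c => coordDeriv y a (coordDeriv y b (coordDeriv y c Φ)) with hP
  have hs2 : ∀ b c, ContDiffOn 𝕜 ∞ (coordDeriv y b (coordDeriv y c Φ)) W := fun b c =>
    contDiffOn_coordDeriv hy hW b (contDiffOn_coordDeriv hy hW c hΦ)
  have hPs : ∀ a b c, ContDiffOn 𝕜 ∞ (P a b c) W := fun a b c =>
    contDiffOn_coordDeriv hy hW a (hs2 b c)
  have hexp : ∀ i j k, ∀ q ∈ W, coordMul S x i j k q
      = ∑ a, ∑ b, ∑ c, B i a q * B j b q * B k c q * P a b c q := fun i j k q hq => by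
    rw [coordMul, coordField_eq_sum hy hW hq i, coordField_eq_sum hy hW hq j,
      coordField_eq_sum hy hW hq k, pair_mul_eq_cubicForm]
    have := cubicForm_sum (fun i j k => ∑ l, S.c q i j l * S.metric q l k)
      (fun a => coordField y a q) (fun a => B i a q) (fun a => B j a q) (fun a => B k a q)
    rw [this]
    simp only [← pair_mul_eq_cubicForm, hpot q hq]
    rfl
  have hder : ∀ l i, coordDeriv x l (coordMul S x i j k) p
      = ∑ a, ∑ e, ∑ b, ∑ c, B i a p * B l e p * B j b p * B k c p * coordDeriv y e (P a b c) p := by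
    intro l i
    have hPd : ∀ a b c, HasDirDeriv (P a b c) (∑ e, B l e p * coordDeriv y e (P a b c) p) p
        (coordField x l p) := fun a b c =>
      ⟨(hPs a b c).differentiableAt_of_isOpen hW hpW, by
        rw [coordField_eq_sum hy hW hpW l, map_sum]
        simp [coordDeriv, hB]⟩
    have h1 : HasDirDeriv (coordMul S x i j k)
        (∑ a, ∑ b, ∑ c, B i a p * B j b p * B k c p * ∑ e, B l e p * coordDeriv y e (P a b c) p) p
        (coordField x l p) := by
      refine HasDirDeriv.congr_of_eventuallyEq (HasDirDeriv.sum fun a _ => HasDirDeriv.sum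
        fun b _ => HasDirDeriv.sum fun c _ => ((((hBd l i a).mul (hBd l j b)).mul
          (hBd l k c)).mul (hPd a b c)).congr_deriv ?_) ?_
      · ring
      · filter_upwards [hW.mem_nhds hpW] with q hq using hexp i j k q hq
    rw [coordDeriv, h1.2]
    refine Finset.sum_congr rfl fun a _ => ?_
    calc _ = ∑ b, ∑ c, ∑ e,
          B i a p * B l e p * B j b p * B k c p * coordDeriv y e (P a b c) p := by
          refine Finset.sum_congr rfl fun b _ => Finset.sum_congr rfl fun c _ => ?_
          rw [Finset.mul_sum]
          exact Finset.sum_congr rfl fun e _ => by ring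
      _ = ∑ b, ∑ e, ∑ c,
          B i a p * B l e p * B j b p * B k c p * coordDeriv y e (P a b c) p :=
          Finset.sum_congr rfl fun b _ => Finset.sum_comm
      _ = _ := Finset.sum_comm
  rw [hder l i, hder i l, Finset.sum_comm]
  refine Finset.sum_congr rfl fun e _ => Finset.sum_congr rfl fun a _ =>
    Finset.sum_congr rfl fun b _ => Finset.sum_congr rfl fun c _ => ?_
  rw [hP, coordDeriv_comm hy hW (hs2 b c) hpW e a]
  ring

end FlatCoordinates

/-! ### Uniqueness of the conjugate structure -/

section Uniqueness

variable {𝕜 : Type*} [RCLike 𝕜] {n : ℕ} {M : Set (Pt 𝕜 (n + 2))} {S S' : FrobeniusData 𝕜 (n + 2)}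
  {F : Pt 𝕜 (n + 2) → 𝕜} {d : Fin (n + 2) → 𝕜} {Λ : Set 𝕜} {ℓ : 𝕜 → 𝕜} {t : Pt 𝕜 (n + 2)}

theorem hasDegree_coordField (hd : IsEulerWeight d) (hℓ : IsLogSqBranch Λ ℓ) (hΛ : t 0 ∈ Λ)
    (i a : Fin (n + 2)) :
    HasDegree d (fun q => coordField (conjCoord d ℓ) i q a) (d a - conjDegree d i) t := by
  have hx := isCoordinateSystem_conjCoord hd hℓ
  have hW := isOpen_preimage_zero (n := n) hℓ
  have e : (fun q => coordField (conjCoord d ℓ) i q a)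
      = coordDeriv (conjCoord d ℓ) i fun q => q a := by
    funext q
    rw [coordDeriv, (HasDirDeriv.coord a q _).2]
  rw [e]
  exact ⟨(contDiffOn_coordDeriv hx hW i (contDiffOn_coord a _)).differentiableAt_of_isOpen hW hΛ,
    coordDeriv_homogeneous hx hW (fun p hp k => fderiv_conjCoord_diagField hd hℓ hp k)
      (contDiffOn_coord a _) (fun p _ => (HasDegree.coord a p).2) i hΛ⟩

/-- The degree of the components of the multiplication of a Frobenius structure with the Euler
field `-∑ dᵢ tⁱ ∂ᵢ` in the conjugate coordinates. -/
theorem hasDegree_coordMul (hd : IsEulerWeight d) (hℓ : IsLogSqBranch Λ ℓ)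
    (hS' : IsFrobenius (conjDomain M Λ) S') (hch : S'.charge = 1 + d 0)
    (hE : ∀ t ∈ conjDomain M Λ, S'.euler t = -diagField d t) (ht : t ∈ conjDomain M Λ)
    (i j k : Fin (n + 2)) :
    HasDegree d (coordMul S' (conjCoord d ℓ) i j k)
      (d 0 - 2 - conjDegree d i - conjDegree d j - conjDegree d k) t := by
  have hU := hS'.isOpen
  have hpd : ∀ i l, pd i (fun q => S'.euler q l) t = if l = i then -d l else 0 := fun i l => by
    rw [pd_congr hU (g := fun q => -(d l * q l)) (fun q hq => by rw [hE q hq]; rfl) i ht, pd,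
      ((HasDirDeriv.coord l t _).const_mul (d l)).neg.2]
    simp only [Pi.single_apply, mul_ite, mul_one, mul_zero]
    split_ifs <;> simp
  have hmet : ∀ i j, HasDegree d (fun q => S'.metric q i j) (d 0 - 1 - d i - d j) t :=
    fun i j => ⟨(hS'.smooth_metric i j).differentiableAt_of_isOpen hU ht, by
      have h1 := hS'.lie_metric t ht i j
      rw [hE t ht, map_neg, hch] at h1
      simp only [hpd, mul_ite, mul_zero, Finset.sum_ite_eq', Finset.mem_univ, if_true] at h1
      linear_combination -h1⟩
  have hc : ∀ i j k, HasDegree d (fun q => S'.c q i j k) (d k - d i - d j - 1) t :=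
    fun i j k => ⟨(hS'.smooth_mul i j k).differentiableAt_of_isOpen hU ht, by
      have h1 := hS'.lie_mul t ht i j k
      rw [hE t ht, map_neg] at h1
      simp only [hpd, mul_ite, mul_zero, Finset.sum_ite_eq, Finset.sum_ite_eq', Finset.mem_univ,
        if_true] at h1
      linear_combination -h1⟩
  have hX := fun i a => hasDegree_coordField (ℓ := ℓ) hd hℓ ht.2 i a
  unfold coordMul FrobeniusData.pair FrobeniusData.mul
  exact HasDegree.sum fun l _ => HasDegree.sum fun c _ =>
    ((((hmet l c).mul (HasDegree.sum (c := d l - 1 - conjDegree d i - conjDegree d j)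
      fun a _ => HasDegree.sum fun b _ => (((hc a b l).mul (hX i a)).mul (hX j b)).congr_degree
        (by ring))).mul (hX k c)).congr_degree (by ring))

theorem cubicForm_sum_sum {r : ℕ} (C : Fin r → Fin r → Fin r → 𝕜) (Y : Fin r → Pt 𝕜 r)
    (u v w : Pt 𝕜 r) :
    cubicForm C (∑ i, u i • Y i) (∑ i, v i • Y i) w
      = ∑ i, ∑ j, u i * (v j * cubicForm C (Y i) (Y j) w) := by
  have h1 := map_sum (IsLinearMap.mk' _ (isLinearMap_cubicForm_left C (∑ i, v i • Y i) w))
    (fun i => u i • Y i) Finset.univ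
  simp only [map_smul, IsLinearMap.mk'_apply, smul_eq_mul] at h1
  rw [h1]
  refine Finset.sum_congr rfl fun i _ => ?_
  have h2 := map_sum (IsLinearMap.mk' _ (isLinearMap_cubicForm_middle C (Y i) w))
    (fun i => v i • Y i) Finset.univ
  simp only [map_smul, IsLinearMap.mk'_apply, smul_eq_mul] at h2
  rw [h2, Finset.mul_sum]

/-- If two structures have the same metric, their products of tangent vectors paired with `E` are
determined by their intersection forms. -/
theorem pair_mul_euler_eq {p : Pt 𝕜 (n + 2)} {S₁ S₂ : FrobeniusData 𝕜 (n + 2)}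
    (hdet : IsUnit (S₂.metric p).det) (hmet : S₁.metric p = S₂.metric p)
    (hE : S₁.euler p = S₂.euler p) (hΩ : S₁.intersectionForm p = S₂.intersectionForm p)
    (v w : Pt 𝕜 (n + 2)) :
    S₁.pair p (S₁.mul p v w) (S₂.euler p) = S₂.pair p (S₂.mul p v w) (S₂.euler p) := by
  -- the rows of the contravariant metric are a basis of the tangent space
  have hexp : ∀ v : Pt 𝕜 (n + 2),
      v = ∑ a, (Matrix.vecMul v (S₂.metric p)) a • S₂.cometric p a := fun v => by
    have h1 : Matrix.vecMul (Matrix.vecMul v (S₂.metric p)) (S₂.cometric p) = v := by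
      rw [Matrix.vecMul_vecMul, FrobeniusData.cometric, Matrix.mul_nonsing_inv _ hdet,
        Matrix.vecMul_one]
    conv_lhs => rw [← h1]
    ext k
    simp [Matrix.vecMul, dotProduct]
  have e : ∀ C, cubicForm C v w (S₂.euler p) = ∑ a, ∑ b, Matrix.vecMul v (S₂.metric p) a *
      (Matrix.vecMul w (S₂.metric p) b *
        cubicForm C (S₂.cometric p a) (S₂.cometric p b) (S₂.euler p)) := fun C => by
    conv_lhs => rw [hexp v, hexp w]
    exact cubicForm_sum_sum C _ _ _ _
  rw [pair_mul_eq_cubicForm, pair_mul_eq_cubicForm, e, e]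
  refine Finset.sum_congr rfl fun a _ => Finset.sum_congr rfl fun b _ => ?_
  congr 2
  have h2 := congrFun (congrFun hΩ a) b
  simp only [FrobeniusData.intersectionForm, Matrix.of_apply, pair_mul_eq_cubicForm, hE] at h2
  rwa [show S₁.cometric p = S₂.cometric p by
    rw [FrobeniusData.cometric, FrobeniusData.cometric, hmet]] at h2

/-- The data which determine a conjugate structure agree with those of `conjData`. -/
theorem IsConjugate.data_eq (h : StandardForm M S F d) (hℓ : IsLogSqBranch Λ ℓ)
    (hS' : IsConjugate (conjDomain M Λ) S (fun t => t 0) (powBranch ℓ (2 / (1 - S.charge))) S')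
    (ht : t ∈ conjDomain M Λ) :
    S'.metric t = (conjData S d ℓ).metric t ∧ S'.unit t = (conjData S d ℓ).unit t ∧
      S'.euler t = (conjData S d ℓ).euler t ∧
      S'.intersectionForm t = (conjData S d ℓ).intersectionForm t := by
  obtain ⟨-, -, hF', -, -, hp'⟩ := hS'
  obtain ⟨-, -, hF₀, -, -, hp₀⟩ := isConjugate_conjData h hℓ
  obtain ⟨a1, a2, a3, a4⟩ := hp' t ht
  obtain ⟨b1, b2, b3, b4⟩ := hp₀ t ht
  refine ⟨?_, a3.trans b3.symm, a4.trans b4.symm, a2.symm.trans b2⟩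
  have e : (S'.metric t)⁻¹ = ((conjData S d ℓ).metric t)⁻¹ := a1.symm.trans b1
  rw [← Matrix.nonsing_inv_nonsing_inv _ (hF'.metric_nondeg t ht), e,
    Matrix.nonsing_inv_nonsing_inv _ (hF₀.metric_nondeg t ht)]

theorem pair_congr {r : ℕ} {S₁ S₂ : FrobeniusData 𝕜 r} {p : Pt 𝕜 r}
    (h : S₁.metric p = S₂.metric p) (v w : Pt 𝕜 r) : S₁.pair p v w = S₂.pair p v w := by
  rw [FrobeniusData.pair, FrobeniusData.pair, h]

/-- The difference of the multiplications of two conjugate structures vanishes. Its components `T`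
in the conjugate coordinates and their first derivatives are totally symmetric, and `T` is
annihilated by the unit and by the Euler field; differentiating `T(∂ᵢ, ∂ⱼ, E) = 0` gives
`(δᵢ + δⱼ + 2 - d₁) T = 0` for all pairs of the three indices. By the condition `dᵢ ≠ d₁/2` this
leaves only `T₁₁₁`, which vanishes because `E` annihilates `T`. -/
theorem IsConjugate.coordMul_eq (h : StandardForm M S F d) (hreg : ∀ i, d i ≠ d 0 / 2)
    (hℓ : IsLogSqBranch Λ ℓ)
    (hS' : IsConjugate (conjDomain M Λ) S (fun t => t 0) (powBranch ℓ (2 / (1 - S.charge))) S')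
    (ht : t ∈ conjDomain M Λ) (i j k : Fin (n + 2)) :
    coordMul S' (conjCoord d ℓ) i j k t = coordMul (conjData S d ℓ) (conjCoord d ℓ) i j k t := by
  have hd := h.isEulerWeight
  have hF' : IsFrobenius (conjDomain M Λ) S' := hS'.2.2.1
  have hF₀ := isFrobenius_conjData h hℓ
  have hx := isCoordinateSystem_conjDomain (M := M) hd hℓ
  have hU := hF₀.isOpen
  have hch₀ : (conjData S d ℓ).charge = 1 + d 0 := by simp only [conjData, h.charge_eq]; ring
  have hch' : S'.charge = 1 + d 0 := by rw [hS'.2.2.2.1, h.charge_eq]; ring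
  have hE₀ : ∀ t ∈ conjDomain M Λ, (conjData S d ℓ).euler t = -diagField d t := fun _ _ => rfl
  have hE' : ∀ t ∈ conjDomain M Λ, S'.euler t = -diagField d t := fun t ht =>
    (hS'.data_eq h hℓ ht).2.2.1
  have hη₀ : ∀ t ∈ conjDomain M Λ, ∀ i j, (conjData S d ℓ).pair t
      (coordField (conjCoord d ℓ) i t) (coordField (conjCoord d ℓ) j t)
      = (Matrix.of fun i j : Fin (n + 2) => if j = Fin.rev i then (1 : 𝕜) else 0) i j :=
    fun t ht i j => pair_coordField_conjData hd hℓ ht.2 i j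
  have hη' : ∀ t ∈ conjDomain M Λ, ∀ i j, S'.pair t
      (coordField (conjCoord d ℓ) i t) (coordField (conjCoord d ℓ) j t)
      = (Matrix.of fun i j : Fin (n + 2) => if j = Fin.rev i then (1 : 𝕜) else 0) i j :=
    fun t ht i j => by rw [pair_congr (hS'.data_eq h hℓ ht).1, hη₀ t ht]
  set δ := conjDegree d with hδ
  set s := conjCoord d ℓ with hs
  set T : Fin (n + 2) → Fin (n + 2) → Fin (n + 2) → Pt 𝕜 (n + 2) → 𝕜 :=
    fun i j k t => coordMul S' s i j k t - coordMul (conjData S d ℓ) s i j k t with hT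
  have T12 : ∀ t ∈ conjDomain M Λ, ∀ i j k, T i j k t = T j i k t := fun t ht i j k => by
    simp only [hT]; rw [coordMul_comm_left hF' ht, coordMul_comm_left hF₀ ht]
  have T23 : ∀ t ∈ conjDomain M Λ, ∀ i j k, T i j k t = T i k j t := fun t ht i j k => by
    simp only [hT]; rw [coordMul_comm_right hF' ht, coordMul_comm_right hF₀ ht]
  have Tdiff : ∀ t ∈ conjDomain M Λ, ∀ l i j k, HasDirDeriv (T i j k)
      (coordDeriv s l (T i j k) t) t (coordField s l t) := fun t ht l i j k =>
    ⟨((contDiffOn_coordMul hF' hx i j k).sub (contDiffOn_coordMul hF₀ hx i j k)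
      ).differentiableAt_of_isOpen hU ht, rfl⟩
  have Tder : ∀ t ∈ conjDomain M Λ, ∀ l i j k,
      coordDeriv s l (T i j k) t = coordDeriv s i (T l j k) t := by
    intro t ht l i j k
    have e : ∀ l i j k, coordDeriv s l (T i j k) t = coordDeriv s l (coordMul S' s i j k) t
        - coordDeriv s l (coordMul (conjData S d ℓ) s i j k) t := fun l i j k =>
      (HasDirDeriv.sub
        (⟨(contDiffOn_coordMul hF' hx i j k).differentiableAt_of_isOpen hU ht, rfl⟩ :
          HasDirDeriv (coordMul S' s i j k) (coordDeriv s l (coordMul S' s i j k) t) t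
            (coordField s l t))
        (⟨(contDiffOn_coordMul hF₀ hx i j k).differentiableAt_of_isOpen hU ht, rfl⟩ :
          HasDirDeriv (coordMul (conjData S d ℓ) s i j k)
            (coordDeriv s l (coordMul (conjData S d ℓ) s i j k) t) t (coordField s l t))).2
    rw [e, e, coordDeriv_coordMul_comm hF' hx hη' ht l i j k,
      coordDeriv_coordMul_comm hF₀ hx hη₀ ht l i j k]
  have Tdeg : ∀ t ∈ conjDomain M Λ, ∀ i j k, fderiv 𝕜 (T i j k) t (diagField d t)
      = (d 0 - 2 - δ i - δ j - δ k) * T i j k t := fun t ht i j k =>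
    ((hasDegree_coordMul hd hℓ hF' hch' hE' ht i j k).sub
      (hasDegree_coordMul hd hℓ hF₀ hch₀ hE₀ ht i j k)).2
  have TE : ∀ t ∈ conjDomain M Λ, ∀ i j, ∑ k, δ k * s t k * T i j k t = 0 := by
    intro t ht i j
    obtain ⟨e1, -, e3, e4⟩ := hS'.data_eq h hℓ ht
    have h1 := pair_mul_euler_eq (hF₀.metric_nondeg t ht) e1 e3 e4
      (coordField s i t) (coordField s j t)
    have h2 : (conjData S d ℓ).euler t = ∑ k, (-(δ k * s t k)) • coordField s k t := by
      conv_lhs => rw [eq_sum_coordField hx ht ((conjData S d ℓ).euler t)]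
      refine Finset.sum_congr rfl fun k _ => ?_
      rw [hE₀ t ht, map_neg, Pi.neg_apply, fderiv_conjCoord_diagField hd hℓ ht.2]
    have h3 : ∀ C : Fin (n + 2) → Fin (n + 2) → Fin (n + 2) → 𝕜, ∀ u v,
        cubicForm C u v (∑ k, (-(δ k * s t k)) • coordField s k t)
          = -∑ k, δ k * s t k * cubicForm C u v (coordField s k t) := fun C u v => by
      have := map_sum (IsLinearMap.mk' _ (isLinearMap_cubicForm_right C u v))
        (fun k => (-(δ k * s t k)) • coordField s k t) Finset.univ
      simp only [map_smul, IsLinearMap.mk'_apply, smul_eq_mul, neg_mul,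
        Finset.sum_neg_distrib] at this
      exact this
    rw [h2, pair_mul_eq_cubicForm, pair_mul_eq_cubicForm, h3, h3, neg_inj] at h1
    simp only [hT, mul_sub, Finset.sum_sub_distrib, coordMul, pair_mul_eq_cubicForm]
    exact sub_eq_zero.2 h1
  -- the derivative of `TE` along `∂/∂sˡ`, simplified by the symmetry and homogeneity of `T`
  have Trel : ∀ i j l, (d 0 - 2 - δ i - δ j) * T i j l t = 0 := by
    intro i j l
    have h1 : HasDirDeriv (fun q => ∑ k, δ k * s q k * T i j k q)
        (∑ k, (δ k * (if k = l then 1 else 0) * T i j k t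
          + δ k * s t k * coordDeriv s l (T i j k) t)) t (coordField s l t) :=
      HasDirDeriv.sum fun k _ => (HasDirDeriv.const_mul (δ k)
        (⟨(hx.contDiffOn_coord k).differentiableAt_of_isOpen hU ht, coordDeriv_coord hx hU ht l k⟩ :
          HasDirDeriv (fun q => s q k) (if k = l then 1 else 0) t (coordField s l t))).mul
        (Tdiff t ht l i j k)
    have h2 : HasDirDeriv (fun q => ∑ k, δ k * s q k * T i j k q) 0 t (coordField s l t) := by
      refine (HasDirDeriv.const 0 _ _).congr_of_eventuallyEq ?_
      filter_upwards [hU.mem_nhds ht] with q hq using TE q hq i j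
    have h3 := h1.2.symm.trans h2.2
    have h4 : ∀ k, coordDeriv s l (T i j k) t = coordDeriv s k (T i j l) t := fun k => by
      have e : ∀ k, EqOn (T i j k) (T k i j) (conjDomain M Λ) := fun k q hq => by
        rw [T23 q hq i j k, T12 q hq]
      rw [coordDeriv_congr hU (e k) l ht, Tder t ht, coordDeriv_congr hU (e l) k ht]
    have h5 := Tdeg t ht i j l
    rw [fderiv_eq_sum_coordDeriv hx ht] at h5
    simp only [show ∀ k, fderiv 𝕜 s t (diagField d t) k = δ k * s t k from
      fderiv_conjCoord_diagField hd hℓ ht.2] at h5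
    simp only [h4, Finset.sum_add_distrib, mul_ite, mul_one, mul_zero, ite_mul, zero_mul,
      Finset.sum_ite_eq', Finset.mem_univ, if_true] at h3
    linear_combination h3 - h5
  have Tlast : ∀ i j, T i j (Fin.last (n + 1)) t = 0 := by
    intro i j
    have hu : coordField s (Fin.last (n + 1)) t = (conjData S d ℓ).unit t :=
      ((isFlatCoordinates_conjData h hℓ).2.2 t ht).symm
    have hu' : coordField s (Fin.last (n + 1)) t = S'.unit t := by
      rw [hu, (hS'.data_eq h hℓ ht).2.1]
    simp only [hT, coordMul]
    rw [hF'.pair_mul t ht, hF₀.pair_mul t ht, hF'.mul_comm t ht, hF₀.mul_comm t ht]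
    nth_rw 1 [hu']
    rw [hu]
    rw [hF'.unit_mul t ht, hF₀.unit_mul t ht, hη' t ht, hη₀ t ht, sub_self]
  -- if `T i j l ≠ 0`, the three relations determine each of the degrees, `δ i = d 0 / 2 - 1`,
  -- which is excluded for `0 < i < last`
  have Tpos : ∀ i j l, i ≠ 0 → T i j l t = 0 := by
    intro i j l hi
    by_cases hl : i = Fin.last (n + 1)
    · rw [hl, T12 t ht, T23 t ht, Tlast]
    by_contra hne
    have e1 := (mul_eq_zero.1 (Trel i j l)).resolve_right hne
    have e2 := (mul_eq_zero.1 (Trel i l j)).resolve_right (by rwa [T23 t ht])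
    have e3 := (mul_eq_zero.1 (Trel j l i)).resolve_right (by rwa [T23 t ht, T12 t ht])
    have e4 : δ i = d 0 - d i := by simp only [hδ, conjDegree, if_neg hi, if_neg hl]
    refine hreg (Fin.rev i) ?_
    linear_combination h.deg_add' i - e4 - (1 / 2) * (e1 + e2 - e3)
  have T000 : T 0 0 0 t = 0 := by
    have h1 := TE t ht 0 0
    rw [Finset.sum_eq_single 0 (fun k _ hk => by
      rw [T23 t ht, T12 t ht, Tpos _ _ _ hk, mul_zero]) (by simp)] at h1
    have hδ0 : δ 0 = d 0 := by simp [hδ, conjDegree]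
    have hs0 : s t 0 = -t 0 := by simp [hs, conjCoord]
    rw [hδ0, hs0] at h1
    exact (mul_eq_zero.1 h1).resolve_left
      (mul_ne_zero hd.ne_zero (neg_ne_zero.2 (hℓ.ne_zero ht.2)))
  rw [← sub_eq_zero]
  change T i j k t = 0
  by_cases hi : i = 0
  · by_cases hj : j = 0
    · by_cases hk : k = 0
      · rw [hi, hj, hk, T000]
      · rw [T23 t ht, T12 t ht, Tpos _ _ _ hk]
    · rw [T12 t ht, Tpos _ _ _ hj]
  · exact Tpos _ _ _ hi

/-- The multiplication of a conjugate structure is unique. -/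
theorem IsConjugate.mul_eq (h : StandardForm M S F d) (hreg : ∀ i, d i ≠ d 0 / 2)
    (hℓ : IsLogSqBranch Λ ℓ)
    (hS' : IsConjugate (conjDomain M Λ) S (fun t => t 0) (powBranch ℓ (2 / (1 - S.charge))) S')
    (ht : t ∈ conjDomain M Λ) (u v : Pt 𝕜 (n + 2)) :
    S'.mul t u v = (conjData S d ℓ).mul t u v := by
  have hx := isCoordinateSystem_conjDomain (M := M) h.isEulerWeight hℓ
  have hmet := (hS'.data_eq h hℓ ht).1
  rw [← sub_eq_zero]
  refine (isFrobenius_conjData h hℓ).eq_zero_of_pair_eq_zero ht fun w => ?_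
  have h1 : S'.pair t (S'.mul t u v) w = (conjData S d ℓ).pair t ((conjData S d ℓ).mul t u v) w := by
    rw [eq_sum_coordField hx ht u, eq_sum_coordField hx ht v, eq_sum_coordField hx ht w,
      pair_mul_eq_cubicForm, pair_mul_eq_cubicForm]
    have e := fun C => cubicForm_sum C (fun a => coordField (conjCoord d ℓ) a t)
      (fderiv 𝕜 (conjCoord d ℓ) t u) (fderiv 𝕜 (conjCoord d ℓ) t v) (fderiv 𝕜 (conjCoord d ℓ) t w)
    rw [e, e]
    congr 1
    funext i j k
    rw [← pair_mul_eq_cubicForm, ← pair_mul_eq_cubicForm]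
    exact hS'.coordMul_eq h hreg hℓ ht i j k
  rw [pair_congr hmet] at h1
  rw [FrobeniusData.pair] at h1 ⊢
  rw [FrobeniusData.pair] at h1
  simp only [Pi.sub_apply, mul_sub, sub_mul, Finset.sum_sub_distrib]
  exact sub_eq_zero.2 h1

theorem IsConjugate.isFlatCoordinates (h : StandardForm M S F d) (hℓ : IsLogSqBranch Λ ℓ)
    (hS' : IsConjugate (conjDomain M Λ) S (fun t => t 0) (powBranch ℓ (2 / (1 - S.charge))) S') :
    IsFlatCoordinates (conjDomain M Λ) S' (conjCoord d ℓ) := by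
  obtain ⟨h1, ⟨η, h2⟩, h3⟩ := isFlatCoordinates_conjData h hℓ
  refine ⟨h1, ⟨η, fun t ht i j => ?_⟩, fun t ht => ?_⟩
  · rw [pair_congr (hS'.data_eq h hℓ ht).1, h2 t ht]
  · rw [(hS'.data_eq h hℓ ht).2.1, h3 t ht]

theorem IsConjugate.isPotential (h : StandardForm M S F d) (hreg : ∀ i, d i ≠ d 0 / 2)
    (hℓ : IsLogSqBranch Λ ℓ)
    (hS' : IsConjugate (conjDomain M Λ) S (fun t => t 0) (powBranch ℓ (2 / (1 - S.charge))) S') :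
    IsPotential (conjDomain M Λ) S' (conjCoord d ℓ) (conjPotential d ℓ F) := by
  obtain ⟨h1, h2, A, B, c₀, h3⟩ := isPotential_conjData h hℓ
  refine ⟨h1, fun t ht i j k => ?_, A, B, c₀, fun t ht => ?_⟩
  · rw [pair_congr (hS'.data_eq h hℓ ht).1, hS'.mul_eq h hreg hℓ ht, h2 t ht]
  · rw [(hS'.data_eq h hℓ ht).2.2.1, h3 t ht, hS'.2.2.2.1]
    rfl

end Uniqueness

/-! ### Existence of branches of the logarithm of the square -/

section Covering

variable {𝕜 : Type*} [RCLike 𝕜]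

theorem exists_exp_eq_sq {x : 𝕜} (hx : x ≠ 0) : ∃ c : 𝕜, NormedSpace.exp c = x ^ 2 := by
  have hcont : Continuous (RCLike.ofReal : ℝ → 𝕜) := RCLike.continuous_ofReal
  rcases RCLike.I_eq_zero_or_im_I_eq_one (K := 𝕜) with hI | hI
  · have hxr : (RCLike.ofReal (RCLike.re x) : 𝕜) = x := by
      conv_rhs => rw [← RCLike.re_add_im x, hI, mul_zero, add_zero]
    have hr : RCLike.re x ≠ 0 := fun h => hx (by rw [← hxr, h, RCLike.ofReal_zero])
    refine ⟨RCLike.ofReal (Real.log (RCLike.re x ^ 2)), ?_⟩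
    have := NormedSpace.map_exp (algebraMap ℝ 𝕜) (RCLike.continuous_ofReal)
      (Real.log (RCLike.re x ^ 2))
    rw [← Real.exp_eq_exp_ℝ, Real.exp_log (by positivity)] at this
    rw [← hxr, ← RCLike.ofReal_pow, RCLike.ofReal_re]
    exact this.symm
  · set e := RCLike.complexRingEquiv hI with he
    have hc : Continuous e.symm := (RCLike.complexLinearIsometryEquiv hI).symm.continuous
    have h := NormedSpace.map_exp e.symm hc (2 * Complex.log (e x))
    refine ⟨e.symm (2 * Complex.log (e x)), ?_⟩
    rw [← h, ← Complex.exp_eq_exp_ℂ, two_mul, Complex.exp_add, Complex.exp_log (by simpa using hx),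
      map_mul, e.symm_apply_apply, sq]

/-- Near every nonzero point there is a branch of `log (x²)`: a local inverse of the exponential
function at a logarithm of `x²`. -/
theorem exists_isLogSqBranch {x : 𝕜} (hx : x ≠ 0) :
    ∃ (Λ : Set 𝕜) (ℓ : 𝕜 → 𝕜), x ∈ Λ ∧ IsLogSqBranch Λ ℓ := by
  obtain ⟨c, hc⟩ := exists_exp_eq_sq hx
  have hsm : ∀ z : 𝕜, ContDiffAt 𝕜 ∞ (NormedSpace.exp : 𝕜 → 𝕜) z := fun z =>
    contDiff_exp_rclike.contDiffAt
  have hstr := (hsm c).hasStrictDerivAt' (hasDerivAt_exp_rclike c) (by simp)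
  set e := (hstr.hasStrictFDerivAt_equiv (exp_ne_zero_rclike c)).toOpenPartialHomeomorph
    (NormedSpace.exp : 𝕜 → 𝕜) with he
  have hcoe : (e : 𝕜 → 𝕜) = NormedSpace.exp := rfl
  have hmem : x ^ 2 ∈ e.target := by
    rw [← hc]
    exact HasStrictFDerivAt.image_mem_toOpenPartialHomeomorph_target _
  have hsq : ContDiff 𝕜 ∞ fun y : 𝕜 => y ^ 2 := contDiff_id.pow 2
  refine ⟨{y | y ^ 2 ∈ e.target} \ {0}, fun y => e.symm (y ^ 2), ⟨hmem, hx⟩, ?_, ?_, ?_, ?_⟩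
  · exact (e.open_target.preimage hsq.continuous).sdiff isClosed_singleton
  · simp
  · intro y hy
    refine (ContDiffAt.comp y (g := e.symm) ?_ hsq.contDiffAt).contDiffWithinAt
    exact e.contDiffAt_symm_deriv (exp_ne_zero_rclike _) hy.1 (hasDerivAt_exp_rclike _) (hsm _)
  · intro y hy
    exact e.right_inv hy.1

end Covering

/-! ### Comparison with the inversion -/

section Inversion

variable {𝕜 : Type*} [RCLike 𝕜] {n : ℕ} {d : Fin (n + 2) → 𝕜} {Λ : Set 𝕜} {ℓ : 𝕜 → 𝕜}
  {t : Pt 𝕜 (n + 2)}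

theorem eulerFlow_zero : eulerFlow d 0 t = t := by
  ext i; simp [eulerFlow]

theorem hasDerivAt_eulerFlow (σ z : 𝕜) :
    HasDerivAt (fun z => eulerFlow d (z * σ) t) (σ • diagField d (eulerFlow d (z * σ) t)) z := by
  refine hasDerivAt_pi.2 fun i => ?_
  have h1 : HasDerivAt (fun z : 𝕜 => d i * (z * σ)) (d i * (1 * σ)) z :=
    ((hasDerivAt_id z).mul_const σ).const_mul (d i)
  refine (((hasDerivAt_exp_rclike _).comp z h1).mul_const (t i)).congr_deriv ?_
  simp only [Pi.smul_apply, diagField, eulerFlow, smul_eq_mul]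
  ring

/-- A quasihomogeneous function is determined along a segment of the Euler flow by its value at the
starting point. -/
theorem eval_eulerFlow_of_homogeneous {N : Set (Pt 𝕜 (n + 2))} {f : Pt 𝕜 (n + 2) → 𝕜} {c σ : 𝕜}
    (hN : IsOpen N) (hf : ContDiffOn 𝕜 ∞ f N)
    (hc : ∀ q ∈ N, fderiv 𝕜 f q (diagField d q) = c * f q)
    (hmem : ∀ u ∈ Icc (0 : ℝ) 1, eulerFlow d ((u : 𝕜) * σ) t ∈ N) :
    f (eulerFlow d σ t) = NormedSpace.exp (c * σ) * f t := by
  set Φ : 𝕜 → 𝕜 := fun z => NormedSpace.exp (-c * (z * σ)) * f (eulerFlow d (z * σ) t) with hΦ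
  have h1 : ∀ u ∈ Icc (0 : ℝ) 1, HasDerivAt Φ 0 (u : 𝕜) := fun u hu => by
    have a1 : HasDerivAt (fun z : 𝕜 => -c * (z * σ)) (-c * (1 * σ)) (u : 𝕜) :=
      ((hasDerivAt_id _).mul_const σ).const_mul (-c)
    have a2 := (hasDerivAt_exp_rclike _).comp (u : 𝕜) a1
    have a3 := (hf.differentiableAt_of_isOpen hN (hmem u hu)).hasFDerivAt.comp_hasDerivAt (u : 𝕜)
      (hasDerivAt_eulerFlow σ (u : 𝕜))
    rw [map_smul, hc _ (hmem u hu), smul_eq_mul] at a3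
    refine (a2.mul a3).congr_deriv ?_
    simp only [Function.comp_apply]
    ring
  have h2 : ∀ u ∈ Icc (0 : ℝ) 1, HasDerivAt (fun u : ℝ => Φ (u : 𝕜)) 0 u := fun u hu => by
    have a := HasDerivAt.scomp u (h1 u hu) (RCLike.ofRealCLM (K := 𝕜)).hasDerivAt
    rw [smul_zero] at a
    exact a
  have h3 := constant_of_has_deriv_right_zero (f := fun u : ℝ => Φ (u : 𝕜))
    (fun u hu => (h2 u hu).continuousAt.continuousWithinAt)
    (fun u hu => (h2 u ⟨hu.1, hu.2.le⟩).hasDerivWithinAt) 1 (by simp)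
  simp only [hΦ, RCLike.ofReal_one, RCLike.ofReal_zero, one_mul, zero_mul, mul_zero,
    NormedSpace.exp_zero, eulerFlow_zero] at h3
  rw [← h3, ← mul_assoc, ← exp_add_rclike]
  simp

theorem eulerFlow_eq_flowFactor (i : Fin (n + 2)) :
    eulerFlow d (-ℓ (t 0) / d 0) t i = flowFactor d ℓ i t * t i := by
  rw [eulerFlow, flowFactor, powBranch]; congr 2; ring

theorem eulerFlow_apply_zero (hd : IsEulerWeight d) (hℓ : IsLogSqBranch Λ ℓ) (ht : t 0 ∈ Λ) :
    eulerFlow d (-ℓ (t 0) / d 0) t 0 = (t 0)⁻¹ := by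
  have h0 := hℓ.ne_zero ht
  rw [eulerFlow_eq_flowFactor, flowFactor_zero hd hℓ ht]; field_simp

theorem antiQuad_eulerFlow (hd : IsEulerWeight d) (hℓ : IsLogSqBranch Λ ℓ) (ht : t 0 ∈ Λ) :
    antiQuad (eulerFlow d (-ℓ (t 0) / d 0) t) = confFactor d ℓ t * (t 0 ^ 2)⁻¹ * antiQuad t := by
  rw [antiQuad, antiQuad, Finset.mul_sum]
  refine Finset.sum_congr rfl fun i _ => ?_
  rw [eulerFlow_eq_flowFactor, eulerFlow_eq_flowFactor, ← flowFactor_mul_rev hd hℓ ht i]; ring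

/-- The conjugate coordinates are the inversion coordinates after the Euler flow at time
`-ℓ(t¹)/d₁`, which moves `t¹` to `1/t¹`. -/
theorem invCoord_eulerFlow (hd : IsEulerWeight d) (hℓ : IsLogSqBranch Λ ℓ) (ht : t 0 ∈ Λ) :
    invCoord (eulerFlow d (-ℓ (t 0) / d 0) t) = conjCoord d ℓ t := by
  have h0 := hℓ.ne_zero ht
  ext i
  simp only [invCoord, conjCoord, eulerFlow_apply_zero hd hℓ ht, antiQuad_eulerFlow hd hℓ ht]
  split_ifs with hi hl
  · field_simp
  · rw [confFactor]; field_simp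
  · rw [eulerFlow_eq_flowFactor, flowFactor]; field_simp

theorem injOn_invCoord : InjOn invCoord {q : Pt 𝕜 (n + 2) | q 0 ≠ 0} := by
  intro p hp q hq h
  have h0 : p 0 = q 0 := by
    have := congrFun h 0
    simp only [invCoord, if_true] at this
    rwa [neg_div, neg_div, neg_inj, one_div, one_div, inv_inj] at this
  have hp0 : p 0 ≠ 0 := hp
  have hmid : ∀ i, i ≠ Fin.last (n + 1) → p i = q i := by
    intro i hl
    by_cases hi : i = 0
    · rw [hi, h0]
    · have := congrFun h i
      simp only [invCoord, if_neg hi, if_neg hl, ← h0] at this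
      exact (div_left_inj' hp0).1 this
  have hQ : antiQuad p = antiQuad q := by
    have := congrFun h (Fin.last (n + 1))
    simp only [invCoord, if_neg zero_ne_last.symm, if_true, ← h0] at this
    exact (div_left_inj' (mul_ne_zero two_ne_zero hp0)).1 this
  exact eq_of_antiQuad_eq hp0 hmid hQ

/-- The potential of the conjugate structure is obtained by inversion from the continuation of the
given potential along the Euler flow. -/
theorem inversionPotential_conjCoord (hd : IsEulerWeight d) (hℓ : IsLogSqBranch Λ ℓ)
    (ht : t 0 ∈ Λ) {N : Set (Pt 𝕜 (n + 2))} {f : Pt 𝕜 (n + 2) → 𝕜}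
    (hN : IsOpen N) (hf : ContDiffOn 𝕜 ∞ f N)
    (hc : ∀ q ∈ N, fderiv 𝕜 f q (diagField d q) = (2 + d 0) * f q)
    (hmem : ∀ u ∈ Icc (0 : ℝ) 1, eulerFlow d ((u : 𝕜) * (-ℓ (t 0) / d 0)) t ∈ N) :
    conjCoord d ℓ t ∈ invCoord '' {q | q ∈ N ∧ q 0 ≠ 0} ∧
      inversionPotential N f (conjCoord d ℓ t) = conjPotential d ℓ f t := by
  have h0 := hℓ.ne_zero ht
  have hd0 := hd.ne_zero
  set q := eulerFlow d (-ℓ (t 0) / d 0) t with hq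
  have hq0 : q 0 = (t 0)⁻¹ := eulerFlow_apply_zero hd hℓ ht
  have hqN : q ∈ {q | q ∈ N ∧ q 0 ≠ 0} :=
    ⟨by simpa using hmem 1 (by simp), by rw [hq0]; exact inv_ne_zero h0⟩
  have hqs : invCoord q = conjCoord d ℓ t := invCoord_eulerFlow hd hℓ ht
  have hinv : Function.invFunOn invCoord {q | q ∈ N ∧ q 0 ≠ 0} (conjCoord d ℓ t) = q := by
    rw [← hqs]
    exact (injOn_invCoord.mono fun _ h => h.2).leftInvOn_invFunOn hqN
  refine ⟨⟨q, hqN, hqs⟩, ?_⟩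
  have hfq : f q = confFactor d ℓ t ^ 2 * (t 0 ^ 2)⁻¹ * f t := by
    rw [hq, eval_eulerFlow_of_homogeneous hN hf hc hmem, confFactor, sq,
      ← hℓ.powBranch_neg_two ht, ← powBranch_add, ← powBranch_add, powBranch]
    congr 2
    field_simp
    ring
  have hlast : q (Fin.last (n + 1)) = confFactor d ℓ t * t (Fin.last (n + 1)) := by
    rw [hq, eulerFlow_eq_flowFactor, flowFactor_last hd]
  have hρ : powBranch ℓ (-4 / d 0) (t 0) = confFactor d ℓ t ^ 2 := by
    rw [confFactor, sq, ← powBranch_add]; congr 1; ring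
  simp only [inversionPotential, hinv]
  rw [conjPotential, hfq, hq0, hlast, hq, antiQuad_eulerFlow hd hℓ ht, hρ]
  field_simp

end Inversion

/-! ### Conjugation and inversion -/

section EmptyDomain

variable {𝕜 : Type*} [RCLike 𝕜] {m : ℕ}

theorem isFrobenius_empty (S : FrobeniusData 𝕜 (m + 1)) : IsFrobenius ∅ S := by
  constructor <;> simp [contDiffOn_empty]

theorem isConjugate_empty (S S' : FrobeniusData 𝕜 (m + 1)) (τ : Pt 𝕜 (m + 1) → 𝕜) (f : 𝕜 → 𝕜)
    (hcharge : S'.charge = 2 - S.charge) : IsConjugate ∅ S τ f S' :=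
  ⟨⟨contDiffOn_empty, by simp⟩, by simp, isFrobenius_empty S', hcharge, contDiffOn_empty, by simp⟩

theorem isFlatCoordinates_empty (S : FrobeniusData 𝕜 (m + 1)) (x : Pt 𝕜 (m + 1) → Pt 𝕜 (m + 1)) :
    IsFlatCoordinates ∅ S x :=
  ⟨⟨contDiffOn_empty, by simp, by simp⟩, ⟨0, by simp⟩, by simp⟩

theorem isPotential_empty (S : FrobeniusData 𝕜 (m + 1)) (x : Pt 𝕜 (m + 1) → Pt 𝕜 (m + 1))
    (F : Pt 𝕜 (m + 1) → 𝕜) : IsPotential ∅ S x F :=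
  ⟨contDiffOn_empty, by simp, 0, 0, 0, by simp⟩

end EmptyDomain

end

theorem theorem1p2 {𝕜 : Type*} [RCLike 𝕜] {n : ℕ}
    -- a Frobenius manifold of dimension `r = n + 2` and charge `≠ 1`, with flat coordinates `t`
    (M : Set (Pt 𝕜 (n + 2))) (S : FrobeniusData 𝕜 (n + 2)) (hS : IsFrobenius M S)
    (hcharge : S.charge ≠ 1)
    (hflat : IsFlatCoordinates M S id)
    -- its potential has the standard form
    (F : Pt 𝕜 (n + 2) → 𝕜) (hF : IsPotential M S id F)
    (G : Pt 𝕜 (n + 1) → 𝕜)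
    (hstd : ∀ t ∈ M, F t = (1 / 2) * t (Fin.last (n + 1)) ^ 2 * t 0
      + (1 / 2) * t (Fin.last (n + 1)) *
          ∑ i ∈ Finset.Ioo (0 : Fin (n + 2)) (Fin.last (n + 1)), t i * t (Fin.rev i)
      + G (fun i => t i.castSucc))
    -- `E = ∑ dᵢ tⁱ ∂ᵢ`, `E F = (3 - d) F`, `dᵣ = 1`, and `dᵢ ≠ d₁ / 2` for all `i`
    (d : Fin (n + 2) → 𝕜)
    (hE : ∀ t ∈ M, ∀ i, S.euler t i = d i * t i)
    (hEF : ∀ t ∈ M, fderiv 𝕜 F t (S.euler t) = (3 - S.charge) * F t)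
    (hlast : d (Fin.last (n + 1)) = 1)
    (hreg : ∀ i, d i ≠ d 0 / 2) :
    -- the sets `U` below cover `M \ {t¹ = 0}`
    (∀ t ∈ M, t 0 ≠ 0 → ∃ (Λ : Set 𝕜) (ℓ : 𝕜 → 𝕜), t 0 ∈ Λ ∧ IsLogSqBranch Λ ℓ) ∧
    ∀ (Λ : Set 𝕜) (ℓ : 𝕜 → 𝕜), IsLogSqBranch Λ ℓ →
      ∀ U : Set (Pt 𝕜 (n + 2)), U = {t | t ∈ M ∧ t 0 ∈ Λ} →
      -- the conjugate Frobenius structure exists,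
      (∃ S' : FrobeniusData 𝕜 (n + 2),
        IsConjugate U S (fun t => t 0) (powBranch ℓ (2 / (1 - S.charge))) S') ∧
      -- it has the flat coordinates `s`, with antidiagonal metric, and the stated potential,
      (∀ S' : FrobeniusData 𝕜 (n + 2),
        IsConjugate U S (fun t => t 0) (powBranch ℓ (2 / (1 - S.charge))) S' →
          IsFlatCoordinates U S' (conjCoord d ℓ) ∧
          (∀ t ∈ U, ∀ i j,
            S'.pair t (coordField (conjCoord d ℓ) i t) (coordField (conjCoord d ℓ) j t)
              = if j = Fin.rev i then 1 else 0) ∧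
          IsPotential U S' (conjCoord d ℓ) (conjPotential d ℓ F)) ∧
      -- and this potential, as a function of `s`, is the potential obtained from `F` by inversion,
      -- as a function of `z = s`, with `F` continued by homogeneity along the Euler flow
      -- if necessary
      (∀ t ∈ U, ∀ (N : Set (Pt 𝕜 (n + 2))) (F' : Pt 𝕜 (n + 2) → 𝕜),
        IsOpen N → ContDiffOn 𝕜 ∞ F' N →
        (∀ q ∈ N, fderiv 𝕜 F' q (fun i => d i * q i) = (3 - S.charge) * F' q) →
        F' t = F t →
        (∀ u ∈ Icc (0 : ℝ) 1, eulerFlow d ((u : 𝕜) * (-ℓ (t 0) / d 0)) t ∈ N) →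
          conjCoord d ℓ t ∈ invCoord '' {q | q ∈ N ∧ q 0 ≠ 0} ∧
          inversionPotential N F' (conjCoord d ℓ t) = conjPotential d ℓ F t) := by
  refine ⟨fun t _ ht => exists_isLogSqBranch ht, fun Λ ℓ hℓ U hU => ?_⟩
  rcases M.eq_empty_or_nonempty with rfl | hne
  · obtain rfl : U = ∅ := by rw [hU]; simp
    exact ⟨⟨conjData S d ℓ, isConjugate_empty _ _ _ _ rfl⟩,
      fun S' _ => ⟨isFlatCoordinates_empty _ _, by simp, isPotential_empty _ _ _⟩, by simp⟩
  have h : StandardForm M S F d :=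
    standardForm_of_potential M S hS hcharge hflat F hF G hstd d hE hEF hlast hne
  have hd := h.isEulerWeight
  have hU' : U = conjDomain M Λ := hU
  subst hU'
  refine ⟨⟨conjData S d ℓ, isConjugate_conjData h hℓ⟩, fun S' hS' =>
    ⟨hS'.isFlatCoordinates h hℓ, fun t ht i j => ?_, hS'.isPotential h hreg hℓ⟩, ?_⟩
  · rw [pair_congr (hS'.data_eq h hℓ ht).1]
    exact pair_coordField_conjData hd hℓ ht.2 i j
  · intro t ht N F' hN hF' hEF' hFt hmem
    have hc : ∀ q ∈ N, fderiv 𝕜 F' q (diagField d q) = (2 + d 0) * F' q := fun q hq => by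
      rw [show (2 + d 0 : 𝕜) = 3 - S.charge by rw [h.charge_eq]; ring]
      exact hEF' q hq
    have := inversionPotential_conjCoord hd hℓ ht.2 hN hF' hc hmem
    rwa [conjPotential, hFt] at this
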